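/- Identify Minkowski space $\mathbb R^4_1=\mathbb R^3\times\mathbb R$, $\langle x,y\rangle=x_1y_1+x_2y_2+x_3y_3-x_4y_4$, with the set of oriented spheres of $\mathbb R^3$ ($(c,r)$ is the sphere with centre $c$ and signed radius $r$). A Legendre immersion of a surface is a smooth map $F=(f,n)$ into $\mathbb R^3\times S^2$ with $df\cdot n=0$ and $(df,dn)$ injective; it envelopes a map $S$ into $\mathbb R^4_1$ if $S(p)$ lies on the null line $\{(f(p)-t\,n(p),t):t\in\mathbb R\}$ for every $p$. Its third fundamental form is $\mathrm{III}=dn\cdot dn$; a direction $v\ne0$ is principal if $df(v)$ and $dn(v)$ are linearly dependent; a point is umbilic if all directions are principal there. **Theorem 1.** Let $M$ be a smooth surface and $S:M\to\mathbb R^4_1$ a smooth space-like immersion with flat induced metric and flat normal bundle. Then every point of $M$ has an open neighbourhood on which $S$ has exactly two envelopes: there are everywhere different Legendre immersions $F$ and $\hat F$ enveloping $S$ there, and any Legendre immersion enveloping $S$ on an open part of that neighbourhood agrees at each point with $F$ or with $\hat F$. Moreover, let $U\subseteq M$ be open and let $F=(f,n)$ and $\hat F=(\hat f,\hat n)$ be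 everywhere different Legendre immersions enveloping $S$ on $U$, whose third fundamental forms are positive definite. Then: 1. ($S$ is a Darboux sphere congruence.) The correspondence $F(p)\leftrightarrow\hat F(p)$ preserves curvature lines: at each $p\in U$ that is not umbilic for one of the two envelopes, every principal direction of that envelope is principal for the other. It is also conformal for the third fundamental forms: $\widehat{\mathrm{III}}_p=\rho(p)\,\mathrm{III}_p$ with $\rho(p)>0$ for all $p\in U$. 2. $F$ and $\hat F$ have opposite orientations, in the following sense: if $N=(-n,1)$ and $\hat N=(-\hat n,1)$ are the null normals of $S$ that belong to $F$ and $\hat F$, then the tangential parts of $dN$ and $d\hat N$, as maps $T_pM\to dS(T_pM)$, induce opposite orientations on $T_pM$, for each $p\in U$. 3. $F$ and $\hat F$ are both $L$-isothermic: about each point of $U$ there are coordinates $(x,y)$ whose coordinate lines are curvature lines and which are conformal for the third fundamental form; these can be chosen so that the differentials $(dx+i\,dy)^2$ agree on overlaps, i.e. form one holomorphic quadratic differential without zeros on $U$. -/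

import Mathlib

open scoped Manifold ContDiff

noncomputable section

/-- Euclidean 3-space. -/
abbrev E3 : Type := EuclideanSpace ℝ (Fin 3)

/-- The coordinate plane on which surfaces are modelled. -/
abbrev E2 : Type := EuclideanSpace ℝ (Fin 2)

/-- Minkowski 4-space `ℝ³ × ℝ`.  The point `(c, r)` stands for the oriented sphere of `ℝ³` with
centre `c` and signed radius `r` (a point sphere if `r = 0`).  The norm that Lean puts on the
product is used only for its topology and smooth structure. -/
abbrev R41 : Type := E3 × ℝ

/-- The Lorentz scalar product `x₁y₁ + x₂y₂ + x₃y₃ - x₄y₄`. -/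
def mink (x y : R41) : ℝ := inner ℝ x.1 y.1 - x.2 * y.2

/-- A contact element of `ℝ³`: a point together with a unit vector. -/
structure ContactElement where
  pt : E3
  normal : E3
  norm_normal : ‖normal‖ = 1

/-- The null line `{(x - t n, t)}` of Minkowski space given by a contact element `(x, n)`, i.e. the
set of all oriented spheres that are in oriented contact with `(x, n)`. -/
def ContactElement.line (e : ContactElement) : Set R41 :=
  {z | ∃ t : ℝ, z = (e.pt - t • e.normal, t)}

/-- The null direction `(-n, 1)` of the line of `(x, n)`. -/
def ContactElement.nullDir (e : ContactElement) : R41 := (-e.normal, 1)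

section Coordinates

/-! ### Curvature in coordinates -/

variable {V : Type*} [NormedAddCommGroup V] [NormedSpace ℝ V]

/-- Partial derivative in the `i`-th coordinate direction of the plane. -/
def pd (i : Fin 2) (φ : E2 → V) (u : E2) : V := fderiv ℝ φ u (EuclideanSpace.single i 1)

/-- Christoffel symbols `Γᵏᵢⱼ` of a metric `g` given in coordinates. -/
def christoffel (g : E2 → Matrix (Fin 2) (Fin 2) ℝ) (k i j : Fin 2) (u : E2) : ℝ :=
  (1 / 2) * ∑ l, (g u)⁻¹ k l *
    (pd i (fun w => g w j l) u + pd j (fun w => g w i l) u - pd l (fun w => g w i j) u)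

/-- Coefficients `Rˡₖᵢⱼ` of the Riemann curvature tensor,
`R(∂ᵢ, ∂ⱼ)∂ₖ = ∑ₗ Rˡₖᵢⱼ ∂ₗ`. -/
def riemannCoeff (g : E2 → Matrix (Fin 2) (Fin 2) ℝ) (l k i j : Fin 2) (u : E2) : ℝ :=
  pd i (christoffel g l j k) u - pd j (christoffel g l i k) u
    + ∑ m, (christoffel g l i m u * christoffel g m j k u
      - christoffel g l j m u * christoffel g m i k u)

/-- The metric that a parametrised surface `X` in Minkowski space induces. -/
def inducedMetric (X : E2 → R41) (u : E2) : Matrix (Fin 2) (Fin 2) ℝ :=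
  Matrix.of fun i j => mink (pd i X u) (pd j X u)

/-- The normal part of a vector `w` along a space-like parametrised surface `X`. -/
def normalPart (X : E2 → R41) (u : E2) (w : R41) : R41 :=
  w - ∑ k, ∑ l, ((inducedMetric X u)⁻¹ k l * mink w (pd k X u)) • pd l X u

/-- The normal connection: `∇^⊥ᵢ ξ` is the normal part of `∂ᵢ ξ`. -/
def normalDeriv (X : E2 → R41) (i : Fin 2) (ξ : E2 → R41) (u : E2) : R41 :=
  normalPart X u (pd i ξ u)

/-- The normal connection of the parametrised surface `X` has zero curvature on the open set `s`:
its covariant derivatives in the coordinate directions commute on all normal fields. -/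
def NormalCurvatureZeroOn (X : E2 → R41) (s : Set E2) : Prop :=
  ∀ ξ : E2 → R41, ContDiffOn ℝ ∞ ξ s →
    (∀ u ∈ s, ∀ i, mink (ξ u) (pd i X u) = 0) →
    ∀ u ∈ s, ∀ i j, normalDeriv X i (normalDeriv X j ξ) u = normalDeriv X j (normalDeriv X i ξ) u

end Coordinates

section Surfaces

variable {M : Type*} [TopologicalSpace M] [ChartedSpace E2 M]
variable {V : Type*} [NormedAddCommGroup V] [NormedSpace ℝ V]

/-- The differential at `p` of a map from the surface `M` to a vector space. -/
def diff (φ : M → V) (p : M) : TangentSpace (𝓡 2) p →L[ℝ] V := mfderiv (𝓡 2) 𝓘(ℝ, V) φ p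

/-! ### Space-like immersions into Minkowski space -/

/-- A smooth map whose induced bilinear form is positive definite (hence an immersion). -/
def IsSpacelikeImmersion (S : M → R41) : Prop :=
  ContMDiff (𝓡 2) 𝓘(ℝ, R41) ∞ S ∧
    ∀ (p : M) (v : TangentSpace (𝓡 2) p), v ≠ 0 → 0 < mink (diff S p v) (diff S p v)

/-- The induced metric is flat: its Riemann tensor vanishes in the charts of `M`. -/
def HasFlatInducedMetric (S : M → R41) : Prop :=
  ∀ p : M, ∀ u ∈ (chartAt E2 p).target, ∀ l k i j,
    riemannCoeff (inducedMetric (S ∘ (chartAt E2 p).symm)) l k i j u = 0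

/-- The normal bundle is flat: the normal connection has zero curvature in the charts of `M`. -/
def HasFlatNormalBundle (S : M → R41) : Prop :=
  ∀ p : M, NormalCurvatureZeroOn (S ∘ (chartAt E2 p).symm) (chartAt E2 p).target

/-! ### Legendre immersions and envelopes -/

/-- `F = (f, n)` is a Legendre immersion on the open set `U`: it is smooth there, satisfies the
contact condition `df · n = 0`, and `(df, dn)` is injective. -/
def IsLegendreImmersionOn (U : Set M) (F : M → ContactElement) : Prop :=
  ContMDiffOn (𝓡 2) 𝓘(ℝ, E3) ∞ (fun p => (F p).pt) U ∧
  ContMDiffOn (𝓡 2) 𝓘(ℝ, E3) ∞ (fun p => (F p).normal) U ∧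
  ∀ p ∈ U, ∀ v : TangentSpace (𝓡 2) p,
    inner ℝ (diff (fun q => (F q).pt) p v) (F p).normal = 0 ∧
    (diff (fun q => (F q).pt) p v = 0 → diff (fun q => (F q).normal) p v = 0 → v = 0)

/-- The Legendre immersion `F` envelopes the sphere congruence `S` on `U`: the sphere `S p` is in
oriented contact with the contact element `F p`. -/
def EnvelopesOn (S : M → R41) (U : Set M) (F : M → ContactElement) : Prop :=
  IsLegendreImmersionOn U F ∧ ∀ p ∈ U, S p ∈ (F p).line

/-- `F` and `G` are two (everywhere different) envelopes of `S` on `U`. -/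
def IsEnvelopingPairOn (S : M → R41) (U : Set M) (F G : M → ContactElement) : Prop :=
  EnvelopesOn S U F ∧ EnvelopesOn S U G ∧ ∀ p ∈ U, F p ≠ G p

/-- The third fundamental form `dn · dn`. -/
def thirdForm (F : M → ContactElement) (p : M) (v w : TangentSpace (𝓡 2) p) : ℝ :=
  inner ℝ (diff (fun q => (F q).normal) p v) (diff (fun q => (F q).normal) p w)

/-- The third fundamental form is positive definite on `U`: no parabolic points. -/
def ThirdFormPosDefOn (U : Set M) (F : M → ContactElement) : Prop :=
  ∀ p ∈ U, ∀ v : TangentSpace (𝓡 2) p, v ≠ 0 → 0 < thirdForm F p v v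

/-! ### Curvature lines -/

/-- `v ≠ 0` is a principal direction of `F = (f, n)`, i.e. tangent to a curvature line:
`df(v)` and `dn(v)` are linearly dependent (Rodrigues). -/
def IsPrincipal (F : M → ContactElement) (p : M) (v : TangentSpace (𝓡 2) p) : Prop :=
  v ≠ 0 ∧ ∃ a b : ℝ, (a ≠ 0 ∨ b ≠ 0) ∧
    a • diff (fun q => (F q).pt) p v + b • diff (fun q => (F q).normal) p v = 0

/-- All directions at `p` are principal. -/
def IsUmbilic (F : M → ContactElement) (p : M) : Prop :=
  ∀ v : TangentSpace (𝓡 2) p, v ≠ 0 → IsPrincipal F p v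

/-- The correspondence `F p ↔ G p` preserves curvature lines: wherever one of the two surfaces
is not umbilic, its principal directions are principal for the other surface. -/
def CurvatureLinesCorrespondOn (U : Set M) (F G : M → ContactElement) : Prop :=
  ∀ p ∈ U,
    (¬ IsUmbilic F p → ∀ v, IsPrincipal F p v → IsPrincipal G p v) ∧
    (¬ IsUmbilic G p → ∀ v, IsPrincipal G p v → IsPrincipal F p v)

/-- The correspondence `F p ↔ G p` is conformal for the third fundamental forms. -/
def ThirdFormsConformalOn (U : Set M) (F G : M → ContactElement) : Prop :=
  ∀ p ∈ U, ∃ ρ : ℝ, 0 < ρ ∧ ∀ v w, thirdForm G p v w = ρ * thirdForm F p v w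

/-- The Darboux condition for a congruence with envelopes `F`, `G` on `U`: Ribaucour, and
conformal for the third fundamental forms. -/
def DarbouxConditionOn (U : Set M) (F G : M → ContactElement) : Prop :=
  CurvatureLinesCorrespondOn U F G ∧ ThirdFormsConformalOn U F G

/-! ### Orientations -/

/-- The area form, pulled back to `M`, of the tangential part of the differential of the null normal
`N = (-n, 1)` of `F`; here `e₂, e₃` is an orthonormal basis of the tangent plane of the congruence.
A change of the null normal to `λ N` multiplies it by `λ²`. -/
def tangentialArea (F : M → ContactElement) (p : M) (e₂ e₃ : R41)
    (v w : TangentSpace (𝓡 2) p) : ℝ :=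
  mink (diff (fun q => (F q).nullDir) p v) e₂ * mink (diff (fun q => (F q).nullDir) p w) e₃ -
    mink (diff (fun q => (F q).nullDir) p v) e₃ * mink (diff (fun q => (F q).nullDir) p w) e₂

/-- The two envelopes `F`, `G` of `S` have opposite orientations: the tangential parts
`T_pM → dS(T_pM)` of the differentials of their null normals induce opposite orientations. -/
def OppositelyOrientedOn (S : M → R41) (U : Set M) (F G : M → ContactElement) : Prop :=
  ∀ p ∈ U, ∀ e₂ ∈ Set.range (diff S p), ∀ e₃ ∈ Set.range (diff S p),
    mink e₂ e₂ = 1 → mink e₃ e₃ = 1 → mink e₂ e₃ = 0 →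
    ∀ v w : TangentSpace (𝓡 2) p, LinearIndependent ℝ ![v, w] →
      tangentialArea F p e₂ e₃ v w * tangentialArea G p e₂ e₃ v w < 0

/-! ### L-isothermic surfaces -/

/-- `(x, y)` are conformal principal coordinates of `F` on `W`: smooth functions with independent
differentials, whose coordinate lines are curvature lines, and in which the third fundamental
form is a positive multiple of `dx² + dy²`. -/
def ConformalPrincipalCoordsOn (W : Set M) (F : M → ContactElement) (x y : M → ℝ) : Prop :=
  ContMDiffOn (𝓡 2) 𝓘(ℝ, ℝ) ∞ x W ∧ ContMDiffOn (𝓡 2) 𝓘(ℝ, ℝ) ∞ y W ∧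
  ∀ p ∈ W, LinearIndependent ℝ ![diff x p, diff y p] ∧
    (∃ c : ℝ, 0 < c ∧ ∀ v, thirdForm F p v v = c * (diff x p v ^ 2 + diff y p v ^ 2)) ∧
    ∀ v, v ≠ 0 → (diff x p v = 0 ∨ diff y p v = 0) → IsPrincipal F p v

/-- `F` is L-isothermic on the open set `U`: about each point there are conformal principal
coordinates `z = x + i y`, and these can be chosen so that the quadratic differentials `dz²` agree
on overlaps, i.e. they make up one holomorphic quadratic differential `q` on `U`. -/
def IsLIsothermicOn (U : Set M) (F : M → ContactElement) : Prop :=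
  ∃ q : (p : M) → TangentSpace (𝓡 2) p → ℂ,
    ∀ p ∈ U, ∃ (W : Set M) (x y : M → ℝ), IsOpen W ∧ p ∈ W ∧ W ⊆ U ∧
      ConformalPrincipalCoordsOn W F x y ∧
      ∀ p' ∈ W, ∀ v, q p' v = ((diff x p' v : ℂ) + (diff y p' v : ℂ) * Complex.I) ^ 2

end Surfaces

end

/-! Envelopes: `(-n, 1)` must be orthogonal to the tangent plane of `S`, which is two linear
equations for `n`. Their solutions form a line in ℝ³, and because the plane is space-like this line
meets the unit sphere in exactly two points, both depending smoothly on the point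
(`IsSpacelikePair.spanPart_lt`, `IsSpacelikePair.eq_unitNormal`, `exists_enveloping_pair`).

For a pair of envelopes with null normals `N`, `N̂`, flatness of the normal bundle says that ⟨dN,
N̂⟩/⟨N, N̂⟩ is closed (`normal_connection_form_closed`). So `N`, `N̂` can be rescaled locally by
positive functions to parallel null normals `P`, `Q` with ⟨P, Q⟩ = -1. Flatness of the metric,
through the Gauss equation (`gauss_null_normals`), lets an orthonormal tangent frame be rotated to a
parallel one `E₁`, `E₂` (`exists_isParallelFrameOn`).

In this frame put A = ⟨dP, E₁⟩ + i⟨dP, E₂⟩, B = ⟨dQ, E₁⟩ - i⟨dQ, E₂⟩ and σ = ⟨dS, E₁⟩ + i⟨dS, E₂⟩.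
The Ricci and Gauss equations are the real and imaginary parts of A ∧ B = 0
(`IsParallelFrameOn.frameForm_wedge_eq_zero`), and the Codazzi equations say that A and B are
closed. Positive third fundamental forms make A and B isomorphisms onto ℂ, hence B = μA with μ ≠ 0
complex. The rest of the theorem is read off from this relation.

The third forms are |A|² and |B|² up to positive factors, so they are conformal. The tangential part
of dQ is the conjugate of B, so it induces the opposite orientation. Write σ = αA + βĀ;
self-adjointness of the two shape operators makes α and μβ real, so Im(σ̄A) and Im(σB), whose zeros
are the principal directions of the two envelopes, are both real multiples of Im(AB)
(`exists_real_proportion_of_symmetric`). A vanishing multiple means an umbilic.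

Finally √μ·A is closed, so AB = dz² locally (`exists_coordinate_of_closed`); then |dz|² = |μ||A|² is
conformal to the third form, and Im(AB) = 2 dx dy vanishes on the coordinate lines. A rotation of
the frame leaves AB unchanged, a reflection conjugates it, and the scaling enters only through
-1/⟨N, N̂⟩; with frames oriented by the normal of `F`, AB is one global quadratic differential
(`IsOrientedFrame.frameForm_mul_eq`). -/

noncomputable section

/-! ### Linear algebra of Minkowski space and null bases -/

section MinkowskiAlgebra

lemma mink_comm (x y : R41) : mink x y = mink y x := by
  simp only [mink, real_inner_comm, mul_comm]

lemma mink_add_left (x y z : R41) : mink (x + y) z = mink x z + mink y z := by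
  simp only [mink, Prod.fst_add, Prod.snd_add, inner_add_left]; ring

lemma mink_smul_left (a : ℝ) (x z : R41) : mink (a • x) z = a * mink x z := by
  simp only [mink, Prod.smul_fst, Prod.smul_snd, real_inner_smul_left, smul_eq_mul]; ring

lemma mink_add_right (x y z : R41) : mink x (y + z) = mink x y + mink x z := by
  rw [mink_comm, mink_add_left, mink_comm y, mink_comm z]

lemma mink_smul_right (a : ℝ) (x z : R41) : mink x (a • z) = a * mink x z := by
  rw [mink_comm, mink_smul_left, mink_comm z]

/-- The Lorentz product as a continuous bilinear map. -/
def minkL : R41 →L[ℝ] R41 →L[ℝ] ℝ :=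
  LinearMap.toContinuousLinearMap
    ((LinearMap.toContinuousLinearMap : (R41 →ₗ[ℝ] ℝ) ≃ₗ[ℝ] (R41 →L[ℝ] ℝ)).toLinearMap ∘ₗ
      LinearMap.mk₂ ℝ mink mink_add_left mink_smul_left mink_add_right mink_smul_right)

@[simp] lemma minkL_apply (x y : R41) : minkL x y = mink x y := rfl

lemma mink_sub_left (x y z : R41) : mink (x - y) z = mink x z - mink y z := by
  simp only [← minkL_apply, map_sub, sub_apply]

lemma mink_sub_right (x y z : R41) : mink x (y - z) = mink x y - mink x z := by
  simp only [← minkL_apply, map_sub]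

lemma mink_neg_left (x z : R41) : mink (-x) z = -mink x z := by
  simp only [← minkL_apply, map_neg, neg_apply]

lemma mink_neg_right (x z : R41) : mink x (-z) = -mink x z := by
  simp only [← minkL_apply, map_neg]

lemma mink_zero_left (z : R41) : mink 0 z = 0 := by
  simp only [← minkL_apply, map_zero, zero_apply]

lemma mink_zero_right (z : R41) : mink z 0 = 0 := by
  simp only [← minkL_apply, map_zero]

lemma mink_sum_left {ι : Type*} (s : Finset ι) (f : ι → R41) (z : R41) :
    mink (∑ i ∈ s, f i) z = ∑ i ∈ s, mink (f i) z := by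
  simp only [← minkL_apply, map_sum, sum_apply]

lemma mink_sum_right {ι : Type*} (s : Finset ι) (f : ι → R41) (z : R41) :
    mink z (∑ i ∈ s, f i) = ∑ i ∈ s, mink z (f i) := by
  simp only [← minkL_apply, map_sum]

/-- Testing against the time reflection of `w` turns the Lorentz product into the Euclidean square
norm. -/
lemma mink_nondegenerate {w : R41} (h : ∀ z, mink w z = 0) : w = 0 := by
  have h1 := h (w.1, -w.2)
  simp only [mink, real_inner_self_eq_norm_sq] at h1
  have h2 : ‖w.1‖ ^ 2 + w.2 ^ 2 = 0 := by linarith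
  have h3 : ‖w.1‖ = 0 := by nlinarith [sq_nonneg ‖w.1‖, sq_nonneg w.2]
  have h4 : w.2 = 0 := by nlinarith [sq_nonneg ‖w.1‖, sq_nonneg w.2]
  exact Prod.ext (norm_eq_zero.mp h3) h4

/-- A basis of Minkowski space that consists of an orthonormal space-like pair and two null vectors
`P`, `Q` with `⟨P, Q⟩ = -1`. -/
structure IsNullBasis (E₁ E₂ P Q : R41) : Prop where
  e11 : mink E₁ E₁ = 1
  e22 : mink E₂ E₂ = 1
  e12 : mink E₁ E₂ = 0
  pp : mink P P = 0
  qq : mink Q Q = 0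
  pq : mink P Q = -1
  e1p : mink E₁ P = 0
  e2p : mink E₂ P = 0
  e1q : mink E₁ Q = 0
  e2q : mink E₂ Q = 0

namespace IsNullBasis

variable {E₁ E₂ P Q : R41}

lemma ext_zero (h : IsNullBasis E₁ E₂ P Q) {w : R41} (h1 : mink w E₁ = 0) (h2 : mink w E₂ = 0)
    (h3 : mink w P = 0) (h4 : mink w Q = 0) : w = 0 := by
  have hli : LinearIndependent ℝ ![E₁, E₂, P, Q] := by
    rw [Fintype.linearIndependent_iff]
    intro g hg
    simp only [Fin.sum_univ_four, Matrix.cons_val_zero, Matrix.cons_val_one, Matrix.cons_val] at hg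
    have key : ∀ z, g 0 * mink E₁ z + g 1 * mink E₂ z + g 2 * mink P z + g 3 * mink Q z = 0 := by
      intro z
      rw [← mink_smul_left, ← mink_smul_left, ← mink_smul_left, ← mink_smul_left,
        ← mink_add_left, ← mink_add_left, ← mink_add_left, hg, mink_zero_left]
    have k1 := key E₁
    have k2 := key E₂
    have k3 := key P
    have k4 := key Q
    rw [h.e11, mink_comm E₂, h.e12, mink_comm P, h.e1p, mink_comm Q, h.e1q] at k1
    rw [h.e22, h.e12, mink_comm P, h.e2p, mink_comm Q, h.e2q] at k2
    rw [h.e1p, h.e2p, h.pp, mink_comm Q, h.pq] at k3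
    rw [h.e1q, h.e2q, h.qq, h.pq] at k4
    intro i
    fin_cases i
    · show g 0 = 0
      linarith
    · show g 1 = 0
      linarith
    · show g 2 = 0
      linarith
    · show g 3 = 0
      linarith
  have hspan : Submodule.span ℝ (Set.range ![E₁, E₂, P, Q]) = ⊤ :=
    hli.span_eq_top_of_card_eq_finrank (by simp)
  apply mink_nondegenerate
  intro z
  have hz : z ∈ Submodule.span ℝ (Set.range ![E₁, E₂, P, Q]) := by rw [hspan]; trivial
  induction hz using Submodule.span_induction with
  | mem x hx =>
    obtain ⟨i, rfl⟩ := hx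
    fin_cases i <;> assumption
  | zero => exact mink_zero_right _
  | add x y _ _ hx hy => rw [mink_add_right, hx, hy, add_zero]
  | smul a x _ hx => rw [mink_smul_right, hx, mul_zero]

lemma expansion (h : IsNullBasis E₁ E₂ P Q) (w : R41) :
    w = mink w E₁ • E₁ + mink w E₂ • E₂ - mink w Q • P - mink w P • Q := by
  rw [← sub_eq_zero]
  apply h.ext_zero <;>
  simp only [mink_sub_left, mink_add_left, mink_smul_left, h.e11, h.e22, h.e12, h.pp, h.qq, h.pq,
    h.e1p, h.e2p, h.e1q, h.e2q, mink_comm E₂ E₁, mink_comm P E₁, mink_comm P E₂, mink_comm Q E₁,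
    mink_comm Q E₂, mink_comm Q P] <;> ring

/-- This is how every structure equation below is split: the first two terms are the tangential part
of a product, the last two its normal part, with minus signs because ⟨P, Q⟩ = -1. -/
lemma parseval (h : IsNullBasis E₁ E₂ P Q) (w z : R41) :
    mink w z = mink w E₁ * mink z E₁ + mink w E₂ * mink z E₂ - mink w P * mink z Q
      - mink w Q * mink z P := by
  conv_lhs => rw [h.expansion w]
  simp only [mink_sub_left, mink_add_left, mink_smul_left, mink_comm E₁ z, mink_comm E₂ z,
    mink_comm P z, mink_comm Q z]
  ring

end IsNullBasis

end MinkowskiAlgebra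

/-! ### Pairs of complex-valued linear forms on a plane -/

section ComplexForms

open ComplexConjugate

variable {T : Type*} [AddCommGroup T] [Module ℝ T]

lemma exists_ratio_of_wedge_eq_zero {A B : T →ₗ[ℝ] ℂ} (hA : Function.Injective A)
    (h : ∀ v w, B v * A w = B w * A v) {v₀ : T} (hv₀ : v₀ ≠ 0) :
    ∀ v, B v = B v₀ / A v₀ * A v := by
  intro v
  have hne : A v₀ ≠ 0 := fun h0 => hv₀ (hA (by rw [h0, map_zero]))
  field_simp
  exact h v v₀

/-- Write σ = αA + βĀ. The first symmetry forces α to be real, the second μβ. Hence β̄ = tμ with t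
real, so that Im(σ̄A) = Im(β̄A²) = t Im(μA²), while Im(σB) = α Im(μA²). -/
lemma exists_real_proportion_of_symmetric (hT : Module.finrank ℝ T = 2) {A B σ : T →ₗ[ℝ] ℂ}
    (hA : Function.Injective A) {μ : ℂ} (hμ : μ ≠ 0) (hB : ∀ v, B v = μ * A v)
    (h1 : ∀ v w, (conj (σ v) * A w).re = (conj (σ w) * A v).re)
    (h2 : ∀ v w, (σ v * B w).re = (σ w * B v).re) :
    ∃ t a : ℝ, ∀ v, (conj (σ v) * A v).im = t * (B v * A v).im ∧
      (σ v * B v).im = a * (B v * A v).im := by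
  have : FiniteDimensional ℝ T := FiniteDimensional.of_finrank_pos (by omega)
  have hsurj : Function.Surjective A :=
    (LinearMap.injective_iff_surjective_of_finrank_eq_finrank
      (by rw [hT, Complex.finrank_real_complex])).mp hA
  obtain ⟨v₁, hv₁⟩ := hsurj 1
  obtain ⟨v₂, hv₂⟩ := hsurj Complex.I
  obtain ⟨m, n⟩ := μ
  have hσ : ∀ v, σ v = (A v).re • σ v₁ + (A v).im • σ v₂ := by
    intro v
    have : v = (A v).re • v₁ + (A v).im • v₂ := by
      apply hA
      rw [map_add, map_smul, map_smul, hv₁, hv₂]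
      apply Complex.ext <;> simp
    conv_lhs => rw [this]
    rw [map_add, map_smul, map_smul]
  have e1 := h1 v₁ v₂
  have e2 := h2 v₁ v₂
  rw [hB, hB] at e2
  rw [hv₁, hv₂] at e1 e2
  generalize σ v₁ = s₁ at *
  generalize σ v₂ = s₂ at *
  obtain ⟨p, q⟩ := s₁
  obtain ⟨q', r⟩ := s₂
  simp only [Complex.mul_re, Complex.conj_re, Complex.conj_im, Complex.I_re, Complex.I_im,
    Complex.one_re, Complex.one_im, Complex.mul_im] at e1 e2
  obtain rfl : q = q' := by linarith
  have hmn : m ^ 2 + n ^ 2 ≠ 0 := by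
    intro h0
    apply hμ
    have hm : m = 0 := by nlinarith [sq_nonneg m, sq_nonneg n]
    have hn : n = 0 := by nlinarith [sq_nonneg m, sq_nonneg n]
    apply Complex.ext <;> simpa
  -- With σ(v₁) = p + iq and σ(v₂) = q + ir one has α = (p + r)/2 and β = (p - r)/2 + iq; the
  -- witnesses are t = Re(β̄μ̄)/|μ|² and a = α. The relation `e3` below is Im(μβ) = 0.
  refine ⟨(2 * m * (p - r) - 4 * q * n) / (4 * (m ^ 2 + n ^ 2)), (p + r) / 2, fun v => ?_⟩
  rw [hB, hσ v]
  generalize A v = ζ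
  obtain ⟨x, y⟩ := ζ
  have e3 : n * (r - p) = 2 * q * m := by linarith
  constructor
  · simp only [Complex.mul_re, Complex.conj_re, Complex.conj_im, Complex.mul_im, Complex.add_re,
      Complex.add_im, Complex.smul_re, Complex.smul_im, smul_eq_mul]
    field_simp
    linear_combination (-4 * n * x * y - 2 * m * (y ^ 2 - x ^ 2)) * e3
  · simp only [Complex.mul_re, Complex.mul_im, Complex.add_re,
      Complex.add_im, Complex.smul_re, Complex.smul_im, smul_eq_mul]
    linear_combination (-(x ^ 2 + y ^ 2) / 2) * e3

end ComplexForms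

/-! ### Closed forms, primitives and complex square roots -/

section Calculus

lemma exists_primitive {F : Type*} [NormedAddCommGroup F] [NormedSpace ℝ F] [CompleteSpace F]
    {η : E2 → E2 →L[ℝ] F} {s : Set E2} (hs : IsOpen s) (hη : ContDiffOn ℝ ∞ η s)
    (hc : ∀ u ∈ s, ∀ v w, fderiv ℝ η u v w = fderiv ℝ η u w v) {u₀ : E2} (hu : u₀ ∈ s) :
    ∃ W : Set E2, IsOpen W ∧ u₀ ∈ W ∧ W ⊆ s ∧ ∃ f : E2 → F, ContDiffOn ℝ ∞ f W ∧
      ∀ u ∈ W, HasFDerivAt f (η u) u := by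
  obtain ⟨ε, hε, hb⟩ := Metric.isOpen_iff.mp hs u₀ hu
  obtain ⟨f, hf⟩ := (convex_ball u₀ ε).exists_forall_hasFDerivAt_of_fderiv_symmetric
    Metric.isOpen_ball ((hη.mono hb).differentiableOn (by simp)) (fun a ha => hc a (hb ha))
  refine ⟨Metric.ball u₀ ε, Metric.isOpen_ball, Metric.mem_ball_self hε, hb, f, ?_, hf⟩
  rw [contDiffOn_infty_iff_fderiv_of_isOpen Metric.isOpen_ball]
  refine ⟨fun a ha => (hf a ha).differentiableAt.differentiableWithinAt, ?_⟩
  exact (hη.mono hb).congr fun a ha => (hf a ha).fderiv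

/-- The one-form `⟨dA, B⟩`. -/
def pairForm (A B : E2 → R41) (u : E2) : E2 →L[ℝ] ℝ := (minkL.flip (B u)).comp (fderiv ℝ A u)

@[simp] lemma pairForm_apply (A B : E2 → R41) (u v : E2) :
    pairForm A B u v = mink (fderiv ℝ A u v) (B u) := rfl

variable {s : Set E2} {A B : E2 → R41}

lemma contDiffOn_fderiv_of_isOpen {V : Type*} [NormedAddCommGroup V] [NormedSpace ℝ V]
    {A : E2 → V} (hs : IsOpen s) (hA : ContDiffOn ℝ ∞ A s) : ContDiffOn ℝ ∞ (fderiv ℝ A) s :=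
  ((contDiffOn_infty_iff_fderiv_of_isOpen hs).mp hA).2

lemma ContDiffOn.mink (hA : ContDiffOn ℝ ∞ A s) (hB : ContDiffOn ℝ ∞ B s) :
    ContDiffOn ℝ ∞ (fun u => mink (A u) (B u)) s :=
  minkL.isBoundedBilinearMap.contDiff.comp_contDiffOn (hA.prodMk hB)

lemma contDiffOn_pairForm (hs : IsOpen s) (hA : ContDiffOn ℝ ∞ A s) (hB : ContDiffOn ℝ ∞ B s) :
    ContDiffOn ℝ ∞ (pairForm A B) s :=
  (minkL.flip.contDiff.comp_contDiffOn hB).clm_comp (contDiffOn_fderiv_of_isOpen hs hA)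

lemma ContDiffOn.hasFDerivAt_of_isOpen {V : Type*} [NormedAddCommGroup V] [NormedSpace ℝ V]
    {A : E2 → V} (hA : ContDiffOn ℝ ∞ A s) (hs : IsOpen s) {u : E2} (hu : u ∈ s) :
    HasFDerivAt A (fderiv ℝ A u) u :=
  ((hA.differentiableOn (by simp)).differentiableAt (hs.mem_nhds hu)).hasFDerivAt

lemma HasFDerivAt.mink {A' B' : E2 →L[ℝ] R41} {u : E2} (hA : HasFDerivAt A A' u)
    (hB : HasFDerivAt B B' u) :
    HasFDerivAt (fun u => mink (A u) (B u)) (minkL.precompR E2 (A u) B' +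
      minkL.precompL E2 A' (B u)) u :=
  minkL.hasFDerivAt_of_bilinear hA hB

lemma fderiv_mink (hs : IsOpen s) (hA : ContDiffOn ℝ ∞ A s) (hB : ContDiffOn ℝ ∞ B s) {u : E2}
    (hu : u ∈ s) (v : E2) : fderiv ℝ (fun u => _root_.mink (A u) (B u)) u v =
      _root_.mink (fderiv ℝ A u v) (B u) + _root_.mink (A u) (fderiv ℝ B u v) := by
  rw [((hA.hasFDerivAt_of_isOpen hs hu).mink (hB.hasFDerivAt_of_isOpen hs hu)).fderiv]
  simp [add_comm]

lemma fderiv_fderiv_comm {V : Type*} [NormedAddCommGroup V] [NormedSpace ℝ V] {A : E2 → V}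
    (hs : IsOpen s) (hA : ContDiffOn ℝ ∞ A s) {u : E2} (hu : u ∈ s) (v w : E2) :
    fderiv ℝ (fderiv ℝ A) u v w = fderiv ℝ (fderiv ℝ A) u w v :=
  ((hA.contDiffAt (hs.mem_nhds hu)).isSymmSndFDerivAt
    (by simpa using ENat.LEInfty.out)).eq v w

lemma fderiv_pairForm (hs : IsOpen s) (hA : ContDiffOn ℝ ∞ A s) (hB : ContDiffOn ℝ ∞ B s) {u : E2}
    (hu : u ∈ s) (v w : E2) : fderiv ℝ (pairForm A B) u v w =
      mink (fderiv ℝ (fderiv ℝ A) u v w) (B u) + mink (fderiv ℝ A u w) (fderiv ℝ B u v) := by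
  have h1 := (contDiffOn_pairForm hs hA hB).hasFDerivAt_of_isOpen hs hu
  have h2 := h1.clm_apply (hasFDerivAt_const w u)
  have h3 : HasFDerivAt (fun u => fderiv ℝ A u w) _ u :=
    ((contDiffOn_fderiv_of_isOpen hs hA).hasFDerivAt_of_isOpen hs hu).clm_apply
      (hasFDerivAt_const w u)
  have h4 := h3.mink (hB.hasFDerivAt_of_isOpen hs hu)
  have := congrArg (fun L => L v) (h2.unique h4)
  simpa [add_comm] using this

/-- The second derivative of `A` is symmetric and drops out: d⟨dA, B⟩ vanishes exactly when ⟨dA ∧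
dB⟩ does. With suitable vector fields of the frame for `A` and `B` this one identity gives the
Ricci, Gauss and Codazzi equations. -/
lemma pairForm_closed_iff (hs : IsOpen s) (hA : ContDiffOn ℝ ∞ A s) (hB : ContDiffOn ℝ ∞ B s)
    {u : E2} (hu : u ∈ s) (v w : E2) :
    fderiv ℝ (pairForm A B) u v w = fderiv ℝ (pairForm A B) u w v ↔
      mink (fderiv ℝ A u v) (fderiv ℝ B u w) = mink (fderiv ℝ A u w) (fderiv ℝ B u v) := by
  rw [fderiv_pairForm hs hA hB hu, fderiv_pairForm hs hA hB hu, fderiv_fderiv_comm hs hA hu v w]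
  constructor <;> intro h <;> linarith

/-- A one-form that vanishes identically is closed. -/
lemma mink_fderiv_symm_of_pairForm_eq_zero (hs : IsOpen s) (hA : ContDiffOn ℝ ∞ A s)
    (hB : ContDiffOn ℝ ∞ B s) (h : ∀ u ∈ s, ∀ v, mink (fderiv ℝ A u v) (B u) = 0) {u : E2}
    (hu : u ∈ s) (v w : E2) :
    mink (fderiv ℝ A u v) (fderiv ℝ B u w) = mink (fderiv ℝ A u w) (fderiv ℝ B u v) := by
  rw [← pairForm_closed_iff hs hA hB hu]
  have h0 : pairForm A B =ᶠ[nhds u] fun _ => 0 := by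
    filter_upwards [hs.mem_nhds hu] with u' hu'
    ext v
    exact h u' hu' v
  rw [h0.fderiv_eq]
  simp

lemma mink_fderiv_add_eq_zero (hs : IsOpen s) (hA : ContDiffOn ℝ ∞ A s) (hB : ContDiffOn ℝ ∞ B s)
    {c : ℝ} (h : ∀ u ∈ s, mink (A u) (B u) = c) {u : E2} (hu : u ∈ s) (v : E2) :
    mink (fderiv ℝ A u v) (B u) + mink (fderiv ℝ B u v) (A u) = 0 := by
  have h0 : (fun u => mink (A u) (B u)) =ᶠ[nhds u] fun _ => c := by
    filter_upwards [hs.mem_nhds hu] with u' hu'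
    exact h u' hu'
  have := fderiv_mink hs hA hB hu v
  rw [h0.fderiv_eq, mink_comm (A u)] at this
  simpa using this.symm

lemma exists_complex_sqrt {μ : E2 → ℂ} (hs : IsOpen s) (hμ : ContDiffOn ℝ ∞ μ s)
    (h0 : ∀ u ∈ s, μ u ≠ 0) {u₀ : E2} (hu : u₀ ∈ s) :
    ∃ W : Set E2, IsOpen W ∧ u₀ ∈ W ∧ W ⊆ s ∧ ∃ r : E2 → ℂ, ContDiffOn ℝ ∞ r W ∧
      ∀ u ∈ W, r u ^ 2 = μ u := by
  obtain ⟨ν, hν⟩ := IsAlgClosed.exists_pow_nat_eq (μ u₀) two_pos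
  have hq : ContDiffOn ℝ ∞ (fun u => μ u / μ u₀) s := hμ.div_const _
  -- Division by the value at u₀ moves that value to 1, inside the slit plane where the principal
  -- logarithm is smooth; the factor ν undoes the division.
  refine ⟨s ∩ (fun u => μ u / μ u₀) ⁻¹' Complex.slitPlane,
    hq.continuousOn.isOpen_inter_preimage hs Complex.isOpen_slitPlane, ⟨hu, ?_⟩,
    Set.inter_subset_left, fun u => ν * Complex.exp (Complex.log (μ u / μ u₀) / 2), ?_, ?_⟩
  · simp [div_self (h0 _ hu)]
  · have hl : ContDiffOn ℝ ∞ (fun u => Complex.log (μ u / μ u₀))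
        (s ∩ (fun u => μ u / μ u₀) ⁻¹' Complex.slitPlane) := by
      intro u hu'
      exact ((Complex.contDiffAt_log hu'.2).restrict_scalars ℝ).comp_contDiffWithinAt u
        ((hq.mono Set.inter_subset_left) u hu')
    exact contDiffOn_const.mul (Complex.contDiff_exp.comp_contDiffOn
      (hl.div_const _))
  · intro u hu'
    rw [mul_pow, hν, ← Complex.exp_nat_mul]
    push_cast
    rw [mul_div_cancel₀ _ (two_ne_zero), Complex.exp_log (div_ne_zero (h0 u hu'.1) (h0 _ hu)),
      mul_div_cancel₀ _ (h0 _ hu)]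

/-- A product of two closed complex-linearly dependent one-forms is locally the square of the
differential of a complex coordinate. -/
lemma exists_coordinate_of_closed {A B : E2 → E2 →L[ℝ] ℂ} (hs : IsOpen s)
    (hA : ContDiffOn ℝ ∞ A s) (hB : ContDiffOn ℝ ∞ B s)
    (hAc : ∀ u ∈ s, ∀ v w, fderiv ℝ A u v w = fderiv ℝ A u w v)
    (hBc : ∀ u ∈ s, ∀ v w, fderiv ℝ B u v w = fderiv ℝ B u w v)
    {v₀ : E2} (hA0 : ∀ u ∈ s, A u v₀ ≠ 0) (hB0 : ∀ u ∈ s, B u v₀ ≠ 0)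
    (hAB : ∀ u ∈ s, ∀ v, B u v = B u v₀ / A u v₀ * A u v) {u₀ : E2} (hu : u₀ ∈ s) :
    ∃ W : Set E2, IsOpen W ∧ u₀ ∈ W ∧ W ⊆ s ∧ ∃ z : E2 → ℂ, ContDiffOn ℝ ∞ z W ∧
      ∀ u ∈ W, ∀ v, fderiv ℝ z u v ^ 2 = A u v * B u v := by
  have hμ : ContDiffOn ℝ ∞ (fun u => B u v₀ / A u v₀) s :=
    by
    simp only [div_eq_mul_inv]
    exact (hB.clm_apply contDiffOn_const).mul ((hA.clm_apply contDiffOn_const).inv hA0)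
  obtain ⟨W₁, hW₁, hu₁, hW₁s, r, hr, hr2⟩ := exists_complex_sqrt hs hμ
    (fun u hu => div_ne_zero (hB0 u hu) (hA0 u hu)) hu
  have hr0 : ∀ u ∈ W₁, r u ≠ 0 := by
    intro u hu h
    have := hr2 u hu
    rw [h, zero_pow two_ne_zero] at this
    exact div_ne_zero (hB0 u (hW₁s hu)) (hA0 u (hW₁s hu)) this.symm
  have hrA : ContDiffOn ℝ ∞ (fun u => r u • A u) W₁ := hr.smul (hA.mono hW₁s)
  have hclosed : ∀ u ∈ W₁, ∀ v w, fderiv ℝ (fun u => r u • A u) u v w =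
      fderiv ℝ (fun u => r u • A u) u w v := by
    intro u hu v w
    have dr := hr.hasFDerivAt_of_isOpen hW₁ hu
    have dA := (hA.mono hW₁s).hasFDerivAt_of_isOpen hW₁ hu
    have dB := (hB.mono hW₁s).hasFDerivAt_of_isOpen hW₁ hu
    -- Here B = r²A with A and B closed, so 0 = d(r²A) = 2r dr ∧ A. Hence d(rA) = dr ∧ A = 0, and rA
    -- has a primitive z with dz² = r²A² = AB.
    have hBr : B =ᶠ[nhds u] fun u => r u • r u • A u := by
      filter_upwards [hW₁.mem_nhds hu] with u' hu'
      ext v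
      rw [hAB u' (hW₁s hu') v, ← hr2 u' hu']
      simp only [smul_apply, smul_eq_mul]
      ring
    have dB' := (dr.smul (dr.smul dA)).congr_of_eventuallyEq hBr
    have e1 := fun v w => congrArg (fun L => L v w) (dB.unique dB')
    have e2 := e1 v w
    have e3 := e1 w v
    have e4 := hBc u (hW₁s hu) v w
    have e5 := hAc u (hW₁s hu) v w
    have drA : HasFDerivAt (fun u => r u • A u) _ u := dr.smul dA
    rw [drA.fderiv]
    simp only [add_apply, smul_apply, ContinuousLinearMap.smulRight_apply, smul_eq_mul,
      Pi.smul_apply'] at e2 e3 ⊢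
    rw [e2, e3, e5] at e4
    have h2 : (2 * r u) ≠ 0 := mul_ne_zero two_ne_zero (hr0 u hu)
    apply mul_left_cancel₀ h2
    rw [e5]
    linear_combination e4
  obtain ⟨W, hW, hu', hWW, z, hz, hz'⟩ := exists_primitive hW₁ hrA hclosed hu₁
  refine ⟨W, hW, hu', hWW.trans hW₁s, z, hz, fun u hu v => ?_⟩
  rw [(hz' u hu).fderiv, hAB u (hW₁s (hWW hu)) v, ← hr2 u (hWW hu)]
  simp only [smul_apply, smul_eq_mul]
  ring

end Calculus

/-! ### Structure equations in a parallel null frame -/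

section ParallelFrames

open ComplexConjugate

/-- The complex-valued functional `w ↦ ⟨w, E₁⟩ + i ⟨w, E₂⟩`. -/
def frameForm (E₁ E₂ : R41) : R41 →L[ℝ] ℂ :=
  Complex.ofRealCLM.comp (minkL.flip E₁) + Complex.I • Complex.ofRealCLM.comp (minkL.flip E₂)

lemma frameForm_apply (E₁ E₂ w : R41) :
    frameForm E₁ E₂ w = (mink w E₁ : ℂ) + Complex.I * (mink w E₂ : ℂ) := rfl

@[simp] lemma frameForm_re (E₁ E₂ w : R41) : (frameForm E₁ E₂ w).re = mink w E₁ := by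
  simp [frameForm_apply]

@[simp] lemma frameForm_im (E₁ E₂ w : R41) : (frameForm E₁ E₂ w).im = mink w E₂ := by
  simp [frameForm_apply]

/-- A null frame along the surface `X` whose tangential and normal part are parallel. -/
structure IsParallelFrameOn (X E₁ E₂ P Q : E2 → R41) (W : Set E2) : Prop where
  isOpen : IsOpen W
  smooth_X : ContDiffOn ℝ ∞ X W
  smooth_E₁ : ContDiffOn ℝ ∞ E₁ W
  smooth_E₂ : ContDiffOn ℝ ∞ E₂ W
  smooth_P : ContDiffOn ℝ ∞ P W
  smooth_Q : ContDiffOn ℝ ∞ Q W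
  basis : ∀ u ∈ W, IsNullBasis (E₁ u) (E₂ u) (P u) (Q u)
  dX_P : ∀ u ∈ W, ∀ v, mink (fderiv ℝ X u v) (P u) = 0
  dX_Q : ∀ u ∈ W, ∀ v, mink (fderiv ℝ X u v) (Q u) = 0
  dP_Q : ∀ u ∈ W, ∀ v, mink (fderiv ℝ P u v) (Q u) = 0
  dE : ∀ u ∈ W, ∀ v, mink (fderiv ℝ E₁ u v) (E₂ u) = 0

namespace IsParallelFrameOn

variable {X E₁ E₂ P Q : E2 → R41} {W : Set E2}

lemma dP_P (h : IsParallelFrameOn X E₁ E₂ P Q W)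
    {u : E2} (hu : u ∈ W) (v : E2) : mink (fderiv ℝ P u v) (P u) = 0 := by
  have := mink_fderiv_add_eq_zero h.isOpen h.smooth_P h.smooth_P (fun u hu => (h.basis u hu).pp)
    hu v
  linarith

lemma dQ_Q (h : IsParallelFrameOn X E₁ E₂ P Q W)
    {u : E2} (hu : u ∈ W) (v : E2) : mink (fderiv ℝ Q u v) (Q u) = 0 := by
  have := mink_fderiv_add_eq_zero h.isOpen h.smooth_Q h.smooth_Q (fun u hu => (h.basis u hu).qq)
    hu v
  linarith

lemma dQ_P (h : IsParallelFrameOn X E₁ E₂ P Q W)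
    {u : E2} (hu : u ∈ W) (v : E2) : mink (fderiv ℝ Q u v) (P u) = 0 := by
  have := mink_fderiv_add_eq_zero h.isOpen h.smooth_P h.smooth_Q (fun u hu => (h.basis u hu).pq)
    hu v
  rw [h.dP_Q u hu] at this
  linarith

lemma dE₁_E₁ (h : IsParallelFrameOn X E₁ E₂ P Q W)
    {u : E2} (hu : u ∈ W) (v : E2) : mink (fderiv ℝ E₁ u v) (E₁ u) = 0 := by
  have := mink_fderiv_add_eq_zero h.isOpen h.smooth_E₁ h.smooth_E₁
    (fun u hu => (h.basis u hu).e11) hu v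
  linarith

lemma dE₂_E₂ (h : IsParallelFrameOn X E₁ E₂ P Q W)
    {u : E2} (hu : u ∈ W) (v : E2) : mink (fderiv ℝ E₂ u v) (E₂ u) = 0 := by
  have := mink_fderiv_add_eq_zero h.isOpen h.smooth_E₂ h.smooth_E₂
    (fun u hu => (h.basis u hu).e22) hu v
  linarith

lemma dE₂_E₁ (h : IsParallelFrameOn X E₁ E₂ P Q W)
    {u : E2} (hu : u ∈ W) (v : E2) : mink (fderiv ℝ E₂ u v) (E₁ u) = 0 := by
  have := mink_fderiv_add_eq_zero h.isOpen h.smooth_E₁ h.smooth_E₂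
    (fun u hu => (h.basis u hu).e12) hu v
  rw [h.dE u hu] at this
  linarith

lemma dE₁_P (h : IsParallelFrameOn X E₁ E₂ P Q W) {u : E2} (hu : u ∈ W) (v : E2) :
    mink (fderiv ℝ E₁ u v) (P u) = -mink (fderiv ℝ P u v) (E₁ u) := by
  have := mink_fderiv_add_eq_zero h.isOpen h.smooth_E₁ h.smooth_P
    (fun u hu => (h.basis u hu).e1p) hu v
  linarith

lemma dE₂_P (h : IsParallelFrameOn X E₁ E₂ P Q W) {u : E2} (hu : u ∈ W) (v : E2) :
    mink (fderiv ℝ E₂ u v) (P u) = -mink (fderiv ℝ P u v) (E₂ u) := by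
  have := mink_fderiv_add_eq_zero h.isOpen h.smooth_E₂ h.smooth_P
    (fun u hu => (h.basis u hu).e2p) hu v
  linarith

lemma dE₁_Q (h : IsParallelFrameOn X E₁ E₂ P Q W) {u : E2} (hu : u ∈ W) (v : E2) :
    mink (fderiv ℝ E₁ u v) (Q u) = -mink (fderiv ℝ Q u v) (E₁ u) := by
  have := mink_fderiv_add_eq_zero h.isOpen h.smooth_E₁ h.smooth_Q
    (fun u hu => (h.basis u hu).e1q) hu v
  linarith

lemma dE₂_Q (h : IsParallelFrameOn X E₁ E₂ P Q W) {u : E2} (hu : u ∈ W) (v : E2) :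
    mink (fderiv ℝ E₂ u v) (Q u) = -mink (fderiv ℝ Q u v) (E₂ u) := by
  have := mink_fderiv_add_eq_zero h.isOpen h.smooth_E₂ h.smooth_Q
    (fun u hu => (h.basis u hu).e2q) hu v
  linarith

lemma dX_dP_symm (h : IsParallelFrameOn X E₁ E₂ P Q W) {u : E2} (hu : u ∈ W) (v w : E2) :
    mink (fderiv ℝ X u v) (fderiv ℝ P u w) = mink (fderiv ℝ X u w) (fderiv ℝ P u v) :=
  mink_fderiv_symm_of_pairForm_eq_zero h.isOpen h.smooth_X h.smooth_P h.dX_P hu v w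

lemma dX_dQ_symm (h : IsParallelFrameOn X E₁ E₂ P Q W) {u : E2} (hu : u ∈ W) (v w : E2) :
    mink (fderiv ℝ X u v) (fderiv ℝ Q u w) = mink (fderiv ℝ X u w) (fderiv ℝ Q u v) :=
  mink_fderiv_symm_of_pairForm_eq_zero h.isOpen h.smooth_X h.smooth_Q h.dX_Q hu v w

/-- The shape operator of `P` is self-adjoint. Since dX has no normal component, ⟨dX, dP⟩ is the
real part of a product of complex forms. -/
lemma re_conj_frameForm_symm (h : IsParallelFrameOn X E₁ E₂ P Q W)
    {u : E2} (hu : u ∈ W) (v w : E2) :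
    (conj (frameForm (E₁ u) (E₂ u) (fderiv ℝ X u v)) *
      frameForm (E₁ u) (E₂ u) (fderiv ℝ P u w)).re =
    (conj (frameForm (E₁ u) (E₂ u) (fderiv ℝ X u w)) *
      frameForm (E₁ u) (E₂ u) (fderiv ℝ P u v)).re := by
  have e := h.dX_dP_symm hu v w
  rw [(h.basis u hu).parseval, (h.basis u hu).parseval (fderiv ℝ X u w), h.dX_P u hu, h.dX_P u hu,
    h.dX_Q u hu, h.dX_Q u hu] at e
  simp only [Complex.mul_re, Complex.conj_re, Complex.conj_im, frameForm_re, frameForm_im]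
  linarith

/-- Self-adjointness of the shape operator of `Q`. Its form is taken with `-E₂`, i.e. conjugated, so
the product appears without a conjugate on the dX factor. -/
lemma re_frameForm_symm (h : IsParallelFrameOn X E₁ E₂ P Q W) {u : E2} (hu : u ∈ W) (v w : E2) :
    (frameForm (E₁ u) (E₂ u) (fderiv ℝ X u v) *
      frameForm (E₁ u) (-E₂ u) (fderiv ℝ Q u w)).re =
    (frameForm (E₁ u) (E₂ u) (fderiv ℝ X u w) *
      frameForm (E₁ u) (-E₂ u) (fderiv ℝ Q u v)).re := by
  have e := h.dX_dQ_symm hu v w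
  rw [(h.basis u hu).parseval, (h.basis u hu).parseval (fderiv ℝ X u w), h.dX_P u hu, h.dX_P u hu,
    h.dX_Q u hu, h.dX_Q u hu] at e
  simp only [Complex.mul_re, frameForm_re, frameForm_im, mink_neg_right]
  linarith

/-- The real part is the Ricci equation, from ⟨dP, Q⟩ = 0; the imaginary part is the Gauss equation,
from ⟨dE₁, E₂⟩ = 0. They combine to one complex equation only because the form of `Q` is conjugated.
-/
lemma frameForm_wedge_eq_zero (h : IsParallelFrameOn X E₁ E₂ P Q W)
    {u : E2} (hu : u ∈ W) (v w : E2) :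
    frameForm (E₁ u) (-E₂ u) (fderiv ℝ Q u v) * frameForm (E₁ u) (E₂ u) (fderiv ℝ P u w) =
    frameForm (E₁ u) (-E₂ u) (fderiv ℝ Q u w) * frameForm (E₁ u) (E₂ u) (fderiv ℝ P u v) := by
  have e1 := mink_fderiv_symm_of_pairForm_eq_zero h.isOpen h.smooth_P h.smooth_Q h.dP_Q hu v w
  have e2 := mink_fderiv_symm_of_pairForm_eq_zero h.isOpen h.smooth_E₁ h.smooth_E₂ h.dE hu v w
  rw [(h.basis u hu).parseval, (h.basis u hu).parseval (fderiv ℝ P u w), h.dP_P hu, h.dP_P hu,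
    h.dP_Q u hu, h.dP_Q u hu] at e1
  rw [(h.basis u hu).parseval, (h.basis u hu).parseval (fderiv ℝ E₁ u w), h.dE u hu, h.dE u hu,
    h.dE₁_E₁ hu, h.dE₁_E₁ hu, h.dE₁_P hu, h.dE₁_P hu, h.dE₂_P hu, h.dE₂_P hu, h.dE₁_Q hu,
    h.dE₁_Q hu, h.dE₂_Q hu, h.dE₂_Q hu] at e2
  apply Complex.ext
  · simp only [Complex.mul_re, frameForm_re, frameForm_im, mink_neg_right]
    linarith
  · simp only [Complex.mul_im, frameForm_re, frameForm_im, mink_neg_right]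
    linarith

lemma dP_dP (h : IsParallelFrameOn X E₁ E₂ P Q W)
    {u : E2} (hu : u ∈ W) (v : E2) : mink (fderiv ℝ P u v) (fderiv ℝ P u v) =
    Complex.normSq (frameForm (E₁ u) (E₂ u) (fderiv ℝ P u v)) := by
  rw [(h.basis u hu).parseval, h.dP_P hu, Complex.normSq_apply, frameForm_re, frameForm_im]
  ring

lemma dQ_dQ (h : IsParallelFrameOn X E₁ E₂ P Q W)
    {u : E2} (hu : u ∈ W) (v : E2) : mink (fderiv ℝ Q u v) (fderiv ℝ Q u v) =
    Complex.normSq (frameForm (E₁ u) (-E₂ u) (fderiv ℝ Q u v)) := by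
  rw [(h.basis u hu).parseval, h.dQ_Q hu, Complex.normSq_apply, frameForm_re, frameForm_im,
    mink_neg_right]
  ring

/-- A Codazzi equation, like the three that follow: in a parallel frame the derivatives of the null
normals are tangential and those of the tangent vectors are normal, so each product of the two
vanishes. -/
lemma pairForm_P_E₁_closed (h : IsParallelFrameOn X E₁ E₂ P Q W) {u : E2} (hu : u ∈ W) (v w : E2) :
    fderiv ℝ (pairForm P E₁) u v w = fderiv ℝ (pairForm P E₁) u w v := by
  rw [pairForm_closed_iff h.isOpen h.smooth_P h.smooth_E₁ hu, (h.basis u hu).parseval,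
    (h.basis u hu).parseval (fderiv ℝ P u w)]
  simp only [h.dP_P hu, h.dP_Q u hu, h.dE₁_E₁ hu, h.dE u hu]
  ring

lemma pairForm_P_E₂_closed (h : IsParallelFrameOn X E₁ E₂ P Q W) {u : E2} (hu : u ∈ W) (v w : E2) :
    fderiv ℝ (pairForm P E₂) u v w = fderiv ℝ (pairForm P E₂) u w v := by
  rw [pairForm_closed_iff h.isOpen h.smooth_P h.smooth_E₂ hu, (h.basis u hu).parseval,
    (h.basis u hu).parseval (fderiv ℝ P u w)]
  simp only [h.dP_P hu, h.dP_Q u hu, h.dE₂_E₂ hu, h.dE₂_E₁ hu]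
  ring

lemma pairForm_Q_E₁_closed (h : IsParallelFrameOn X E₁ E₂ P Q W) {u : E2} (hu : u ∈ W) (v w : E2) :
    fderiv ℝ (pairForm Q E₁) u v w = fderiv ℝ (pairForm Q E₁) u w v := by
  rw [pairForm_closed_iff h.isOpen h.smooth_Q h.smooth_E₁ hu, (h.basis u hu).parseval,
    (h.basis u hu).parseval (fderiv ℝ Q u w)]
  simp only [h.dQ_P hu, h.dQ_Q hu, h.dE₁_E₁ hu, h.dE u hu]
  ring

lemma pairForm_Q_E₂_closed (h : IsParallelFrameOn X E₁ E₂ P Q W) {u : E2} (hu : u ∈ W) (v w : E2) :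
    fderiv ℝ (pairForm Q E₂) u v w = fderiv ℝ (pairForm Q E₂) u w v := by
  rw [pairForm_closed_iff h.isOpen h.smooth_Q h.smooth_E₂ hu, (h.basis u hu).parseval,
    (h.basis u hu).parseval (fderiv ℝ Q u w)]
  simp only [h.dQ_P hu, h.dQ_Q hu, h.dE₂_E₂ hu, h.dE₂_E₁ hu]
  ring

lemma frameForm_comp_fderiv (A E₁ E₂ : E2 → R41) (u : E2) :
    (frameForm (E₁ u) (E₂ u)).comp (fderiv ℝ A u) = Complex.ofRealCLM.comp (pairForm A E₁ u) +
      Complex.I • Complex.ofRealCLM.comp (pairForm A E₂ u) := rfl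

lemma contDiffOn_frameForm_comp_fderiv {A E₁ E₂ : E2 → R41} (hW : IsOpen W)
    (hA : ContDiffOn ℝ ∞ A W) (h1 : ContDiffOn ℝ ∞ E₁ W) (h2 : ContDiffOn ℝ ∞ E₂ W) :
    ContDiffOn ℝ ∞ (fun u => (frameForm (E₁ u) (E₂ u)).comp (fderiv ℝ A u)) W := by
  simp only [frameForm_comp_fderiv]
  exact (contDiffOn_const.clm_comp (contDiffOn_pairForm hW hA h1)).add
    ((contDiffOn_const.clm_comp (contDiffOn_pairForm hW hA h2)).const_smul _)

lemma frameForm_comp_fderiv_closed {A E₁ E₂ : E2 → R41} (hW : IsOpen W)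
    (hA : ContDiffOn ℝ ∞ A W) (h1 : ContDiffOn ℝ ∞ E₁ W) (h2 : ContDiffOn ℝ ∞ E₂ W) {u : E2}
    (hu : u ∈ W) (v w : E2)
    (c1 : fderiv ℝ (pairForm A E₁) u v w = fderiv ℝ (pairForm A E₁) u w v)
    (c2 : fderiv ℝ (pairForm A E₂) u v w = fderiv ℝ (pairForm A E₂) u w v) :
    fderiv ℝ (fun u => (frameForm (E₁ u) (E₂ u)).comp (fderiv ℝ A u)) u v w =
      fderiv ℝ (fun u => (frameForm (E₁ u) (E₂ u)).comp (fderiv ℝ A u)) u w v := by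
  simp only [frameForm_comp_fderiv]
  have d1 := (contDiffOn_pairForm hW hA h1).hasFDerivAt_of_isOpen hW hu
  have d2 := (contDiffOn_pairForm hW hA h2).hasFDerivAt_of_isOpen hW hu
  have d : HasFDerivAt (fun u => Complex.ofRealCLM.comp (pairForm A E₁ u) +
      Complex.I • Complex.ofRealCLM.comp (pairForm A E₂ u)) _ u :=
    ((hasFDerivAt_const Complex.ofRealCLM u).clm_comp d1).add
      (((hasFDerivAt_const Complex.ofRealCLM u).clm_comp d2).const_smul Complex.I)
  rw [d.fderiv]
  simp [c1, c2]

/-- Positivity makes both forms nowhere zero on nonzero vectors, which is what the division B/A and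
its square root need; closedness is Codazzi, proportionality is the wedge equation. -/
lemma exists_coordinate (h : IsParallelFrameOn X E₁ E₂ P Q W)
    (hP : ∀ u ∈ W, ∀ v, v ≠ 0 → 0 < mink (fderiv ℝ P u v) (fderiv ℝ P u v))
    (hQ : ∀ u ∈ W, ∀ v, v ≠ 0 → 0 < mink (fderiv ℝ Q u v) (fderiv ℝ Q u v)) {u₀ : E2}
    (hu : u₀ ∈ W) :
    ∃ W' : Set E2, IsOpen W' ∧ u₀ ∈ W' ∧ W' ⊆ W ∧ ∃ z : E2 → ℂ, ContDiffOn ℝ ∞ z W' ∧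
      ∀ u ∈ W', ∀ v, fderiv ℝ z u v ^ 2 = frameForm (E₁ u) (E₂ u) (fderiv ℝ P u v) *
        frameForm (E₁ u) (-E₂ u) (fderiv ℝ Q u v) := by
  have hE₂ : ContDiffOn ℝ ∞ (fun u => -E₂ u) W := h.smooth_E₂.neg
  have hAi : ∀ u ∈ W, ∀ v, v ≠ 0 → frameForm (E₁ u) (E₂ u) (fderiv ℝ P u v) ≠ 0 := by
    intro u hu v hv h0
    have := hP u hu v hv
    rw [h.dP_dP hu, h0, map_zero] at this
    exact this.false
  have hBi : ∀ u ∈ W, ∀ v, v ≠ 0 → frameForm (E₁ u) (-E₂ u) (fderiv ℝ Q u v) ≠ 0 := by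
    intro u hu v hv h0
    have := hQ u hu v hv
    rw [h.dQ_dQ hu, h0, map_zero] at this
    exact this.false
  -- Any fixed nonzero vector would serve to evaluate the ratio of the two forms.
  have hv₀ : (EuclideanSpace.single 0 1 : E2) ≠ 0 := by simp
  refine exists_coordinate_of_closed (v₀ := EuclideanSpace.single 0 1) h.isOpen
    (contDiffOn_frameForm_comp_fderiv h.isOpen h.smooth_P h.smooth_E₁ h.smooth_E₂)
    (contDiffOn_frameForm_comp_fderiv h.isOpen h.smooth_Q h.smooth_E₁ hE₂)
    (fun u hu v w => frameForm_comp_fderiv_closed h.isOpen h.smooth_P h.smooth_E₁ h.smooth_E₂ hu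
      v w (h.pairForm_P_E₁_closed hu v w) (h.pairForm_P_E₂_closed hu v w))
    (fun u hu v w => frameForm_comp_fderiv_closed h.isOpen h.smooth_Q h.smooth_E₁ hE₂ hu
      v w (h.pairForm_Q_E₁_closed hu v w) ?_)
    (fun u hu => hAi u hu _ hv₀) (fun u hu => hBi u hu _ hv₀) (fun u hu v => ?_) hu
  · have hneg : pairForm Q (fun u => -E₂ u) = -pairForm Q E₂ := by
      ext u v
      simp [mink_neg_right]
    rw [hneg, fderiv_neg]
    simp only [neg_apply, neg_inj]
    exact h.pairForm_Q_E₂_closed hu v w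
  · have := h.frameForm_wedge_eq_zero hu v (EuclideanSpace.single 0 1)
    have h0 := hAi u hu _ hv₀
    simp only [ContinuousLinearMap.comp_apply]
    field_simp
    exact this

end IsParallelFrameOn

end ParallelFrames

/-! ### Existence of parallel null frames -/

section FrameExistence

variable {X N M : E2 → R41} {s : Set E2}

/-- Rescaling of a pair of null normals to a parallel pair. -/
lemma exists_parallel_null_normals (hs : IsOpen s) (hN : ContDiffOn ℝ ∞ N s)
    (hM : ContDiffOn ℝ ∞ M s) (hNM : ∀ u ∈ s, mink (N u) (M u) < 0)
    (hτ : ∀ u ∈ s, ∀ v w, fderiv ℝ (fun u => (mink (N u) (M u))⁻¹ • pairForm N M u) u v w =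
      fderiv ℝ (fun u => (mink (N u) (M u))⁻¹ • pairForm N M u) u w v) {u₀ : E2} (hu : u₀ ∈ s) :
    ∃ (W : Set E2) (φ : E2 → ℝ), IsOpen W ∧ u₀ ∈ W ∧ W ⊆ s ∧ ContDiffOn ℝ ∞ φ W ∧
      (∀ u ∈ W, 0 < φ u) ∧
      ∀ u ∈ W, ∀ v, mink (fderiv ℝ (fun u => φ u • N u) u v) (M u) = 0 := by
  have hsm : ContDiffOn ℝ ∞ (fun u => (mink (N u) (M u))⁻¹ • pairForm N M u) s :=
    ((hN.mink hM).inv fun u hu => (hNM u hu).ne).smul (contDiffOn_pairForm hs hN hM)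
  obtain ⟨W, hW, hu', hWs, f, hf, hf'⟩ := exists_primitive hs hsm hτ hu
  -- With df = ⟨dN, M⟩/⟨N, M⟩ the product ⟨d(e^(-f) N), M⟩ equals e^(-f) (-df ⟨N, M⟩ + ⟨dN, M⟩) = 0.
  refine ⟨W, fun u => Real.exp (-f u), hW, hu', hWs, hf.neg.exp, fun u _ => Real.exp_pos _, ?_⟩
  intro u hu v
  have d1 : HasFDerivAt (fun u => Real.exp (-f u) • N u) _ u :=
    (hf' u hu).neg.exp.smul (hN.hasFDerivAt_of_isOpen hs (hWs hu))
  rw [d1.fderiv]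
  have hne := (hNM u (hWs hu)).ne
  simp only [add_apply, smul_apply, neg_apply, ContinuousLinearMap.smulRight_apply, smul_eq_mul,
    mink_add_left, mink_smul_left, pairForm_apply]
  field_simp
  ring

/-- Rotation of an orthonormal frame to a parallel frame. -/
lemma exists_parallel_frame {E₁ E₂ P Q : E2 → R41} (hs : IsOpen s) (hX : ContDiffOn ℝ ∞ X s)
    (h1 : ContDiffOn ℝ ∞ E₁ s) (h2 : ContDiffOn ℝ ∞ E₂ s) (hP : ContDiffOn ℝ ∞ P s)
    (hQ : ContDiffOn ℝ ∞ Q s) (hb : ∀ u ∈ s, IsNullBasis (E₁ u) (E₂ u) (P u) (Q u))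
    (hXP : ∀ u ∈ s, ∀ v, mink (fderiv ℝ X u v) (P u) = 0)
    (hXQ : ∀ u ∈ s, ∀ v, mink (fderiv ℝ X u v) (Q u) = 0)
    (hPQ : ∀ u ∈ s, ∀ v, mink (fderiv ℝ P u v) (Q u) = 0)
    (hE : ∀ u ∈ s, ∀ v w, mink (fderiv ℝ E₁ u v) (fderiv ℝ E₂ u w) =
      mink (fderiv ℝ E₁ u w) (fderiv ℝ E₂ u v)) {u₀ : E2} (hu : u₀ ∈ s) :
    ∃ (W : Set E2) (F₁ F₂ : E2 → R41), u₀ ∈ W ∧ W ⊆ s ∧ IsParallelFrameOn X F₁ F₂ P Q W := by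
  obtain ⟨W, hW, hu', hWs, f, hf, hf'⟩ := exists_primitive hs (contDiffOn_pairForm hs h1 h2)
    (fun u hu v w => (pairForm_closed_iff hs h1 h2 hu v w).mpr (hE u hu v w)) hu
  have k1 := h1.mono hWs
  have k2 := h2.mono hWs
  have hc := hf.cos
  have hsn := hf.sin
  -- Rotation by the angle f changes the connection form ⟨dE₁, E₂⟩ by -df, and f is a primitive of
  -- that form.
  refine ⟨W, fun u => Real.cos (f u) • E₁ u - Real.sin (f u) • E₂ u,
    fun u => Real.sin (f u) • E₁ u + Real.cos (f u) • E₂ u, hu', hWs, hW, hX.mono hWs,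
    (hc.smul k1).sub (hsn.smul k2), (hsn.smul k1).add (hc.smul k2), hP.mono hWs, hQ.mono hWs,
    ?_, fun u hu => hXP u (hWs hu), fun u hu => hXQ u (hWs hu), fun u hu => hPQ u (hWs hu), ?_⟩
  · intro u hu
    have hB := hb u (hWs hu)
    have hcs := Real.sin_sq_add_cos_sq (f u)
    constructor
    any_goals first | exact hB.pp | exact hB.qq | exact hB.pq
    all_goals
      simp only [mink_sub_left, mink_add_left, mink_smul_left, mink_sub_right, mink_add_right,
        mink_smul_right, hB.e11, hB.e22, hB.e12, mink_comm (E₂ u) (E₁ u), hB.e1p, hB.e2p, hB.e1q,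
        hB.e2q]
      first | ring1 | linear_combination hcs
  · intro u hu v
    have hB := hb u (hWs hu)
    have hcs := Real.sin_sq_add_cos_sq (f u)
    have a11 := mink_fderiv_add_eq_zero hs h1 h1 (fun u hu => (hb u hu).e11) (hWs hu) v
    have a22 := mink_fderiv_add_eq_zero hs h2 h2 (fun u hu => (hb u hu).e22) (hWs hu) v
    have a12 := mink_fderiv_add_eq_zero hs h1 h2 (fun u hu => (hb u hu).e12) (hWs hu) v
    have d : HasFDerivAt (fun u => Real.cos (f u) • E₁ u - Real.sin (f u) • E₂ u) _ u :=
      ((hf' u hu).cos.smul (h1.hasFDerivAt_of_isOpen hs (hWs hu))).sub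
        ((hf' u hu).sin.smul (h2.hasFDerivAt_of_isOpen hs (hWs hu)))
    rw [d.fderiv]
    simp only [add_apply, smul_apply, sub_apply, ContinuousLinearMap.smulRight_apply, smul_eq_mul,
      mink_sub_left, mink_add_left, mink_smul_left, mink_add_right, mink_smul_right,
      pairForm_apply, hB.e11, hB.e22, hB.e12, mink_comm (E₂ u) (E₁ u)]
    generalize Real.sin (f u) = S at *
    generalize Real.cos (f u) = C at *
    linear_combination (C * S / 2) * a11 - (C * S / 2) * a22 - S ^ 2 * a12

/-- A smooth orthonormal tangent frame of a space-like surface. -/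
lemma exists_orthonormal_tangent_frame (hs : IsOpen s) (hX : ContDiffOn ℝ ∞ X s)
    (hpos : ∀ u ∈ s, ∀ v, v ≠ 0 → 0 < mink (fderiv ℝ X u v) (fderiv ℝ X u v)) :
    ∃ a b : E2 → E2, ContDiffOn ℝ ∞ (fun u => fderiv ℝ X u (a u)) s ∧
      ContDiffOn ℝ ∞ (fun u => fderiv ℝ X u (b u)) s ∧ ∀ u ∈ s,
      mink (fderiv ℝ X u (a u)) (fderiv ℝ X u (a u)) = 1 ∧
      mink (fderiv ℝ X u (b u)) (fderiv ℝ X u (b u)) = 1 ∧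
      mink (fderiv ℝ X u (a u)) (fderiv ℝ X u (b u)) = 0 := by
  have hX' := contDiffOn_fderiv_of_isOpen hs hX
  set e₀ : E2 := EuclideanSpace.single 0 1
  set e₁ : E2 := EuclideanSpace.single 1 1
  have hlen : ∀ c : E2 → E2, ContDiffOn ℝ ∞ c s → (∀ u ∈ s, c u ≠ 0) →
      ∃ a : E2 → E2, ContDiffOn ℝ ∞ a s ∧ ∀ u ∈ s,
        mink (fderiv ℝ X u (a u)) (fderiv ℝ X u (a u)) = 1 ∧ ∃ r : ℝ, a u = r • c u := by
    intro c hc hc0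
    have hDX := hX'.clm_apply hc
    refine ⟨fun u => (Real.sqrt (mink (fderiv ℝ X u (c u)) (fderiv ℝ X u (c u))))⁻¹ • c u,
      ?_, fun u hu => ⟨?_, _, rfl⟩⟩
    · exact (((hDX.mink hDX).sqrt fun u hu => (hpos u hu _ (hc0 u hu)).ne').inv
        fun u hu => (Real.sqrt_pos.mpr (hpos u hu _ (hc0 u hu))).ne').smul hc
    · have hp := hpos u hu _ (hc0 u hu)
      have hq := Real.mul_self_sqrt hp.le
      have hq' := (Real.sqrt_pos.mpr hp).ne'
      simp only [map_smul, mink_smul_left, mink_smul_right]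
      field_simp
      rw [sq, hq]
  obtain ⟨a, ha, haX⟩ := hlen (fun _ => e₀) contDiffOn_const (fun _ _ => by simp [e₀])
  have hDa := hX'.clm_apply ha
  have hD1 : ContDiffOn ℝ ∞ (fun u => fderiv ℝ X u e₁) s := hX'.clm_apply contDiffOn_const
  obtain ⟨b, hb, hbX⟩ := hlen (fun u => e₁ - mink (fderiv ℝ X u e₁) (fderiv ℝ X u (a u)) • a u)
    (contDiffOn_const.sub ((hD1.mink hDa).smul ha)) (by
      intro u hu h0
      -- Gram–Schmidt does not degenerate: `a u` is a multiple of `e₀`, so the difference keeps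
      -- second coordinate 1.
      obtain ⟨r, hr⟩ := (haX u hu).2
      have := congrArg (fun x : E2 => x 1) h0
      simp [hr, e₀, e₁] at this)
  refine ⟨a, b, hDa, hX'.clm_apply hb, fun u hu => ⟨(haX u hu).1, (hbX u hu).1, ?_⟩⟩
  obtain ⟨r, hr⟩ := (hbX u hu).2
  rw [hr]
  simp only [map_smul, map_sub, mink_smul_right, mink_sub_right, (haX u hu).1,
    mink_comm (fderiv ℝ X u e₁)]
  ring

/-- A space-like surface with flat tangent and normal bundle carries parallel null frames; the flat
normal bundle is expressed by the closed form `⟨dN, M⟩ / ⟨N, M⟩`, the flat metric by the Gauss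
equation. -/
lemma exists_isParallelFrameOn (hs : IsOpen s) (hX : ContDiffOn ℝ ∞ X s)
    (hpos : ∀ u ∈ s, ∀ v, v ≠ 0 → 0 < mink (fderiv ℝ X u v) (fderiv ℝ X u v))
    (hN : ContDiffOn ℝ ∞ N s)
    (hM : ContDiffOn ℝ ∞ M s) (hNN : ∀ u ∈ s, mink (N u) (N u) = 0)
    (hMM : ∀ u ∈ s, mink (M u) (M u) = 0) (hNM : ∀ u ∈ s, mink (N u) (M u) < 0)
    (hXN : ∀ u ∈ s, ∀ v, mink (fderiv ℝ X u v) (N u) = 0)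
    (hXM : ∀ u ∈ s, ∀ v, mink (fderiv ℝ X u v) (M u) = 0)
    (hτ : ∀ u ∈ s, ∀ v w, fderiv ℝ (fun u => (mink (N u) (M u))⁻¹ • pairForm N M u) u v w =
      fderiv ℝ (fun u => (mink (N u) (M u))⁻¹ • pairForm N M u) u w v)
    (hG : ∀ u ∈ s, ∀ a b v w,
      mink (fderiv ℝ X u a) (fderiv ℝ N u v) * mink (fderiv ℝ X u b) (fderiv ℝ M u w) +
      mink (fderiv ℝ X u a) (fderiv ℝ M u v) * mink (fderiv ℝ X u b) (fderiv ℝ N u w) =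
      mink (fderiv ℝ X u a) (fderiv ℝ N u w) * mink (fderiv ℝ X u b) (fderiv ℝ M u v) +
      mink (fderiv ℝ X u a) (fderiv ℝ M u w) * mink (fderiv ℝ X u b) (fderiv ℝ N u v))
    {u₀ : E2} (hu : u₀ ∈ s) :
    ∃ (W : Set E2) (E₁ E₂ : E2 → R41) (φ : E2 → ℝ), u₀ ∈ W ∧ W ⊆ s ∧ (∀ u ∈ W, 0 < φ u) ∧
      ContDiffOn ℝ ∞ φ W ∧
      IsParallelFrameOn X E₁ E₂ (fun u => φ u • N u)
        (fun u => -((φ u)⁻¹ * (mink (N u) (M u))⁻¹) • M u) W := by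
  obtain ⟨W₁, φ, hW₁, hu₁, hWs, hφ, hφpos, hφN⟩ :=
    exists_parallel_null_normals hs hN hM hNM hτ hu
  obtain ⟨a, b, ha, hb, hab⟩ := exists_orthonormal_tangent_frame hs hX hpos
  have hψ : ContDiffOn ℝ ∞ (fun u => -((φ u)⁻¹ * (mink (N u) (M u))⁻¹)) W₁ :=
    ((hφ.inv fun u hu => (hφpos u hu).ne').mul
      (((hN.mink hM).inv fun u hu => (hNM u hu).ne).mono hWs)).neg
  have hP : ContDiffOn ℝ ∞ (fun u => φ u • N u) W₁ := hφ.smul (hN.mono hWs)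
  have hQ : ContDiffOn ℝ ∞ (fun u => -((φ u)⁻¹ * (mink (N u) (M u))⁻¹) • M u) W₁ :=
    hψ.smul (hM.mono hWs)
  have hbasis : ∀ u ∈ W₁, IsNullBasis (fderiv ℝ X u (a u)) (fderiv ℝ X u (b u)) (φ u • N u)
      (-((φ u)⁻¹ * (mink (N u) (M u))⁻¹) • M u) := by
    intro u hu
    obtain ⟨h1, h2, h3⟩ := hab u (hWs hu)
    have hne := (hNM u (hWs hu)).ne
    have hne' := (hφpos u hu).ne'
    constructor <;>
    simp only [h1, h2, h3, mink_smul_left, mink_smul_right, hNN u (hWs hu), hMM u (hWs hu),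
      hXN u (hWs hu), hXM u (hWs hu), mul_zero]
    field_simp
  have hXP : ∀ u ∈ W₁, ∀ v, mink (fderiv ℝ X u v) (φ u • N u) = 0 := by
    intro u hu v
    rw [mink_smul_right, hXN u (hWs hu), mul_zero]
  have hXQ : ∀ u ∈ W₁, ∀ v,
      mink (fderiv ℝ X u v) (-((φ u)⁻¹ * (mink (N u) (M u))⁻¹) • M u) = 0 := by
    intro u hu v
    rw [mink_smul_right, hXM u (hWs hu), mul_zero]
  obtain ⟨W, E₁, E₂, huW, hWW, hE⟩ := exists_parallel_frame hW₁ (hX.mono hWs) (ha.mono hWs)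
    (hb.mono hWs) hP hQ hbasis hXP hXQ
    (by
      intro u hu v
      rw [mink_smul_right, hφN u hu, mul_zero])
    (by
      intro u hu v w
      have hne := (hNM u (hWs hu)).ne
      have hne' := (hφpos u hu).ne'
      have hB := hbasis u hu
      have ha' := ha.mono hWs
      have hb' := hb.mono hWs
      have a11 := fun v => mink_fderiv_add_eq_zero hW₁ ha' ha' (fun u hu => (hbasis u hu).e11) hu v
      have a22 := fun v => mink_fderiv_add_eq_zero hW₁ hb' hb' (fun u hu => (hbasis u hu).e22) hu v
      have k1 : ∀ v, mink (fderiv ℝ (fun u => fderiv ℝ X u (a u)) u v)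
          (fderiv ℝ X u (a u)) = 0 := fun v => by linarith [a11 v]
      have k2 : ∀ v, mink (fderiv ℝ (fun u => fderiv ℝ X u (b u)) u v)
          (fderiv ℝ X u (b u)) = 0 := fun v => by linarith [a22 v]
      have p1 : ∀ v, mink (fderiv ℝ (fun u => fderiv ℝ X u (a u)) u v) (N u) =
          -mink (fderiv ℝ X u (a u)) (fderiv ℝ N u v) := fun v => by
        have := mink_fderiv_add_eq_zero hs ha hN (fun u hu => hXN u hu (a u)) (hWs hu) v
        rw [mink_comm (fderiv ℝ N u v)] at this
        linarith
      have p2 : ∀ v, mink (fderiv ℝ (fun u => fderiv ℝ X u (b u)) u v) (N u) =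
          -mink (fderiv ℝ X u (b u)) (fderiv ℝ N u v) := fun v => by
        have := mink_fderiv_add_eq_zero hs hb hN (fun u hu => hXN u hu (b u)) (hWs hu) v
        rw [mink_comm (fderiv ℝ N u v)] at this
        linarith
      have q1 : ∀ v, mink (fderiv ℝ (fun u => fderiv ℝ X u (a u)) u v) (M u) =
          -mink (fderiv ℝ X u (a u)) (fderiv ℝ M u v) := fun v => by
        have := mink_fderiv_add_eq_zero hs ha hM (fun u hu => hXM u hu (a u)) (hWs hu) v
        rw [mink_comm (fderiv ℝ M u v)] at this
        linarith
      have q2 : ∀ v, mink (fderiv ℝ (fun u => fderiv ℝ X u (b u)) u v) (M u) =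
          -mink (fderiv ℝ X u (b u)) (fderiv ℝ M u v) := fun v => by
        have := mink_fderiv_add_eq_zero hs hb hM (fun u hu => hXM u hu (b u)) (hWs hu) v
        rw [mink_comm (fderiv ℝ M u v)] at this
        linarith
      -- The derivative of each unit tangent field has no component along itself, so the tangential
      -- part of ⟨dE₁, dE₂⟩ is zero. The normal part consists of second fundamental forms, and its
      -- symmetry is `hG`.
      rw [hB.parseval, hB.parseval (fderiv ℝ (fun u => fderiv ℝ X u (a u)) u w)]
      simp only [k1, k2, mink_smul_right, p1, p2, q1, q2]
      have := hG u (hWs hu) (a u) (b u) v w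
      field_simp
      linear_combination this) hu₁
  exact ⟨W, E₁, E₂, φ, huW, hWW.trans hWs, fun u hu => hφpos u (hWW hu), hφ.mono hWW, hE⟩

end FrameExistence

/-! ### Normal projection and the Ricci equation in coordinates -/

section FlatnessInCoordinates

variable {X N M : E2 → R41} {s s' : Set E2}

/-- The coordinate vectors of the plane. -/
abbrev cv (i : Fin 2) : E2 := EuclideanSpace.single i 1

lemma eq_sum_cv (v : E2) : v = ∑ i, v i • cv i := by
  ext j
  fin_cases j <;> simp [cv]

lemma pd_apply {V : Type*} [NormedAddCommGroup V] [NormedSpace ℝ V] (i : Fin 2) (φ : E2 → V)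
    (u : E2) : pd i φ u = fderiv ℝ φ u (cv i) := rfl

lemma fderiv_eq_sum_pd {V : Type*} [NormedAddCommGroup V] [NormedSpace ℝ V] (φ : E2 → V)
    (u v : E2) : fderiv ℝ φ u v = ∑ i, v i • pd i φ u := by
  conv_lhs => rw [eq_sum_cv v]
  rw [map_sum]
  simp only [map_smul, pd_apply]

lemma contDiffOn_pd {V : Type*} [NormedAddCommGroup V] [NormedSpace ℝ V] {φ : E2 → V}
    (hs : IsOpen s) (hφ : ContDiffOn ℝ ∞ φ s) (i : Fin 2) : ContDiffOn ℝ ∞ (pd i φ) s :=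
  (contDiffOn_fderiv_of_isOpen hs hφ).clm_apply contDiffOn_const

lemma pd_pd_eq {V : Type*} [NormedAddCommGroup V] [NormedSpace ℝ V] {φ : E2 → V}
    (hs : IsOpen s) (hφ : ContDiffOn ℝ ∞ φ s) {u : E2} (hu : u ∈ s) (i j : Fin 2) :
    pd i (pd j φ) u = fderiv ℝ (fderiv ℝ φ) u (cv i) (cv j) := by
  have : HasFDerivAt (pd j φ) _ u :=
    ((contDiffOn_fderiv_of_isOpen hs hφ).hasFDerivAt_of_isOpen hs hu).clm_apply
      (hasFDerivAt_const (cv j) u)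
  rw [pd_apply, this.fderiv]
  simp

lemma pd_pd_comm {V : Type*} [NormedAddCommGroup V] [NormedSpace ℝ V] {φ : E2 → V}
    (hs : IsOpen s) (hφ : ContDiffOn ℝ ∞ φ s) {u : E2} (hu : u ∈ s) (i j : Fin 2) :
    pd i (pd j φ) u = pd j (pd i φ) u := by
  rw [pd_pd_eq hs hφ hu, pd_pd_eq hs hφ hu, fderiv_fderiv_comm hs hφ hu]

lemma inducedMetric_apply (X : E2 → R41) (u : E2) (i j : Fin 2) :
    inducedMetric X u i j = mink (pd i X u) (pd j X u) := rfl

lemma inducedMetric_symm (X : E2 → R41) (u : E2) (i j : Fin 2) :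
    inducedMetric X u i j = inducedMetric X u j i := by
  rw [inducedMetric_apply, inducedMetric_apply, mink_comm]

lemma isUnit_det_inducedMetric {u : E2}
    (hpos : ∀ v, v ≠ 0 → 0 < mink (fderiv ℝ X u v) (fderiv ℝ X u v)) :
    IsUnit (inducedMetric X u).det := by
  rw [isUnit_iff_ne_zero]
  intro h0
  obtain ⟨v, hv, hv0⟩ := Matrix.exists_mulVec_eq_zero_iff.mpr h0
  have hne : (WithLp.toLp 2 v : E2) ≠ 0 := by
    intro h
    apply hv
    ext i
    have := congrArg (fun x : E2 => x i) h
    simpa using this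
  have := hpos _ hne
  rw [fderiv_eq_sum_pd] at this
  have e0 := congrFun hv0 0
  have e1 := congrFun hv0 1
  simp only [Matrix.mulVec, dotProduct, Fin.sum_univ_two, inducedMetric_apply, Pi.zero_apply]
    at e0 e1
  simp only [Fin.sum_univ_two, mink_add_left, mink_add_right, mink_smul_left, mink_smul_right]
    at this
  refine this.ne' ?_
  linear_combination v 0 * e0 + v 1 * e1

lemma mink_normalPart_pd {u : E2} (hdet : IsUnit (inducedMetric X u).det) (w : R41) (m : Fin 2) :
    mink (normalPart X u w) (pd m X u) = 0 := by
  have h1 : ∀ k, ∑ l, (inducedMetric X u)⁻¹ k l * inducedMetric X u l m =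
      (1 : Matrix (Fin 2) (Fin 2) ℝ) k m := by
    intro k
    rw [← Matrix.nonsing_inv_mul _ hdet, Matrix.mul_apply]
  simp only [normalPart, mink_sub_left, mink_sum_left, mink_smul_left]
  have h2 : ∀ k, ∑ l, (inducedMetric X u)⁻¹ k l * mink w (pd k X u) * mink (pd l X u) (pd m X u) =
      mink w (pd k X u) * (1 : Matrix (Fin 2) (Fin 2) ℝ) k m := by
    intro k
    rw [← h1, Finset.mul_sum]
    exact Finset.sum_congr rfl fun l _ => by rw [inducedMetric_apply]; ring
  simp only [h2, Matrix.one_apply, mul_ite, mul_one, mul_zero, Finset.sum_ite_eq',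
    Finset.mem_univ, if_true, sub_self]

lemma mink_normalPart_of_orthogonal {u : E2} {n : R41}
    (hn : ∀ v, mink (fderiv ℝ X u v) n = 0) (w : R41) :
    mink (normalPart X u w) n = mink w n := by
  simp only [normalPart, mink_sub_left, mink_sum_left, mink_smul_left, pd_apply, hn, mul_zero,
    Finset.sum_const_zero, sub_zero]

/-- A null basis adapted to a space-like surface and two of its null normals. -/
lemma exists_isNullBasis (hs : IsOpen s) (hX : ContDiffOn ℝ ∞ X s)
    (hpos : ∀ u ∈ s, ∀ v, v ≠ 0 → 0 < mink (fderiv ℝ X u v) (fderiv ℝ X u v)) {u : E2}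
    (hu : u ∈ s) {n m : R41} (hn : mink n n = 0) (hm : mink m m = 0) (hnm : mink n m < 0)
    (hXn : ∀ v, mink (fderiv ℝ X u v) n = 0) (hXm : ∀ v, mink (fderiv ℝ X u v) m = 0) :
    ∃ a b, IsNullBasis (fderiv ℝ X u a) (fderiv ℝ X u b) n (-(mink n m)⁻¹ • m) := by
  obtain ⟨a, b, -, -, hab⟩ := exists_orthonormal_tangent_frame hs hX hpos
  obtain ⟨h1, h2, h3⟩ := hab u hu
  refine ⟨a u, b u, ?_⟩
  have hne := hnm.ne
  constructor <;>
  simp only [h1, h2, h3, mink_smul_left, mink_smul_right, hn, hm, hXn, hXm, mul_zero]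
  field_simp

/-- The normal plane is spanned by `n` and `m`; both being null, the coefficient of each is found by
pairing with the other. -/
lemma normalPart_eq (hs : IsOpen s) (hX : ContDiffOn ℝ ∞ X s)
    (hpos : ∀ u ∈ s, ∀ v, v ≠ 0 → 0 < mink (fderiv ℝ X u v) (fderiv ℝ X u v)) {u : E2}
    (hu : u ∈ s) {n m : R41} (hn : mink n n = 0) (hm : mink m m = 0) (hnm : mink n m < 0)
    (hXn : ∀ v, mink (fderiv ℝ X u v) n = 0) (hXm : ∀ v, mink (fderiv ℝ X u v) m = 0) (w : R41) :
    normalPart X u w = ((mink n m)⁻¹ * mink w m) • n + ((mink n m)⁻¹ * mink w n) • m := by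
  obtain ⟨a, b, hB⟩ := exists_isNullBasis hs hX hpos hu hn hm hnm hXn hXm
  have hdet := isUnit_det_inducedMetric (hpos u hu)
  have ht : ∀ a, mink (normalPart X u w) (fderiv ℝ X u a) = 0 := by
    intro a
    simp only [fderiv_eq_sum_pd X u a, mink_sum_right, mink_smul_right,
      mink_normalPart_pd hdet, mul_zero, Finset.sum_const_zero]
  have hne := hnm.ne
  rw [hB.expansion (normalPart X u w), ht, ht]
  simp only [mink_smul_right, mink_normalPart_of_orthogonal hXn,
    mink_normalPart_of_orthogonal hXm]
  module

lemma mink_eq_of_normal (hs : IsOpen s) (hX : ContDiffOn ℝ ∞ X s)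
    (hpos : ∀ u ∈ s, ∀ v, v ≠ 0 → 0 < mink (fderiv ℝ X u v) (fderiv ℝ X u v)) {u : E2}
    (hu : u ∈ s) {n m : R41} (hn : mink n n = 0) (hm : mink m m = 0) (hnm : mink n m < 0)
    (hXn : ∀ v, mink (fderiv ℝ X u v) n = 0) (hXm : ∀ v, mink (fderiv ℝ X u v) m = 0) {w : R41}
    (hw : ∀ k, mink w (pd k X u) = 0) (z : R41) :
    mink w z = (mink n m)⁻¹ * (mink w m * mink z n + mink w n * mink z m) := by
  obtain ⟨a, b, hB⟩ := exists_isNullBasis hs hX hpos hu hn hm hnm hXn hXm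
  have ht : ∀ a, mink w (fderiv ℝ X u a) = 0 := by
    intro a
    simp only [fderiv_eq_sum_pd X u a, mink_sum_right, mink_smul_right, hw, mul_zero,
      Finset.sum_const_zero]
  rw [hB.parseval w z, ht, ht]
  simp only [mink_smul_right]
  ring

lemma symmetric_of_cv {B : E2 →L[ℝ] E2 →L[ℝ] ℝ} (h : ∀ i j, B (cv i) (cv j) = B (cv j) (cv i))
    (v w : E2) : B v w = B w v := by
  have := h 0 1
  rw [eq_sum_cv v, eq_sum_cv w]
  simp only [Fin.sum_univ_two, map_add, map_smul, add_apply, smul_apply, smul_eq_mul]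
  linear_combination (v 0 * w 1 - v 1 * w 0) * this

/-- Extension of a smooth normal field from a neighbourhood by a cut-off. -/
lemma exists_smooth_extension {V : Type*} [NormedAddCommGroup V] [NormedSpace ℝ V] {φ : E2 → V}
    (hs : IsOpen s) (hφ : ContDiffOn ℝ ∞ φ s) {u₀ : E2} (hu : u₀ ∈ s) :
    ∃ χ : E2 → ℝ, ContDiff ℝ ∞ (fun u => χ u • φ u) ∧ (∀ u ∉ s, χ u = 0) ∧
      ∃ W, IsOpen W ∧ u₀ ∈ W ∧ W ⊆ s ∧ ∀ u ∈ W, χ u = 1 := by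
  obtain ⟨ε, hε, hb⟩ := Metric.isOpen_iff.mp hs u₀ hu
  let f : ContDiffBump u₀ := ⟨ε / 4, ε / 2, by positivity, by linarith⟩
  have hsub : Metric.closedBall u₀ (ε / 2) ⊆ s :=
    (Metric.closedBall_subset_ball (by linarith)).trans hb
  have hout : ∀ u ∉ Metric.closedBall u₀ (ε / 2), f u = 0 := by
    intro u hu
    apply f.zero_of_le_dist
    rw [Metric.mem_closedBall, not_le] at hu
    exact hu.le
  refine ⟨f, ?_, fun u hu => hout u fun h => hu (hsub h), Metric.ball u₀ (ε / 4),
    Metric.isOpen_ball, Metric.mem_ball_self (by positivity),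
    (Metric.ball_subset_ball (by linarith)).trans hb, fun u hu => f.one_of_mem_closedBall
      (Metric.ball_subset_closedBall hu)⟩
  rw [contDiff_iff_contDiffAt]
  intro u
  by_cases hu : u ∈ Metric.closedBall u₀ (ε / 2)
  · exact (f.contDiff.contDiffAt).smul (hφ.contDiffAt (hs.mem_nhds (hsub hu)))
  · apply (contDiffAt_const (c := (0 : V))).congr_of_eventuallyEq
    filter_upwards [Metric.isClosed_closedBall.isOpen_compl.mem_nhds hu] with u' hu'
    rw [hout u' hu', zero_smul]

/-- The Ricci equation: a flat normal bundle makes the connection form of a null normal closed. -/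
lemma normal_connection_form_closed (hs : IsOpen s) (hX : ContDiffOn ℝ ∞ X s)
    (hpos : ∀ u ∈ s, ∀ v, v ≠ 0 → 0 < mink (fderiv ℝ X u v) (fderiv ℝ X u v))
    (hflat : NormalCurvatureZeroOn X s) (hs' : IsOpen s') (hss : s' ⊆ s)
    (hN : ContDiffOn ℝ ∞ N s') (hM : ContDiffOn ℝ ∞ M s') (hNN : ∀ u ∈ s', mink (N u) (N u) = 0)
    (hMM : ∀ u ∈ s', mink (M u) (M u) = 0) (hNM : ∀ u ∈ s', mink (N u) (M u) < 0)
    (hXN : ∀ u ∈ s', ∀ v, mink (fderiv ℝ X u v) (N u) = 0)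
    (hXM : ∀ u ∈ s', ∀ v, mink (fderiv ℝ X u v) (M u) = 0) {u₀ : E2} (hu : u₀ ∈ s') (v w : E2) :
    fderiv ℝ (fun u => (mink (N u) (M u))⁻¹ • pairForm N M u) u₀ v w =
      fderiv ℝ (fun u => (mink (N u) (M u))⁻¹ • pairForm N M u) u₀ w v := by
  set τ : E2 → E2 →L[ℝ] ℝ := fun u => (mink (N u) (M u))⁻¹ • pairForm N M u with hτ
  have hτs : ContDiffOn ℝ ∞ τ s' :=
    ((hN.mink hM).inv fun u hu => (hNM u hu).ne).smul (contDiffOn_pairForm hs' hN hM)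
  -- Flatness is a statement about normal fields on all of `s`, whereas `N` is given only on `s'`.
  -- The cut-off field is normal on `s` and equals `N` near `u₀`, where the curvature is evaluated.
  obtain ⟨χ, hχ, hχ0, W, hW, huW, hWs, hχ1⟩ := exists_smooth_extension hs' hN hu
  have hnorm : ∀ u ∈ s, ∀ i, mink (χ u • N u) (pd i X u) = 0 := by
    intro u _ i
    by_cases hu' : u ∈ s'
    · rw [mink_smul_left, mink_comm, pd_apply, hXN u hu', mul_zero]
    · rw [hχ0 u hu', zero_smul, mink_zero_left]
  have key := hflat _ hχ.contDiffOn hnorm u₀ (hss hu)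
  have hnp : ∀ u ∈ s', ∀ w, normalPart X u w =
      ((mink (N u) (M u))⁻¹ * mink w (M u)) • N u +
        ((mink (N u) (M u))⁻¹ * mink w (N u)) • M u := fun u hu w =>
    normalPart_eq hs hX hpos (hss hu) (hNN u hu) (hMM u hu) (hNM u hu) (hXN u hu) (hXM u hu) w
  have hNdN : ∀ u ∈ s', ∀ v, mink (fderiv ℝ N u v) (N u) = 0 := by
    intro u hu v
    have := mink_fderiv_add_eq_zero hs' hN hN hNN hu v
    linarith
  -- Since ⟨dN, N⟩ = 0 the component along `M` vanishes: the normal connection preserves the line of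
  -- `N`, with connection form τ.
  have hD : ∀ j, ∀ u ∈ W, normalDeriv X j (fun u => χ u • N u) u = τ u (cv j) • N u := by
    intro j u hu'
    have hev : (fun u => χ u • N u) =ᶠ[nhds u] N := by
      filter_upwards [hW.mem_nhds hu'] with u' hu''
      rw [hχ1 u' hu'', one_smul]
    rw [normalDeriv, pd_apply, hev.fderiv_eq, hnp u (hWs hu'), hNdN u (hWs hu'), mul_zero,
      zero_smul, add_zero]
    rfl
  -- The term τⱼτᵢ is symmetric, so commuting covariant derivatives leave the symmetry of the
  -- derivative of τ, i.e. closedness.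
  have hDD : ∀ i j, normalDeriv X i (normalDeriv X j (fun u => χ u • N u)) u₀ =
      (fderiv ℝ τ u₀ (cv i) (cv j) + τ u₀ (cv j) * τ u₀ (cv i)) • N u₀ := by
    intro i j
    have hev : normalDeriv X j (fun u => χ u • N u) =ᶠ[nhds u₀] fun u => τ u (cv j) • N u := by
      filter_upwards [hW.mem_nhds huW] with u' hu''
      exact hD j u' hu''
    have d : HasFDerivAt (fun u => τ u (cv j) • N u) _ u₀ :=
      ((hτs.hasFDerivAt_of_isOpen hs' hu).clm_apply (hasFDerivAt_const (cv j) u₀)).smul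
        (hN.hasFDerivAt_of_isOpen hs' hu)
    rw [normalDeriv, pd_apply, hev.fderiv_eq, d.fderiv, hnp u₀ hu]
    have hne := (hNM u₀ hu).ne
    have hτj : ∀ j, mink (fderiv ℝ N u₀ (cv j)) (M u₀) = mink (N u₀) (M u₀) * τ u₀ (cv j) := by
      intro j
      simp only [hτ, smul_apply, smul_eq_mul, pairForm_apply]
      field_simp
    simp only [add_apply, smul_apply, ContinuousLinearMap.smulRight_apply, mink_add_left,
      mink_smul_left, hNdN u₀ hu, hNN u₀ hu, hτj, mul_zero, add_zero, zero_smul,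
      ContinuousLinearMap.comp_apply, ContinuousLinearMap.flip_apply, zero_apply, map_zero,
      zero_add]
    congr 1
    field_simp
    ring
  have hN0 : N u₀ ≠ 0 := by
    intro h0
    have := hNM u₀ hu
    rw [h0, mink_zero_left] at this
    exact this.false
  apply symmetric_of_cv
  intro i j
  have h1 := key i j
  rw [hDD, hDD] at h1
  have h2 := smul_left_injective ℝ hN0 h1
  linarith

end FlatnessInCoordinates

/-! ### The Gauss equation from the vanishing Riemann tensor -/

section GaussEquation

variable {X N M : E2 → R41} {s s' : Set E2}

lemma inv_inducedMetric_contDiffOn (hs : IsOpen s) (hX : ContDiffOn ℝ ∞ X s)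
    (hpos : ∀ u ∈ s, ∀ v, v ≠ 0 → 0 < mink (fderiv ℝ X u v) (fderiv ℝ X u v)) (k l : Fin 2) :
    ContDiffOn ℝ ∞ (fun u => (inducedMetric X u)⁻¹ k l) s := by
  have hg : ∀ i j, ContDiffOn ℝ ∞ (fun u => inducedMetric X u i j) s := fun i j =>
    (contDiffOn_pd hs hX i).mink (contDiffOn_pd hs hX j)
  have hdet : ContDiffOn ℝ ∞ (fun u => (inducedMetric X u).det) s := by
    simp only [Matrix.det_fin_two]
    exact ((hg 0 0).mul (hg 1 1)).sub ((hg 0 1).mul (hg 1 0))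
  have hinv := hdet.inv fun u hu => (isUnit_det_inducedMetric (hpos u hu)).ne_zero
  simp only [Matrix.inv_def, Ring.inverse_eq_inv', Matrix.adjugate_fin_two]
  fin_cases k <;> fin_cases l
  · exact hinv.mul (hg 1 1)
  · exact hinv.mul (hg 0 1).neg
  · exact hinv.mul (hg 1 0).neg
  · exact hinv.mul (hg 0 0)

/-- In the Koszul combination the symmetry of the second derivatives cancels all but one pair of
equal terms, so the Christoffel symbols are the tangential coefficients of ∂ᵢ∂ⱼX. -/
lemma christoffel_eq (hs : IsOpen s) (hX : ContDiffOn ℝ ∞ X s) {u : E2} (hu : u ∈ s)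
    (k i j : Fin 2) : christoffel (inducedMetric X) k i j u =
      ∑ l, (inducedMetric X u)⁻¹ k l * mink (pd i (pd j X) u) (pd l X u) := by
  have hd : ∀ i j l, pd i (fun w => inducedMetric X w j l) u =
      mink (pd i (pd j X) u) (pd l X u) + mink (pd j X u) (pd i (pd l X) u) := fun i j l =>
    fderiv_mink hs (contDiffOn_pd hs hX j) (contDiffOn_pd hs hX l) hu (cv i)
  rw [christoffel, Finset.mul_sum]
  refine Finset.sum_congr rfl fun l _ => ?_
  rw [hd, hd, hd, pd_pd_comm hs hX hu j i, pd_pd_comm hs hX hu l i, pd_pd_comm hs hX hu l j,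
    mink_comm (pd j X u), mink_comm (pd i X u)]
  ring

lemma christoffel_contDiffOn (hs : IsOpen s) (hX : ContDiffOn ℝ ∞ X s)
    (hpos : ∀ u ∈ s, ∀ v, v ≠ 0 → 0 < mink (fderiv ℝ X u v) (fderiv ℝ X u v)) (k i j : Fin 2) :
    ContDiffOn ℝ ∞ (christoffel (inducedMetric X) k i j) s := by
  have : ContDiffOn ℝ ∞ (fun u =>
      ∑ l, (inducedMetric X u)⁻¹ k l * mink (pd i (pd j X) u) (pd l X u)) s :=
    ContDiffOn.sum fun l _ => (inv_inducedMetric_contDiffOn hs hX hpos k l).mul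
      ((contDiffOn_pd hs (contDiffOn_pd hs hX j) i).mink (contDiffOn_pd hs hX l))
  exact this.congr fun u hu => christoffel_eq hs hX hu k i j

lemma sum_christoffel_mul (hs : IsOpen s) (hX : ContDiffOn ℝ ∞ X s)
    (hpos : ∀ u ∈ s, ∀ v, v ≠ 0 → 0 < mink (fderiv ℝ X u v) (fderiv ℝ X u v)) {u : E2}
    (hu : u ∈ s) (i j m : Fin 2) :
    ∑ k, christoffel (inducedMetric X) k i j u * inducedMetric X u k m =
      mink (pd i (pd j X) u) (pd m X u) := by
  have hdet := isUnit_det_inducedMetric (hpos u hu)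
  have h1 : ∀ l, ∑ k, inducedMetric X u m k * (inducedMetric X u)⁻¹ k l =
      (1 : Matrix (Fin 2) (Fin 2) ℝ) m l := by
    intro l
    rw [← Matrix.mul_nonsing_inv _ hdet, Matrix.mul_apply]
  simp only [christoffel_eq hs hX hu, Finset.sum_mul]
  rw [Finset.sum_comm]
  have h2 : ∀ l, ∑ k, (inducedMetric X u)⁻¹ k l * mink (pd i (pd j X) u) (pd l X u) *
      inducedMetric X u k m = mink (pd i (pd j X) u) (pd l X u) *
        (1 : Matrix (Fin 2) (Fin 2) ℝ) m l := by
    intro l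
    rw [← h1, Finset.mul_sum]
    exact Finset.sum_congr rfl fun k _ => by rw [inducedMetric_symm X u m k]; ring
  simp only [h2, Matrix.one_apply, mul_ite, mul_one, mul_zero, Finset.sum_ite_eq,
    Finset.mem_univ, if_true]

/-- The second fundamental form `∂ᵢ∂ⱼX - ∑ₘ Γᵐᵢⱼ ∂ₘX`. -/
def secondForm (X : E2 → R41) (i j : Fin 2) (u : E2) : R41 :=
  pd i (pd j X) u - ∑ m, christoffel (inducedMetric X) m i j u • pd m X u

lemma mink_secondForm_pd (hs : IsOpen s) (hX : ContDiffOn ℝ ∞ X s)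
    (hpos : ∀ u ∈ s, ∀ v, v ≠ 0 → 0 < mink (fderiv ℝ X u v) (fderiv ℝ X u v)) {u : E2}
    (hu : u ∈ s) (i j l : Fin 2) : mink (secondForm X i j u) (pd l X u) = 0 := by
  simp only [secondForm, mink_sub_left, mink_sum_left, mink_smul_left]
  rw [← sum_christoffel_mul hs hX hpos hu]
  exact sub_self _

lemma secondForm_contDiffOn (hs : IsOpen s) (hX : ContDiffOn ℝ ∞ X s)
    (hpos : ∀ u ∈ s, ∀ v, v ≠ 0 → 0 < mink (fderiv ℝ X u v) (fderiv ℝ X u v)) (i j : Fin 2) :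
    ContDiffOn ℝ ∞ (secondForm X i j) s :=
  (contDiffOn_pd hs (contDiffOn_pd hs hX j) i).sub (ContDiffOn.sum fun m _ =>
    (christoffel_contDiffOn hs hX hpos m i j).smul (contDiffOn_pd hs hX m))

lemma pd_secondForm (hs : IsOpen s) (hX : ContDiffOn ℝ ∞ X s)
    (hpos : ∀ u ∈ s, ∀ v, v ≠ 0 → 0 < mink (fderiv ℝ X u v) (fderiv ℝ X u v)) {u : E2}
    (hu : u ∈ s) (i j k : Fin 2) : pd i (secondForm X j k) u =
      pd i (pd j (pd k X)) u - ∑ m, (christoffel (inducedMetric X) m j k u • pd i (pd m X) u +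
        pd i (christoffel (inducedMetric X) m j k) u • pd m X u) := by
  have d : HasFDerivAt (secondForm X j k) _ u :=
    ((contDiffOn_pd hs (contDiffOn_pd hs hX k) j).hasFDerivAt_of_isOpen hs hu).sub
      (HasFDerivAt.fun_sum fun m (_ : m ∈ Finset.univ) =>
        ((christoffel_contDiffOn hs hX hpos m j k).hasFDerivAt_of_isOpen hs hu).smul
          ((contDiffOn_pd hs hX m).hasFDerivAt_of_isOpen hs hu))
  rw [pd_apply, d.fderiv]
  simp only [sub_apply, sum_apply, add_apply, smul_apply,
    ContinuousLinearMap.smulRight_apply, pd_apply i]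

/-- The Gauss equation of a flat space-like surface. -/
lemma secondForm_gauss (hs : IsOpen s) (hX : ContDiffOn ℝ ∞ X s)
    (hpos : ∀ u ∈ s, ∀ v, v ≠ 0 → 0 < mink (fderiv ℝ X u v) (fderiv ℝ X u v)) {u : E2}
    (hu : u ∈ s) (hR : ∀ l k i j, riemannCoeff (inducedMetric X) l k i j u = 0)
    (i j k l : Fin 2) : mink (secondForm X j k u) (secondForm X i l u) =
      mink (secondForm X i k u) (secondForm X j l u) := by
  -- Differentiate ⟨IIⱼₖ, ∂ₗX⟩ = 0; against the normal vector IIⱼₖ only the normal part IIᵢₗ of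
  -- ∂ᵢ∂ₗX counts.
  have hII : ∀ i j k l, mink (pd i (secondForm X j k) u) (pd l X u) =
      -mink (secondForm X j k u) (secondForm X i l u) := by
    intro i j k l
    have h1 := mink_fderiv_add_eq_zero hs (secondForm_contDiffOn hs hX hpos j k)
      (contDiffOn_pd hs hX l) (fun u hu => mink_secondForm_pd hs hX hpos hu j k l) hu (cv i)
    have h2 : mink (secondForm X j k u) (pd i (pd l X) u) =
        mink (secondForm X j k u) (secondForm X i l u) := by
      simp only [secondForm.eq_1 X i l, mink_sub_right, mink_sum_right, mink_smul_right,
        mink_secondForm_pd hs hX hpos hu, mul_zero, Finset.sum_const_zero, sub_zero]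
    rw [← h2, mink_comm (secondForm X j k u)]
    exact eq_neg_of_add_eq_zero_left h1
  have e1 := hII i j k l
  have e2 := hII j i k l
  rw [pd_secondForm hs hX hpos hu] at e1 e2
  rw [pd_pd_comm hs (contDiffOn_pd hs hX k) hu j i] at e2
  simp only [mink_sub_left, mink_sum_left, mink_add_left, mink_smul_left,
    ← sum_christoffel_mul hs hX hpos hu, ← inducedMetric_apply] at e1 e2
  -- In `e1 - e2` the third derivatives of `X` cancel, and what is left on the tangential side is,
  -- up to sign, the Riemann tensor with lowered index.
  have e3 : ∑ p, riemannCoeff (inducedMetric X) p k i j u * inducedMetric X u p l = 0 := by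
    simp only [hR, zero_mul, Finset.sum_const_zero]
  simp only [riemannCoeff, Fin.sum_univ_two] at e1 e2 e3
  linear_combination e1 - e2 + e3

/-- The Gauss equation in terms of the shape operators of two null normals. -/
lemma gauss_null_normals (hs : IsOpen s) (hX : ContDiffOn ℝ ∞ X s)
    (hpos : ∀ u ∈ s, ∀ v, v ≠ 0 → 0 < mink (fderiv ℝ X u v) (fderiv ℝ X u v))
    (hR : ∀ u ∈ s, ∀ l k i j, riemannCoeff (inducedMetric X) l k i j u = 0)
    (hs' : IsOpen s') (hss : s' ⊆ s)
    (hN : ContDiffOn ℝ ∞ N s') (hM : ContDiffOn ℝ ∞ M s') (hNN : ∀ u ∈ s', mink (N u) (N u) = 0)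
    (hMM : ∀ u ∈ s', mink (M u) (M u) = 0) (hNM : ∀ u ∈ s', mink (N u) (M u) < 0)
    (hXN : ∀ u ∈ s', ∀ v, mink (fderiv ℝ X u v) (N u) = 0)
    (hXM : ∀ u ∈ s', ∀ v, mink (fderiv ℝ X u v) (M u) = 0) {u : E2} (hu : u ∈ s')
    (a b v w : E2) :
    mink (fderiv ℝ X u a) (fderiv ℝ N u v) * mink (fderiv ℝ X u b) (fderiv ℝ M u w) +
      mink (fderiv ℝ X u a) (fderiv ℝ M u v) * mink (fderiv ℝ X u b) (fderiv ℝ N u w) =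
      mink (fderiv ℝ X u a) (fderiv ℝ N u w) * mink (fderiv ℝ X u b) (fderiv ℝ M u v) +
      mink (fderiv ℝ X u a) (fderiv ℝ M u w) * mink (fderiv ℝ X u b) (fderiv ℝ N u v) := by
  have hh : ∀ {N : E2 → R41}, ContDiffOn ℝ ∞ N s' →
      (∀ u ∈ s', ∀ v, mink (fderiv ℝ X u v) (N u) = 0) → ∀ j k,
      mink (secondForm X j k u) (N u) = -mink (pd k X u) (pd j N u) := by
    intro N hN hXN j k
    have h1 := mink_fderiv_add_eq_zero hs' (contDiffOn_pd hs' (hX.mono hss) k) hN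
      (fun u hu => hXN u hu (cv k)) hu (cv j)
    simp only [secondForm, mink_sub_left, mink_sum_left, mink_smul_left, pd_apply _ X, hXN u hu,
      mul_zero, Finset.sum_const_zero, sub_zero]
    rw [mink_comm (fderiv ℝ X u (cv k))]
    exact eq_neg_of_add_eq_zero_left h1
  have hne := inv_ne_zero (hNM u hu).ne
  have key : ∀ i j k l,
      mink (pd k X u) (pd j N u) * mink (pd l X u) (pd i M u) +
        mink (pd k X u) (pd j M u) * mink (pd l X u) (pd i N u) =
      mink (pd k X u) (pd i N u) * mink (pd l X u) (pd j M u) +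
        mink (pd k X u) (pd i M u) * mink (pd l X u) (pd j N u) := by
    intro i j k l
    have := secondForm_gauss hs hX hpos (hss hu) (hR u (hss hu)) i j k l
    rw [mink_eq_of_normal hs hX hpos (hss hu) (hNN u hu) (hMM u hu) (hNM u hu) (hXN u hu)
        (hXM u hu) (fun m => mink_secondForm_pd hs hX hpos (hss hu) j k m),
      mink_eq_of_normal hs hX hpos (hss hu) (hNN u hu) (hMM u hu) (hNM u hu) (hXN u hu)
        (hXM u hu) (fun m => mink_secondForm_pd hs hX hpos (hss hu) i k m)] at this
    have := mul_left_cancel₀ hne this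
    simp only [hh hN hXN, hh hM hXM] at this
    linarith
  -- The claim is bilinear in `a`, `b` and alternating in `v`, `w`, so four instances on coordinate
  -- vectors suffice.
  have k00 := key 1 0 0 0
  have k01 := key 1 0 0 1
  have k10 := key 1 0 1 0
  have k11 := key 1 0 1 1
  simp only [fderiv_eq_sum_pd, Fin.sum_univ_two, mink_add_left, mink_add_right, mink_smul_left,
    mink_smul_right]
  linear_combination (v 0 * w 1 - v 1 * w 0) * (a 0 * b 0 * k00 + a 0 * b 1 * k01 +
    a 1 * b 0 * k10 + a 1 * b 1 * k11)

end GaussEquation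

/-! ### Passing between the surface and its charts -/

section ManifoldTransfer

variable {M : Type*} [TopologicalSpace M] [ChartedSpace E2 M]
variable {V : Type*} [NormedAddCommGroup V] [NormedSpace ℝ V]
variable {V' : Type*} [NormedAddCommGroup V'] [NormedSpace ℝ V']

/-- The differential at `p` of the chart about `p₀`. -/
def chartDiff (p₀ p : M) : TangentSpace (𝓡 2) p →L[ℝ] E2 :=
  mfderiv (𝓡 2) (𝓡 2) (chartAt E2 p₀) p

lemma diff_congr {φ ψ : M → V} {p : M} (h : φ =ᶠ[nhds p] ψ) : diff φ p = diff ψ p :=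
  h.mfderiv_eq

lemma diff_comp {φ : M → V} {Φ : V → V'} {p : M} (hΦ : DifferentiableAt ℝ Φ (φ p))
    (hφ : MDifferentiableAt (𝓡 2) 𝓘(ℝ, V) φ p) (v : TangentSpace (𝓡 2) p) :
    diff (fun q => Φ (φ q)) p v = fderiv ℝ Φ (φ p) (diff φ p v) := by
  have h := mfderiv_comp (I := 𝓡 2) (I' := 𝓘(ℝ, V)) (I'' := 𝓘(ℝ, V')) p
    hΦ.mdifferentiableAt hφ
  rw [mfderiv_eq_fderiv] at h
  exact congrArg (fun L => L v) h

lemma mdifferentiableAt_of_contMDiffOn {φ : M → V} {U : Set M} (hU : IsOpen U)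
    (hφ : ContMDiffOn (𝓡 2) 𝓘(ℝ, V) ∞ φ U) {p : M} (hp : p ∈ U) :
    MDifferentiableAt (𝓡 2) 𝓘(ℝ, V) φ p :=
  (hφ.contMDiffAt (hU.mem_nhds hp)).mdifferentiableAt (by simp)

variable [IsManifold (𝓡 2) ∞ M]

lemma chartDiff_bijective {p₀ p : M} (hp : p ∈ (chartAt E2 p₀).source) :
    Function.Bijective (chartDiff p₀ p) := by
  have : IsManifold (𝓡 2) 1 M := IsManifold.of_le (n := ∞) (by simp)
  exact (mdifferentiable_chart (I := 𝓡 2) p₀).mfderiv_bijective hp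

lemma diff_comp_chart {ψ : E2 → V} {p₀ p : M} (hp : p ∈ (chartAt E2 p₀).source)
    (hψ : DifferentiableAt ℝ ψ (chartAt E2 p₀ p)) (v : TangentSpace (𝓡 2) p) :
    diff (fun q => ψ (chartAt E2 p₀ q)) p v =
      fderiv ℝ ψ (chartAt E2 p₀ p) (chartDiff p₀ p v) := by
  have : IsManifold (𝓡 2) 1 M := IsManifold.of_le (n := ∞) (by simp)
  exact diff_comp hψ ((mdifferentiable_chart (I := 𝓡 2) p₀).mdifferentiableAt hp) v

lemma contDiffOn_comp_chart_symm {φ : M → V} {U : Set M}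
    (hφ : ContMDiffOn (𝓡 2) 𝓘(ℝ, V) ∞ φ U) (p₀ : M) :
    ContDiffOn ℝ ∞ (fun u => φ ((chartAt E2 p₀).symm u))
      ((chartAt E2 p₀).target ∩ (chartAt E2 p₀).symm ⁻¹' U) := by
  rw [← contMDiffOn_iff_contDiffOn]
  exact hφ.comp ((contMDiffOn_chart_symm (I := 𝓡 2) (n := ∞) (x := p₀)).mono
    Set.inter_subset_left) fun u hu => hu.2

lemma contMDiffOn_comp_chart {ψ : E2 → V} {W : Set E2} (hψ : ContDiffOn ℝ ∞ ψ W) (p₀ : M) :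
    ContMDiffOn (𝓡 2) 𝓘(ℝ, V) ∞ (fun q => ψ (chartAt E2 p₀ q))
      ((chartAt E2 p₀).source ∩ chartAt E2 p₀ ⁻¹' W) :=
  (contMDiffOn_iff_contDiffOn.mpr hψ).comp
    ((contMDiffOn_chart (I := 𝓡 2) (n := ∞) (x := p₀)).mono Set.inter_subset_left)
    fun _ hq => hq.2

/-- Every derivative on the surface is computed through this formula; since `chartDiff` is
bijective, a statement about all tangent vectors becomes one about all vectors of the plane. -/
lemma diff_eq_fderiv {φ : M → V} {U : Set M} (hU : IsOpen U)
    (hφ : ContMDiffOn (𝓡 2) 𝓘(ℝ, V) ∞ φ U) {p₀ p : M} (hp : p ∈ (chartAt E2 p₀).source)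
    (hpU : p ∈ U) (v : TangentSpace (𝓡 2) p) :
    diff φ p v = fderiv ℝ (fun u => φ ((chartAt E2 p₀).symm u)) (chartAt E2 p₀ p)
      (chartDiff p₀ p v) := by
  have hopen := (chartAt E2 p₀).isOpen_inter_preimage_symm hU
  have hmem : chartAt E2 p₀ p ∈ (chartAt E2 p₀).target ∩ (chartAt E2 p₀).symm ⁻¹' U :=
    ⟨(chartAt E2 p₀).map_source hp, by
      rw [Set.mem_preimage, (chartAt E2 p₀).left_inv hp]; exact hpU⟩
  rw [← diff_comp_chart (ψ := fun u => φ ((chartAt E2 p₀).symm u)) hp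
    (((contDiffOn_comp_chart_symm hφ p₀).hasFDerivAt_of_isOpen hopen hmem).differentiableAt)]
  have hev : φ =ᶠ[nhds p] fun q => φ ((chartAt E2 p₀).symm (chartAt E2 p₀ q)) := by
    filter_upwards [(chartAt E2 p₀).open_source.mem_nhds hp] with q hq
    rw [(chartAt E2 p₀).left_inv hq]
  exact congrArg (fun L => L v) (diff_congr hev)

end ManifoldTransfer

/-! ### Contact elements, null normals and principal directions -/

section Envelopes

variable {M : Type*} [TopologicalSpace M] [ChartedSpace E2 M]

/-- A contact element is recovered from its normal and one sphere touching it. Hence envelopes that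
differ at a point have different normals there, and their null directions are not orthogonal. -/
lemma ContactElement.ext_of_line {e e' : ContactElement} {z : R41} (h : z ∈ e.line)
    (h' : z ∈ e'.line) (hn : e.normal = e'.normal) : e = e' := by
  obtain ⟨t, rfl⟩ := h
  obtain ⟨t', ht⟩ := h'
  obtain ⟨x, n, hx⟩ := e
  obtain ⟨x', n', hx'⟩ := e'
  simp only [Prod.mk.injEq] at ht hn
  obtain ⟨h1, rfl⟩ := ht
  subst hn
  simp only [ContactElement.mk.injEq, and_true]
  exact sub_left_injective h1

lemma ContactElement.pt_eq_of_mem_line {e : ContactElement} {z : R41} (h : z ∈ e.line) :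
    e.pt = z.1 + z.2 • e.normal := by
  obtain ⟨t, rfl⟩ := h
  simp

lemma ContactElement.mink_nullDir_self (e : ContactElement) : mink e.nullDir e.nullDir = 0 := by
  simp [mink, nullDir, e.norm_normal]

lemma ContactElement.mink_nullDir_neg {e e' : ContactElement} (h : e.normal ≠ e'.normal) :
    mink e.nullDir e'.nullDir < 0 := by
  have := inner_lt_one_iff_real_of_norm_eq_one e.norm_normal e'.norm_normal
  simp only [mink, nullDir, inner_neg_neg, mul_one]
  linarith [this.mpr h]

variable {S : M → R41} {U : Set M} {F G : M → ContactElement}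

lemma contMDiffOn_nullDir (hF : IsLegendreImmersionOn U F) :
    ContMDiffOn (𝓡 2) 𝓘(ℝ, R41) ∞ (fun q => (F q).nullDir) U := by
  have : ContDiff ℝ ∞ (fun n : E3 => ((-n, 1) : R41)) := contDiff_neg.prodMk contDiff_const
  exact this.contMDiff.comp_contMDiffOn hF.2.1

lemma diff_nullDir (hU : IsOpen U) (hF : IsLegendreImmersionOn U F) {p : M} (hp : p ∈ U)
    (v : TangentSpace (𝓡 2) p) :
    diff (fun q => (F q).nullDir) p v = (-diff (fun q => (F q).normal) p v, 0) := by
  have hd : HasFDerivAt (fun n : E3 => ((-n, 1) : R41)) _ (F p).normal :=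
    (hasFDerivAt_id (𝕜 := ℝ) (F p).normal).neg.prodMk (hasFDerivAt_const (1 : ℝ) _)
  have := diff_comp (φ := fun q => (F q).normal) hd.differentiableAt
    (mdifferentiableAt_of_contMDiffOn hU hF.2.1 hp) v
  rw [hd.fderiv] at this
  exact this

lemma thirdForm_eq_mink (hU : IsOpen U) (hF : IsLegendreImmersionOn U F) {p : M} (hp : p ∈ U)
    (v w : TangentSpace (𝓡 2) p) : thirdForm F p v w =
      mink (diff (fun q => (F q).nullDir) p v) (diff (fun q => (F q).nullDir) p w) := by
  rw [diff_nullDir hU hF hp, diff_nullDir hU hF hp]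
  simp [thirdForm, mink]

lemma inner_diff_normal_self (hU : IsOpen U) {n : M → E3}
    (hn : ContMDiffOn (𝓡 2) 𝓘(ℝ, E3) ∞ n U) (h1 : ∀ p ∈ U, ‖n p‖ = 1) {p : M} (hp : p ∈ U)
    (v : TangentSpace (𝓡 2) p) : inner ℝ (diff n p v) (n p) = 0 := by
  have hd : HasFDerivAt (fun x : E3 => inner ℝ x x) _ (n p) :=
    (hasFDerivAt_id (n p)).inner ℝ (hasFDerivAt_id (n p))
  have h2 := diff_comp hd.differentiableAt (mdifferentiableAt_of_contMDiffOn hU hn hp) v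
  have h3 : (fun q => (inner ℝ (n q) (n q) : ℝ)) =ᶠ[nhds p] fun _ => 1 := by
    filter_upwards [hU.mem_nhds hp] with q hq
    rw [real_inner_self_eq_norm_sq, h1 q hq, one_pow]
  rw [diff_congr h3, hd.fderiv] at h2
  have h4 : diff (fun _ : M => (1 : ℝ)) p v = 0 := by
    rw [diff, mfderiv_const]
    rfl
  rw [h4] at h2
  simp [real_inner_comm] at h2
  have h5 : inner ℝ (n p) (diff n p v) = (0 : ℝ) := by linarith
  rw [real_inner_comm]
  exact h5

variable [IsManifold (𝓡 2) ∞ M]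

/-- Stated for any unit-free `n` and any `f` of this form, so that it serves both for a given
envelope and for the construction of one. -/
lemma diff_pt (hU : IsOpen U) (hS : ContMDiff (𝓡 2) 𝓘(ℝ, R41) ∞ S) {n : M → E3}
    (hn : ContMDiffOn (𝓡 2) 𝓘(ℝ, E3) ∞ n U) {f : M → E3}
    (hf : ∀ p ∈ U, f p = (S p).1 + (S p).2 • n p) {p : M} (hp : p ∈ U)
    (v : TangentSpace (𝓡 2) p) :
    ContMDiffOn (𝓡 2) 𝓘(ℝ, E3) ∞ f U ∧ diff f p v =
      (diff S p v).1 + (diff S p v).2 • n p + (S p).2 • diff n p v := by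
  have hfs : ContMDiffOn (𝓡 2) 𝓘(ℝ, E3) ∞ f U := by
    have h1 : ContDiff ℝ ∞ (fun z : R41 × E3 => z.1.1 + z.1.2 • z.2) := by fun_prop
    refine (h1.contMDiff.comp_contMDiffOn (hS.contMDiffOn.prodMk_space hn)).congr fun q hq => ?_
    simp [hf q hq]
  refine ⟨hfs, ?_⟩
  have hps := mem_chart_source E2 p
  have hopen := (chartAt E2 p).isOpen_inter_preimage_symm hU
  have hmem : chartAt E2 p p ∈ (chartAt E2 p).target ∩ (chartAt E2 p).symm ⁻¹' U :=
    ⟨(chartAt E2 p).map_source hps, by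
      rw [Set.mem_preimage, (chartAt E2 p).left_inv hps]; exact hp⟩
  have dS := (contDiffOn_comp_chart_symm (hS.contMDiffOn (s := U)) p).hasFDerivAt_of_isOpen
    hopen hmem
  have dn := (contDiffOn_comp_chart_symm hn p).hasFDerivAt_of_isOpen hopen hmem
  have df : HasFDerivAt (fun u => (S ((chartAt E2 p).symm u)).1 +
      (S ((chartAt E2 p).symm u)).2 • n ((chartAt E2 p).symm u)) _ (chartAt E2 p p) :=
    dS.fst.add (dS.snd.smul dn)
  have hev : (fun u => f ((chartAt E2 p).symm u)) =ᶠ[nhds (chartAt E2 p p)]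
      fun u => (S ((chartAt E2 p).symm u)).1 +
        (S ((chartAt E2 p).symm u)).2 • n ((chartAt E2 p).symm u) := by
    filter_upwards [hopen.mem_nhds hmem] with u hu
    exact hf _ hu.2
  rw [diff_eq_fderiv hU hfs hps hp, diff_eq_fderiv hU hn hps hp,
    diff_eq_fderiv hU hS.contMDiffOn hps hp, hev.fderiv_eq, df.fderiv]
  simp only [(chartAt E2 p).left_inv hps, add_apply, smul_apply,
    ContinuousLinearMap.comp_apply, ContinuousLinearMap.smulRight_apply,
    ContinuousLinearMap.coe_fst', ContinuousLinearMap.coe_snd']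
  abel

/-- The enveloping condition says that the null direction is normal to the congruence. -/
lemma mink_diff_nullDir (hU : IsOpen U) (hS : ContMDiff (𝓡 2) 𝓘(ℝ, R41) ∞ S)
    (hF : EnvelopesOn S U F) {p : M} (hp : p ∈ U) (v : TangentSpace (𝓡 2) p) :
    mink (diff S p v) (F p).nullDir = 0 := by
  have h1 := (hF.1.2.2 p hp v).1
  rw [(diff_pt hU hS hF.1.2.1
    (fun q hq => ContactElement.pt_eq_of_mem_line (hF.2 q hq)) hp v).2, inner_add_left,
    inner_add_left, real_inner_smul_left, real_inner_smul_left,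
    inner_diff_normal_self hU hF.1.2.1 (fun q _ => (F q).norm_normal) hp,
    real_inner_self_eq_norm_sq, (F p).norm_normal] at h1
  simp only [mink, ContactElement.nullDir, inner_neg_right]
  linarith

/-- Principal directions in terms of the shape operator of the null normal. -/
lemma isPrincipal_iff (hU : IsOpen U) (hS : ContMDiff (𝓡 2) 𝓘(ℝ, R41) ∞ S)
    (hF : EnvelopesOn S U F) {p : M} (hp : p ∈ U) {E₁ E₂ m : R41}
    (hB : IsNullBasis E₁ E₂ (F p).nullDir m) (v : TangentSpace (𝓡 2) p) :
    IsPrincipal F p v ↔ v ≠ 0 ∧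
      mink (diff S p v) E₁ * mink (diff (fun q => (F q).nullDir) p v) E₂ =
      mink (diff S p v) E₂ * mink (diff (fun q => (F q).nullDir) p v) E₁ := by
  have hpt := (diff_pt hU hS hF.1.2.1
    (fun q hq => ContactElement.pt_eq_of_mem_line (hF.2 q hq)) hp v).2
  have hSN := mink_diff_nullDir hU hS hF hp v
  have hNN : mink (diff (fun q => (F q).nullDir) p v) (F p).nullDir = 0 := by
    rw [diff_nullDir hU hF.1 hp]
    simp only [mink, ContactElement.nullDir, inner_neg_neg, zero_mul, sub_zero]
    exact inner_diff_normal_self hU hF.1.2.1 (fun q _ => (F q).norm_normal) hp v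
  have key : ∀ a b : ℝ, a • diff (fun q => (F q).pt) p v +
      b • diff (fun q => (F q).normal) p v = 0 ↔
      a * mink (diff S p v) E₁ =
        (a * (S p).2 + b) * mink (diff (fun q => (F q).nullDir) p v) E₁ ∧
      a * mink (diff S p v) E₂ =
        (a * (S p).2 + b) * mink (diff (fun q => (F q).nullDir) p v) E₂ := by
    intro a b
    -- Subtracting from dS the multiple of the null direction with the same last coordinate leaves
    -- (dc + dr·n, 0), where S = (c, r) and f = c + r n. The vector `w` is a df + b dn lifted to
    -- Minkowski space, written through dS and dN.
    set w : R41 := a • (diff S p v - (diff S p v).2 • (F p).nullDir) -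
      (a * (S p).2 + b) • diff (fun q => (F q).nullDir) p v with hw
    have hw' : w =
        (a • diff (fun q => (F q).pt) p v + b • diff (fun q => (F q).normal) p v, 0) := by
      rw [hw, diff_nullDir hU hF.1 hp, hpt]
      refine Prod.ext ?_ ?_
      · simp only [ContactElement.nullDir, Prod.fst_sub, Prod.smul_fst]
        module
      · simp [ContactElement.nullDir]
    have hwE : ∀ E, mink (F p).nullDir E = 0 → mink w E = a * mink (diff S p v) E -
        (a * (S p).2 + b) * mink (diff (fun q => (F q).nullDir) p v) E := by
      intro E hE
      rw [hw, mink_sub_left, mink_smul_left, mink_sub_left, mink_smul_left, mink_smul_left, hE]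
      ring
    have e1 := hwE E₁ (by rw [mink_comm]; exact hB.e1p)
    have e2 := hwE E₂ (by rw [mink_comm]; exact hB.e2p)
    have e3 := hwE (F p).nullDir hB.pp
    rw [hSN, hNN, mul_zero, mul_zero, sub_zero] at e3
    constructor
    · intro h0
      rw [h0] at hw'
      rw [hw', show ((0, 0) : R41) = 0 from rfl, mink_zero_left] at e1 e2
      exact ⟨by linarith, by linarith⟩
    · rintro ⟨h1, h2⟩
      rw [h1, sub_self] at e1
      rw [h2, sub_self] at e2
      -- Only a multiple of the null direction remains; its last coordinate is that multiple, but
      -- `w` has last coordinate 0.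
      have h3 := hB.expansion w
      rw [e1, e2, e3] at h3
      have h4 := congrArg Prod.snd h3
      rw [congrArg Prod.snd hw'] at h4
      simp only [zero_smul, add_zero, sub_zero, zero_sub, Prod.snd_neg, Prod.smul_snd,
        ContactElement.nullDir, smul_eq_mul, mul_one, zero_eq_neg] at h4
      rw [h4] at h3
      have h5 := congrArg Prod.fst (hw'.symm.trans h3)
      simpa using h5
  unfold IsPrincipal
  refine and_congr_right fun _ => ⟨?_, fun h => ?_⟩
  · rintro ⟨a, b, hab, h0⟩
    obtain ⟨h1, h2⟩ := (key a b).mp h0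
    generalize mink (diff S p v) E₁ = s₁ at *
    generalize mink (diff S p v) E₂ = s₂ at *
    generalize mink (diff (fun q => (F q).nullDir) p v) E₁ = a₁ at *
    generalize mink (diff (fun q => (F q).nullDir) p v) E₂ = a₂ at *
    by_cases ha : a = 0
    · subst ha
      have hb : b ≠ 0 := by simpa using hab
      have h1' : a₁ = 0 := by simpa [hb] using h1.symm
      have h2' : a₂ = 0 := by simpa [hb] using h2.symm
      rw [h1', h2', mul_zero, mul_zero]
    · apply mul_left_cancel₀ ha
      linear_combination a₂ * h1 - a₁ * h2
  · generalize mink (diff S p v) E₁ = s₁ at *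
    generalize mink (diff S p v) E₂ = s₂ at *
    generalize mink (diff (fun q => (F q).nullDir) p v) E₁ = a₁ at *
    generalize mink (diff (fun q => (F q).nullDir) p v) E₂ = a₂ at *
    -- By `key` one needs a·sᵢ = (a r + b)·aᵢ for i = 1, 2, with r the radius. A nonzero component
    -- of dN is taken as a, and b is chosen so that a r + b is the matching component of dS. If dN
    -- has no tangential component, (0, 1) works.
    by_cases h1 : a₁ = 0
    · by_cases h2 : a₂ = 0
      · exact ⟨0, 1, by simp, (key 0 1).mpr ⟨by rw [h1]; ring, by rw [h2]; ring⟩⟩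
      · exact ⟨a₂, s₂ - a₂ * (S p).2, Or.inl h2, (key _ _).mpr
          ⟨by linear_combination h, by ring⟩⟩
    · exact ⟨a₁, s₁ - a₁ * (S p).2, Or.inl h1, (key _ _).mpr
          ⟨by ring, by linear_combination -h⟩⟩

end Envelopes

/-! ### Unit vectors solving the two enveloping equations -/

section UnitNormals

lemma inner_E3 (a b : E3) : inner ℝ a b = a 0 * b 0 + a 1 * b 1 + a 2 * b 2 := by
  simp only [PiLp.inner_apply, Fin.sum_univ_three, RCLike.inner_apply, conj_trivial]
  ring

/-- The cross product of Euclidean 3-space. -/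
def cross3 (a b : E3) : E3 :=
  !₂[a 1 * b 2 - a 2 * b 1, a 2 * b 0 - a 0 * b 2, a 0 * b 1 - a 1 * b 0]

@[simp] lemma cross3_zero (a b : E3) : cross3 a b 0 = a 1 * b 2 - a 2 * b 1 := rfl
@[simp] lemma cross3_one (a b : E3) : cross3 a b 1 = a 2 * b 0 - a 0 * b 2 := rfl
@[simp] lemma cross3_two (a b : E3) : cross3 a b 2 = a 0 * b 1 - a 1 * b 0 := rfl

lemma inner_cross3_left (a b : E3) : inner ℝ (cross3 a b) a = (0 : ℝ) := by
  simp only [inner_E3, cross3_zero, cross3_one, cross3_two]; ring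

lemma inner_cross3_right (a b : E3) : inner ℝ (cross3 a b) b = (0 : ℝ) := by
  simp only [inner_E3, cross3_zero, cross3_one, cross3_two]; ring

/-- The Gram determinant of two vectors. -/
def gram2 (a b : E3) : ℝ := inner ℝ a a * inner ℝ b b - inner ℝ a b ^ 2

lemma inner_cross3_self (a b : E3) : inner ℝ (cross3 a b) (cross3 a b) = gram2 a b := by
  simp only [gram2, inner_E3, cross3_zero, cross3_one, cross3_two]; ring

/-- The orthogonal complement of two independent vectors is the line of their cross product;
multiplying by the Gram determinant avoids a division. -/
lemma smul_eq_of_orthogonal {a b w : E3} (ha : inner ℝ w a = (0 : ℝ)) (hb : inner ℝ w b = (0 : ℝ)) :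
    gram2 a b • w = (inner ℝ w (cross3 a b) : ℝ) • cross3 a b := by
  simp only [inner_E3] at ha hb
  ext i
  fin_cases i
  · simp only [gram2, inner_E3, PiLp.smul_apply, smul_eq_mul, cross3_zero, cross3_one, cross3_two,
      Fin.zero_eta]
    linear_combination ((b 0 ^ 2 + b 1 ^ 2 + b 2 ^ 2) * a 0 -
      (a 0 * b 0 + a 1 * b 1 + a 2 * b 2) * b 0) * ha +
      ((a 0 ^ 2 + a 1 ^ 2 + a 2 ^ 2) * b 0 - (a 0 * b 0 + a 1 * b 1 + a 2 * b 2) * a 0) * hb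
  · simp only [gram2, inner_E3, PiLp.smul_apply, smul_eq_mul, cross3_zero, cross3_one, cross3_two,
      Fin.mk_one]
    linear_combination ((b 0 ^ 2 + b 1 ^ 2 + b 2 ^ 2) * a 1 -
      (a 0 * b 0 + a 1 * b 1 + a 2 * b 2) * b 1) * ha +
      ((a 0 ^ 2 + a 1 ^ 2 + a 2 ^ 2) * b 1 - (a 0 * b 0 + a 1 * b 1 + a 2 * b 2) * a 1) * hb
  · simp only [gram2, inner_E3, PiLp.smul_apply, smul_eq_mul, cross3_zero, cross3_one, cross3_two,
      Fin.reduceFinMk]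
    linear_combination ((b 0 ^ 2 + b 1 ^ 2 + b 2 ^ 2) * a 2 -
      (a 0 * b 0 + a 1 * b 1 + a 2 * b 2) * b 2) * ha +
      ((a 0 ^ 2 + a 1 ^ 2 + a 2 ^ 2) * b 2 - (a 0 * b 0 + a 1 * b 1 + a 2 * b 2) * a 2) * hb

/-- The vector `m` in the span of `a` and `b` with `m · a = -r` and `m · b = -t`. -/
def spanPart (a b : E3) (r t : ℝ) : E3 :=
  (-(r * inner ℝ b b - t * inner ℝ a b) / gram2 a b) • a +
    (-(t * inner ℝ a a - r * inner ℝ a b) / gram2 a b) • b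

/-- The unit vectors `n` with `n · a = -r` and `n · b = -t`, for `ε = ± 1`. -/
def unitNormal (ε : ℝ) (a b : E3) (r t : ℝ) : E3 :=
  spanPart a b r t + (ε * Real.sqrt ((1 - inner ℝ (spanPart a b r t) (spanPart a b r t)) /
    gram2 a b)) • cross3 a b

/-- The plane spanned by `(a, r)` and `(b, t)` is space-like. -/
def IsSpacelikePair (a b : E3) (r t : ℝ) : Prop :=
  ∀ x y : ℝ, (x ≠ 0 ∨ y ≠ 0) → 0 < mink (x • (a, r) + y • (b, t)) (x • (a, r) + y • (b, t))

variable {a b : E3} {r t : ℝ}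

/-- Space-like vectors have nonzero spatial part. This is applied to `a` and to the combination |a|²
b - (a·b) a, whose spatial square norm is |a|² times the Gram determinant. -/
lemma IsSpacelikePair.gram2_pos (h : IsSpacelikePair a b r t) : 0 < gram2 a b := by
  have ha := h 1 0 (Or.inl one_ne_zero)
  have hq := h (-inner ℝ a b) (inner ℝ a a) (Or.inr ?_)
  · simp only [mink, Prod.smul_mk, Prod.mk_add_mk, inner_add_left, inner_add_right,
      real_inner_smul_left, real_inner_smul_right, smul_eq_mul, real_inner_comm a b] at ha hq
    have h1 : 0 < inner ℝ a a := by nlinarith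
    have h2 : 0 < inner ℝ a a * gram2 a b := by
      unfold gram2
      nlinarith
    exact (mul_pos_iff_of_pos_left h1).mp h2
  · simp only [mink, Prod.smul_mk, Prod.mk_add_mk, inner_add_left, inner_add_right,
      real_inner_smul_left, real_inner_smul_right, smul_eq_mul, real_inner_comm a b] at ha
    nlinarith

lemma inner_spanPart_left (hD : gram2 a b ≠ 0) : inner ℝ (spanPart a b r t) a = -r := by
  simp only [spanPart, inner_add_left, real_inner_smul_left, real_inner_comm a b]
  field_simp
  simp only [gram2]
  ring

lemma inner_spanPart_right (hD : gram2 a b ≠ 0) : inner ℝ (spanPart a b r t) b = -t := by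
  simp only [spanPart, inner_add_left, real_inner_smul_left]
  field_simp
  simp only [gram2]
  ring

/-- If m = xa + yb solves the two equations, then q = |m|² = -(xr + yt). The vector x(a, r) + y(b,
t) has Lorentz square q - q², positive unless x = y = 0, so q < 1: the solution line crosses the
open unit ball. -/
lemma IsSpacelikePair.spanPart_lt (h : IsSpacelikePair a b r t) :
    inner ℝ (spanPart a b r t) (spanPart a b r t) < (1 : ℝ) := by
  have hD := h.gram2_pos.ne'
  have h1 := inner_spanPart_left (r := r) (t := t) hD
  have h2 := inner_spanPart_right (r := r) (t := t) hD
  obtain ⟨x, y, hxy⟩ : ∃ x y : ℝ, spanPart a b r t = x • a + y • b := ⟨_, _, rfl⟩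
  have h3 : inner ℝ (spanPart a b r t) (spanPart a b r t) = -(x * r + y * t) := by
    conv_lhs => rw [hxy, inner_add_left, real_inner_smul_left, real_inner_smul_left, ← hxy,
      real_inner_comm, h1, real_inner_comm, h2]
    ring
  by_cases h0 : x ≠ 0 ∨ y ≠ 0
  · have h4 := h x y h0
    simp only [mink, Prod.smul_mk, Prod.mk_add_mk, ← hxy, h3, smul_eq_mul] at h4
    rw [h3]
    nlinarith
  · push Not at h0
    rw [h3, h0.1, h0.2]
    norm_num

lemma inner_unitNormal_left (hD : gram2 a b ≠ 0) (ε : ℝ) :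
    inner ℝ (unitNormal ε a b r t) a = -r := by
  rw [unitNormal, inner_add_left, inner_spanPart_left hD, real_inner_smul_left,
    inner_cross3_left, mul_zero, add_zero]

lemma inner_unitNormal_right (hD : gram2 a b ≠ 0) (ε : ℝ) :
    inner ℝ (unitNormal ε a b r t) b = -t := by
  rw [unitNormal, inner_add_left, inner_spanPart_right hD, real_inner_smul_left,
    inner_cross3_right, mul_zero, add_zero]

lemma inner_spanPart_cross3 : inner ℝ (spanPart a b r t) (cross3 a b) = (0 : ℝ) := by
  rw [spanPart, inner_add_left, real_inner_smul_left, real_inner_smul_left,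
    real_inner_comm (cross3 a b) a, inner_cross3_left, real_inner_comm (cross3 a b) b,
    inner_cross3_right]
  ring

lemma IsSpacelikePair.norm_unitNormal (h : IsSpacelikePair a b r t) {ε : ℝ} (hε : ε ^ 2 = 1) :
    ‖unitNormal ε a b r t‖ = 1 := by
  have hD := h.gram2_pos
  have hq : 0 ≤ (1 - inner ℝ (spanPart a b r t) (spanPart a b r t)) / gram2 a b :=
    div_nonneg (by linarith [h.spanPart_lt]) hD.le
  have h1 : inner ℝ (unitNormal ε a b r t) (unitNormal ε a b r t) = (1 : ℝ) := by
    simp only [unitNormal, inner_add_left, inner_add_right, real_inner_smul_left,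
      real_inner_smul_right, inner_spanPart_cross3, real_inner_comm (spanPart a b r t) (cross3 a b),
      inner_cross3_self]
    have h2 := Real.sq_sqrt hq
    generalize Real.sqrt _ = ρ at *
    rw [eq_div_iff hD.ne'] at h2
    linear_combination h2 + ρ ^ 2 * gram2 a b * hε
  rw [real_inner_self_eq_norm_sq] at h1
  exact (pow_eq_one_iff_of_nonneg (norm_nonneg _) two_ne_zero).mp h1

lemma IsSpacelikePair.unitNormal_ne (h : IsSpacelikePair a b r t) :
    unitNormal 1 a b r t ≠ unitNormal (-1) a b r t := by
  intro h0
  have hD := h.gram2_pos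
  have hq : 0 < (1 - inner ℝ (spanPart a b r t) (spanPart a b r t)) / gram2 a b :=
    div_pos (by linarith [h.spanPart_lt]) hD
  have h1 := congrArg (fun w => (inner ℝ w (cross3 a b) : ℝ)) h0
  simp only [unitNormal, inner_add_left, real_inner_smul_left, inner_cross3_self] at h1
  have := mul_pos (Real.sqrt_pos.mpr hq) hD
  linarith

/-- Two solutions differ by a multiple of the cross product, and the unit length fixes the square of
that multiple. -/
lemma IsSpacelikePair.eq_unitNormal (h : IsSpacelikePair a b r t) {n : E3} (hn : ‖n‖ = 1)
    (ha : inner ℝ n a = -r) (hb : inner ℝ n b = -t) :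
    n = unitNormal 1 a b r t ∨ n = unitNormal (-1) a b r t := by
  have hD := h.gram2_pos
  have hq : 0 ≤ (1 - inner ℝ (spanPart a b r t) (spanPart a b r t)) / gram2 a b :=
    div_nonneg (by linarith [h.spanPart_lt]) hD.le
  have h1 := smul_eq_of_orthogonal (a := a) (b := b) (w := n - spanPart a b r t)
    (by rw [inner_sub_left, ha, inner_spanPart_left hD.ne', sub_self])
    (by rw [inner_sub_left, hb, inner_spanPart_right hD.ne', sub_self])
  obtain ⟨c, hc⟩ : ∃ c : ℝ, n = spanPart a b r t + c • cross3 a b := by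
    refine ⟨(gram2 a b)⁻¹ * inner ℝ (n - spanPart a b r t) (cross3 a b), ?_⟩
    rw [mul_smul, ← h1, inv_smul_smul₀ hD.ne']
    abel
  have h2 : inner ℝ n n = (1 : ℝ) := by rw [real_inner_self_eq_norm_sq, hn, one_pow]
  rw [hc] at h2
  simp only [inner_add_left, inner_add_right, real_inner_smul_left,
    real_inner_smul_right, inner_spanPart_cross3, real_inner_comm (spanPart a b r t) (cross3 a b),
    inner_cross3_self] at h2
  have h3 : c ^ 2 = Real.sqrt ((1 - inner ℝ (spanPart a b r t) (spanPart a b r t)) /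
      gram2 a b) ^ 2 := by
    rw [Real.sq_sqrt hq, eq_div_iff hD.ne']
    linarith
  rcases sq_eq_sq_iff_eq_or_eq_neg.mp h3 with h4 | h4
  · left
    rw [hc, unitNormal, one_mul, h4]
  · right
    rw [hc, unitNormal, neg_one_mul, h4]

lemma contDiffOn_unitNormal {s : Set E2} {a b : E2 → E3} {r t : E2 → ℝ}
    (ha : ContDiffOn ℝ ∞ a s) (hb : ContDiffOn ℝ ∞ b s) (hr : ContDiffOn ℝ ∞ r s)
    (ht : ContDiffOn ℝ ∞ t s) (h : ∀ u ∈ s, IsSpacelikePair (a u) (b u) (r u) (t u)) (ε : ℝ) :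
    ContDiffOn ℝ ∞ (fun u => unitNormal ε (a u) (b u) (r u) (t u)) s := by
  have haa := ha.inner ℝ ha
  have hab := ha.inner ℝ hb
  have hbb := hb.inner ℝ hb
  have hg : ContDiffOn ℝ ∞ (fun u => gram2 (a u) (b u)) s := (haa.mul hbb).sub (hab.pow 2)
  have hg0 : ∀ u ∈ s, gram2 (a u) (b u) ≠ 0 := fun u hu => (h u hu).gram2_pos.ne'
  have hgi := hg.inv hg0
  have hm : ContDiffOn ℝ ∞ (fun u => spanPart (a u) (b u) (r u) (t u)) s := by
    simp only [spanPart, div_eq_mul_inv]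
    exact ((((hr.mul hbb).sub (ht.mul hab)).neg.mul hgi).smul ha).add
      ((((ht.mul haa).sub (hr.mul hab)).neg.mul hgi).smul hb)
  have hk : ContDiffOn ℝ ∞ (fun u => cross3 (a u) (b u)) s := by
    rw [contDiffOn_euclidean]
    have ha' := contDiffOn_euclidean.mp ha
    have hb' := contDiffOn_euclidean.mp hb
    intro i
    fin_cases i
    · exact ((ha' 1).mul (hb' 2)).sub ((ha' 2).mul (hb' 1))
    · exact ((ha' 2).mul (hb' 0)).sub ((ha' 0).mul (hb' 2))
    · exact ((ha' 0).mul (hb' 1)).sub ((ha' 1).mul (hb' 0))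
  have hq : ContDiffOn ℝ ∞ (fun u => (1 - inner ℝ (spanPart (a u) (b u) (r u) (t u))
      (spanPart (a u) (b u) (r u) (t u))) / gram2 (a u) (b u)) s := by
    simp only [div_eq_mul_inv]
    exact (contDiffOn_const.sub (hm.inner ℝ hm)).mul hgi
  refine hm.add ((contDiffOn_const.mul (hq.sqrt fun u hu => ?_)).smul hk)
  exact (div_pos (by linarith [(h u hu).spanPart_lt]) (h u hu).gram2_pos).ne'

end UnitNormals

/-! ### Existence and uniqueness of the two envelopes -/

section Existence

variable {M : Type*} [TopologicalSpace M] [ChartedSpace E2 M] {S : M → R41}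

open Classical in
/-- The contact element with point `x` and normal `n`, if `n` is a unit vector. -/
def contactOf (x n : E3) : ContactElement :=
  -- The second branch is an arbitrary value off the neighbourhood considered; it makes the envelope
  -- a total map.
  if h : ‖n‖ = 1 then ⟨x, n, h⟩ else ⟨0, EuclideanSpace.single 0 1, by simp⟩

lemma contactOf_normal {x n : E3} (h : ‖n‖ = 1) : (contactOf x n).normal = n := by
  simp [contactOf, h]

lemma contactOf_pt {x n : E3} (h : ‖n‖ = 1) : (contactOf x n).pt = x := by
  simp [contactOf, h]

lemma contMDiffOn_congr_normal {U : Set M} {n : M → E3} {x : M → E3}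
    (hn : ContMDiffOn (𝓡 2) 𝓘(ℝ, E3) ∞ n U) (h1 : ∀ p ∈ U, ‖n p‖ = 1) :
    ContMDiffOn (𝓡 2) 𝓘(ℝ, E3) ∞ (fun p => (contactOf (x p) (n p)).normal) U :=
  hn.congr fun p hp => contactOf_normal (h1 p hp)

variable [IsManifold (𝓡 2) ∞ M]

/-- A smooth unit field whose null direction is normal to the congruence defines an envelope. -/
lemma envelopesOn_of_normal (hS : IsSpacelikeImmersion S) {U : Set M} (hU : IsOpen U) {n : M → E3}
    (hn : ContMDiffOn (𝓡 2) 𝓘(ℝ, E3) ∞ n U) (h1 : ∀ p ∈ U, ‖n p‖ = 1)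
    (hN : ∀ p ∈ U, ∀ v, mink (diff S p v) (-n p, 1) = 0) :
    EnvelopesOn S U (fun p => contactOf ((S p).1 + (S p).2 • n p) (n p)) := by
  have hpt : ∀ p ∈ U, (contactOf ((S p).1 + (S p).2 • n p) (n p)).pt =
      (S p).1 + (S p).2 • n p := fun p hp => contactOf_pt (h1 p hp)
  have hev : ∀ p ∈ U, diff (fun p => (contactOf ((S p).1 + (S p).2 • n p) (n p)).normal) p =
      diff n p := by
    intro p hp
    apply diff_congr
    filter_upwards [hU.mem_nhds hp] with q hq
    exact contactOf_normal (h1 q hq)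
  refine ⟨⟨?_, contMDiffOn_congr_normal hn h1, fun p hp v => ?_⟩, fun p hp => ⟨(S p).2, ?_⟩⟩
  · intro p hp
    exact (diff_pt hU hS.1 hn hpt hp 0).1 p hp
  · have hd := (diff_pt hU hS.1 hn hpt hp v).2
    have hm := hN p hp v
    simp only [mink, inner_neg_right, mul_one] at hm
    have hnn : inner ℝ (n p) (n p) = (1 : ℝ) := by
      rw [real_inner_self_eq_norm_sq, h1 p hp, one_pow]
    rw [hd, contactOf_normal (h1 p hp), hev p hp]
    constructor
    · rw [inner_add_left, inner_add_left, real_inner_smul_left, real_inner_smul_left, hnn,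
        inner_diff_normal_self hU hn h1 hp]
      linarith
    · intro h2 h3
      by_contra hv
      have h4 := hS.2 p v hv
      rw [h3, smul_zero, add_zero] at h2
      -- If df and dn both vanish on v, then dS(v) is a multiple of the null vector (-n, 1), which a
      -- space-like immersion excludes for v ≠ 0.
      have h5 : (diff S p v).1 = -((diff S p v).2 • n p) := eq_neg_of_add_eq_zero_left h2
      simp only [mink, h5, inner_neg_neg, real_inner_smul_left, real_inner_smul_right, hnn] at h4
      linarith
  · rw [contactOf_pt (h1 p hp), contactOf_normal (h1 p hp)]
    simp

/-- Every point has a neighbourhood with exactly two envelopes. -/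
theorem exists_enveloping_pair (hS : IsSpacelikeImmersion S) (p : M) :
    ∃ (U : Set M) (F G : M → ContactElement), IsOpen U ∧ p ∈ U ∧
      IsEnvelopingPairOn S U F G ∧
      ∀ (V : Set M) (H : M → ContactElement), IsOpen V → V ⊆ U → EnvelopesOn S V H →
        ∀ p' ∈ V, H p' = F p' ∨ H p' = G p' := by
  set e := chartAt E2 p with he
  set X : E2 → R41 := fun u => S (e.symm u) with hX
  have hXs : ContDiffOn ℝ ∞ X e.target := by
    have := contDiffOn_comp_chart_symm (hS.1.contMDiffOn (s := Set.univ)) p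
    rwa [Set.preimage_univ, Set.inter_univ] at this
  have hdS : ∀ q ∈ e.source, ∀ v, diff S q v = fderiv ℝ X (e q) (chartDiff p q v) := fun q hq v =>
    diff_eq_fderiv isOpen_univ hS.1.contMDiffOn hq (Set.mem_univ q) v
  have hsp : ∀ q ∈ e.source, IsSpacelikePair (pd 0 X (e q)).1 (pd 1 X (e q)).1
      (pd 0 X (e q)).2 (pd 1 X (e q)).2 := by
    intro q hq x y hxy
    obtain ⟨v, hv⟩ := (chartDiff_bijective hq).2 (x • cv 0 + y • cv 1)
    have hv0 : v ≠ 0 := by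
      rintro rfl
      rw [map_zero] at hv
      have h0 := congrArg (fun w : E2 => w 0) hv
      have h1 := congrArg (fun w : E2 => w 1) hv
      simp [cv] at h0 h1
      rcases hxy with h | h
      · exact h h0.symm
      · exact h h1.symm
    have h2 := hS.2 q v hv0
    rw [hdS q hq, hv, map_add, map_smul, map_smul] at h2
    exact h2
  have hsp' : ∀ u ∈ e.target, IsSpacelikePair (pd 0 X u).1 (pd 1 X u).1
      (pd 0 X u).2 (pd 1 X u).2 := by
    intro u hu
    have := hsp (e.symm u) (e.map_target hu)
    rwa [e.right_inv hu] at this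
  set n : ℝ → M → E3 := fun ε q => unitNormal ε (pd 0 X (e q)).1 (pd 1 X (e q)).1
      (pd 0 X (e q)).2 (pd 1 X (e q)).2 with hn
  have hns : ∀ ε, ContMDiffOn (𝓡 2) 𝓘(ℝ, E3) ∞ (n ε) e.source := by
    intro ε
    have h0 := contDiffOn_pd e.open_target hXs 0
    have h1 := contDiffOn_pd e.open_target hXs 1
    have := contMDiffOn_comp_chart
      (contDiffOn_unitNormal h0.fst h1.fst h0.snd h1.snd hsp' ε) p
    exact this.mono fun q hq => ⟨hq, e.map_source hq⟩
  have hn1 : ∀ ε : ℝ, ε ^ 2 = 1 → ∀ q ∈ e.source, ‖n ε q‖ = 1 := fun ε hε q hq =>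
    (hsp q hq).norm_unitNormal hε
  have hnN : ∀ ε, ∀ q ∈ e.source, ∀ v, mink (diff S q v) (-n ε q, 1) = 0 := by
    intro ε q hq v
    have hD := (hsp q hq).gram2_pos.ne'
    have h0 := inner_unitNormal_left (r := (pd 0 X (e q)).2) (t := (pd 1 X (e q)).2) hD ε
    have h1 := inner_unitNormal_right (r := (pd 0 X (e q)).2) (t := (pd 1 X (e q)).2) hD ε
    have hi : ∀ i, mink (pd i X (e q)) (-n ε q, 1) = 0 := by
      intro i
      simp only [mink, inner_neg_right, mul_one]
      rw [real_inner_comm]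
      fin_cases i
      · simp only [hn, Fin.zero_eta]
        rw [h0]
        ring
      · simp only [hn, Fin.mk_one]
        rw [h1]
        ring
    rw [hdS q hq, fderiv_eq_sum_pd]
    simp only [mink_sum_left, mink_smul_left, hi, mul_zero, Finset.sum_const_zero]
  have hF : ∀ ε : ℝ, ε ^ 2 = 1 → EnvelopesOn S e.source
      (fun q => contactOf ((S q).1 + (S q).2 • n ε q) (n ε q)) := fun ε hε =>
    envelopesOn_of_normal hS e.open_source (hns ε) (hn1 ε hε) (hnN ε)
  refine ⟨e.source, _, _, e.open_source, mem_chart_source E2 p,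
    ⟨hF 1 (by norm_num), hF (-1) (by norm_num), fun q hq h0 => ?_⟩, fun V H hV hVU hH q hq => ?_⟩
  · have h1 := congrArg ContactElement.normal h0
    rw [contactOf_normal (hn1 1 (by norm_num) q hq),
      contactOf_normal (hn1 (-1) (by norm_num) q hq)] at h1
    exact (hsp q hq).unitNormal_ne h1
  · have hi : ∀ i, inner ℝ (H q).normal (pd i X (e q)).1 = -(pd i X (e q)).2 := by
      intro i
      obtain ⟨v, hv⟩ := (chartDiff_bijective (hVU hq)).2 (cv i)
      have h2 := mink_diff_nullDir hV hS.1 hH hq v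
      rw [hdS q (hVU hq), hv, ← pd_apply] at h2
      simp only [mink, ContactElement.nullDir, inner_neg_right, mul_one] at h2
      rw [real_inner_comm]
      linarith
    rcases (hsp q (hVU hq)).eq_unitNormal (H q).norm_normal (hi 0) (hi 1) with h | h
    · left
      refine ContactElement.ext_of_line (hH.2 q hq) ((hF 1 (by norm_num)).2 q (hVU hq)) ?_
      rw [contactOf_normal (hn1 1 (by norm_num) q (hVU hq))]
      exact h
    · right
      refine ContactElement.ext_of_line (hH.2 q hq) ((hF (-1) (by norm_num)).2 q (hVU hq)) ?_
      rw [contactOf_normal (hn1 (-1) (by norm_num) q (hVU hq))]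
      exact h

end Existence

/-! ### Parallel frames along a pair of envelopes -/

section AdaptedFrames

open ComplexConjugate

/-- Lets one tangent frame serve both envelopes, each with its own null direction in the first null
place. -/
lemma IsNullBasis.swap {E₁ E₂ n m : R41} (hm : mink m m = 0)
    (h : IsNullBasis E₁ E₂ n (-(mink n m)⁻¹ • m)) (hnm : mink n m ≠ 0) :
    IsNullBasis E₁ E₂ m (-(mink m n)⁻¹ • n) := by
  have h1 := h.e1q
  have h2 := h.e2q
  rw [mink_smul_right] at h1 h2
  have hne : -(mink n m)⁻¹ ≠ 0 := neg_ne_zero.mpr (inv_ne_zero hnm)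
  have hnm' : mink m n ≠ 0 := by rwa [mink_comm]
  constructor <;>
  simp only [h.e11, h.e22, h.e12, h.e1p, h.e2p, h.pp, hm, mink_smul_left, mink_smul_right,
    (mul_eq_zero.mp h1).resolve_left hne, (mul_eq_zero.mp h2).resolve_left hne, mul_zero]
  field_simp

lemma frameForm_neg (E₁ E₂ w : R41) : frameForm E₁ (-E₂) w = conj (frameForm E₁ E₂ w) := by
  apply Complex.ext
  · simp
  · simp [mink_neg_right]

/-- If `E` is orthogonal to `N`, the tangential components of `d(ψN)` are `ψ` times those of
`dN`. -/
lemma frameForm_fderiv_smul {ψ : E2 → ℝ} {N : E2 → R41} {u : E2} (hψ : DifferentiableAt ℝ ψ u)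
    (hN : DifferentiableAt ℝ N u) {E₁ E₂ : R41} (h1 : mink E₁ (N u) = 0) (h2 : mink E₂ (N u) = 0)
    (v : E2) : frameForm E₁ E₂ (fderiv ℝ (fun u => ψ u • N u) u v) =
      ψ u * frameForm E₁ E₂ (fderiv ℝ N u v) := by
  have d : HasFDerivAt (fun u => ψ u • N u) _ u := hψ.hasFDerivAt.smul hN.hasFDerivAt
  rw [mink_comm] at h1 h2
  rw [d.fderiv]
  apply Complex.ext
  · simp [h1]
  · simp [h2]

variable {M : Type*} [TopologicalSpace M] [ChartedSpace E2 M]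

/-- The complex-valued form `v ↦ ⟨dφ(v), E₁⟩ + i ⟨dφ(v), E₂⟩` on the tangent space. -/
def frameDiff (E₁ E₂ : R41) (φ : M → R41) (p : M) : TangentSpace (𝓡 2) p →ₗ[ℝ] ℂ :=
  ((frameForm E₁ E₂).comp (diff φ p)).toLinearMap

lemma frameDiff_apply (E₁ E₂ : R41) (φ : M → R41) (p : M) (v : TangentSpace (𝓡 2) p) :
    frameDiff E₁ E₂ φ p v = frameForm E₁ E₂ (diff φ p v) := rfl

/-- The factor `-1 / ⟨N, N̂⟩` of two contact elements with null directions `N`, `N̂`. -/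
def nullFactor (e e' : ContactElement) : ℝ := -(mink e.nullDir e'.nullDir)⁻¹

lemma nullFactor_pos {e e' : ContactElement} (h : e.normal ≠ e'.normal) : 0 < nullFactor e e' := by
  rw [nullFactor, Left.neg_pos_iff, inv_lt_zero]
  exact ContactElement.mink_nullDir_neg h

/-- The linear relations between the differentials of a flat congruence and of the null normals of
its envelopes, in an orthonormal frame `E₁`, `E₂` at the point `p`. -/
structure IsAdaptedFrameAt (S : M → R41) (F G : M → ContactElement) (p : M) (E₁ E₂ : R41) :
    Prop where
  basis : IsNullBasis E₁ E₂ (F p).nullDir (nullFactor (F p) (G p) • (G p).nullDir)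
  symm_F : ∀ v w, (conj (frameDiff E₁ E₂ S p v) *
      frameDiff E₁ E₂ (fun q => (F q).nullDir) p w).re = (conj (frameDiff E₁ E₂ S p w) *
      frameDiff E₁ E₂ (fun q => (F q).nullDir) p v).re
  symm_G : ∀ v w, (frameDiff E₁ E₂ S p v *
      frameDiff E₁ (-E₂) (fun q => (G q).nullDir) p w).re = (frameDiff E₁ E₂ S p w *
      frameDiff E₁ (-E₂) (fun q => (G q).nullDir) p v).re
  wedge : ∀ v w, frameDiff E₁ (-E₂) (fun q => (G q).nullDir) p v *
      frameDiff E₁ E₂ (fun q => (F q).nullDir) p w =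
      frameDiff E₁ (-E₂) (fun q => (G q).nullDir) p w *
      frameDiff E₁ E₂ (fun q => (F q).nullDir) p v

variable {S : M → R41} {U : Set M} {F G : M → ContactElement}

lemma IsEnvelopingPairOn.normal_ne (h : IsEnvelopingPairOn S U F G) {p : M} (hp : p ∈ U) :
    (F p).normal ≠ (G p).normal := fun h0 =>
  h.2.2 p hp (ContactElement.ext_of_line (h.1.2 p hp) (h.2.1.2 p hp) h0)

lemma IsEnvelopingPairOn.symm (h : IsEnvelopingPairOn S U F G) : IsEnvelopingPairOn S U G F :=
  ⟨h.2.1, h.1, fun p hp => (h.2.2 p hp).symm⟩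

variable [IsManifold (𝓡 2) ∞ M]

/-- Around every point there is a smooth adapted frame, together with a complex function whose
squared differential is the product of the forms of the two envelopes. -/
theorem exists_adaptedFrame (hS : IsSpacelikeImmersion S) (hflat : HasFlatInducedMetric S)
    (hnormal : HasFlatNormalBundle S) (hU : IsOpen U) (hFG : IsEnvelopingPairOn S U F G)
    (hF : ThirdFormPosDefOn U F) (hG : ThirdFormPosDefOn U G) {p₀ : M} (hp₀ : p₀ ∈ U) :
    ∃ (W : Set M) (E₁ E₂ : M → R41) (z : M → ℂ), IsOpen W ∧ p₀ ∈ W ∧ W ⊆ U ∧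
      ContinuousOn E₁ W ∧ ContinuousOn E₂ W ∧ ContMDiffOn (𝓡 2) 𝓘(ℝ, ℂ) ∞ z W ∧
      ∀ p ∈ W, IsAdaptedFrameAt S F G p (E₁ p) (E₂ p) ∧
        ∀ v, diff z p v ^ 2 = nullFactor (F p) (G p) *
          (frameDiff (E₁ p) (E₂ p) (fun q => (F q).nullDir) p v *
            frameDiff (E₁ p) (-E₂ p) (fun q => (G q).nullDir) p v) := by
  set e := chartAt E2 p₀ with he
  set X : E2 → R41 := fun u => S (e.symm u) with hX
  set N : E2 → R41 := fun u => (F (e.symm u)).nullDir with hN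
  set K : E2 → R41 := fun u => (G (e.symm u)).nullDir with hK
  set s' : Set E2 := e.target ∩ e.symm ⁻¹' U with hs'
  have hs'o : IsOpen s' := e.isOpen_inter_preimage_symm hU
  have hss : s' ⊆ e.target := Set.inter_subset_left
  have hXs : ContDiffOn ℝ ∞ X e.target := by
    have := contDiffOn_comp_chart_symm (hS.1.contMDiffOn (s := Set.univ)) p₀
    rwa [Set.preimage_univ, Set.inter_univ] at this
  have hNs : ContDiffOn ℝ ∞ N s' := contDiffOn_comp_chart_symm (contMDiffOn_nullDir hFG.1.1) p₀
  have hKs : ContDiffOn ℝ ∞ K s' := contDiffOn_comp_chart_symm (contMDiffOn_nullDir hFG.2.1.1) p₀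
  have hdS : ∀ q ∈ e.source, ∀ v, diff S q v = fderiv ℝ X (e q) (chartDiff p₀ q v) := fun q hq v =>
    diff_eq_fderiv isOpen_univ hS.1.contMDiffOn hq (Set.mem_univ q) v
  have hdN : ∀ q ∈ e.source, q ∈ U → ∀ v, diff (fun q => (F q).nullDir) q v =
      fderiv ℝ N (e q) (chartDiff p₀ q v) := fun q hq hqU v =>
    diff_eq_fderiv hU (contMDiffOn_nullDir hFG.1.1) hq hqU v
  have hdK : ∀ q ∈ e.source, q ∈ U → ∀ v, diff (fun q => (G q).nullDir) q v =
      fderiv ℝ K (e q) (chartDiff p₀ q v) := fun q hq hqU v =>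
    diff_eq_fderiv hU (contMDiffOn_nullDir hFG.2.1.1) hq hqU v
  have hlift : ∀ u ∈ e.target, ∀ v : E2, ∃ v' : TangentSpace (𝓡 2) (e.symm u),
      (v ≠ 0 → v' ≠ 0) ∧ chartDiff p₀ (e.symm u) v' = v := by
    intro u hu v
    obtain ⟨v', hv'⟩ := (chartDiff_bijective (e.map_target hu)).2 v
    refine ⟨v', fun hv h0 => hv ?_, hv'⟩
    rw [← hv', h0, map_zero]
  have hpos : ∀ u ∈ e.target, ∀ v, v ≠ 0 → 0 < mink (fderiv ℝ X u v) (fderiv ℝ X u v) := by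
    intro u hu v hv
    obtain ⟨v', hv', rfl⟩ := hlift u hu v
    have := hS.2 _ v' (hv' hv)
    rwa [hdS _ (e.map_target hu), e.right_inv hu] at this
  have hXN : ∀ u ∈ s', ∀ v, mink (fderiv ℝ X u v) (N u) = 0 := by
    intro u hu v
    obtain ⟨v', hv', rfl⟩ := hlift u hu.1 v
    have := mink_diff_nullDir hU hS.1 hFG.1 hu.2 v'
    rwa [hdS _ (e.map_target hu.1), e.right_inv hu.1] at this
  have hXK : ∀ u ∈ s', ∀ v, mink (fderiv ℝ X u v) (K u) = 0 := by
    intro u hu v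
    obtain ⟨v', hv', rfl⟩ := hlift u hu.1 v
    have := mink_diff_nullDir hU hS.1 hFG.2.1 hu.2 v'
    rwa [hdS _ (e.map_target hu.1), e.right_inv hu.1] at this
  have hNpos : ∀ u ∈ s', ∀ v, v ≠ 0 → 0 < mink (fderiv ℝ N u v) (fderiv ℝ N u v) := by
    intro u hu v hv
    obtain ⟨v', hv', rfl⟩ := hlift u hu.1 v
    have := hF _ hu.2 v' (hv' hv)
    rwa [thirdForm_eq_mink hU hFG.1.1 hu.2, hdN _ (e.map_target hu.1) hu.2,
      e.right_inv hu.1] at this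
  have hKpos : ∀ u ∈ s', ∀ v, v ≠ 0 → 0 < mink (fderiv ℝ K u v) (fderiv ℝ K u v) := by
    intro u hu v hv
    obtain ⟨v', hv', rfl⟩ := hlift u hu.1 v
    have := hG _ hu.2 v' (hv' hv)
    rwa [thirdForm_eq_mink hU hFG.2.1.1 hu.2, hdK _ (e.map_target hu.1) hu.2,
      e.right_inv hu.1] at this
  have hNN : ∀ u ∈ s', mink (N u) (N u) = 0 := fun u _ => ContactElement.mink_nullDir_self _
  have hKK : ∀ u ∈ s', mink (K u) (K u) = 0 := fun u _ => ContactElement.mink_nullDir_self _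
  have hNK : ∀ u ∈ s', mink (N u) (K u) < 0 := fun u hu =>
    ContactElement.mink_nullDir_neg (hFG.normal_ne hu.2)
  have hu₀ : e p₀ ∈ s' := ⟨e.map_source (mem_chart_source E2 p₀), by
    rw [Set.mem_preimage, e.left_inv (mem_chart_source E2 p₀)]; exact hp₀⟩
  obtain ⟨W₁, E₁, E₂, φ, hu₁, hW₁s, hφpos, hφ, hfr⟩ := exists_isParallelFrameOn hs'o
    (hXs.mono hss) (fun u hu => hpos u (hss hu)) hNs hKs hNN hKK hNK hXN hXK
    (fun u hu v w => normal_connection_form_closed e.open_target hXs hpos (hnormal p₀) hs'o hss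
      hNs hKs hNN hKK hNK hXN hXK hu v w)
    (fun u hu a b v w => gauss_null_normals e.open_target hXs hpos (hflat p₀) hs'o hss hNs hKs
      hNN hKK hNK hXN hXK hu a b v w) hu₀
  set ψ : E2 → ℝ := fun u => -((φ u)⁻¹ * (mink (N u) (K u))⁻¹) with hψ
  have hW₁ := hfr.isOpen
  have hψs : ContDiffOn ℝ ∞ ψ W₁ :=
    ((hφ.inv fun u hu => (hφpos u hu).ne').mul
      (((hNs.mink hKs).inv fun u hu => (hNK u hu).ne).mono hW₁s)).neg
  have hψ0 : ∀ u ∈ W₁, ψ u ≠ 0 := fun u hu => neg_ne_zero.mpr (mul_ne_zero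
    (inv_ne_zero (hφpos u hu).ne') (inv_ne_zero (hNK u (hW₁s hu)).ne))
  have hb : ∀ u ∈ W₁, IsNullBasis (E₁ u) (E₂ u) (N u) (-(mink (N u) (K u))⁻¹ • K u) := by
    intro u hu
    have h := hfr.basis u hu
    have h1 := h.e1p
    have h2 := h.e2p
    have h3 := h.e1q
    have h4 := h.e2q
    rw [mink_smul_right] at h1 h2 h3 h4
    have hne := (hNK u (hW₁s hu)).ne
    constructor <;>
    simp only [h.e11, h.e22, h.e12, hNN u (hW₁s hu), hKK u (hW₁s hu), mink_smul_left,
      mink_smul_right, (mul_eq_zero.mp h1).resolve_left (hφpos u hu).ne',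
      (mul_eq_zero.mp h2).resolve_left (hφpos u hu).ne',
      (mul_eq_zero.mp h3).resolve_left (hψ0 u hu),
      (mul_eq_zero.mp h4).resolve_left (hψ0 u hu), mul_zero]
    field_simp
  have hE_K : ∀ u ∈ W₁, mink (E₁ u) (K u) = 0 ∧ mink (E₂ u) (K u) = 0 := by
    intro u hu
    have h3 := (hfr.basis u hu).e1q
    have h4 := (hfr.basis u hu).e2q
    rw [mink_smul_right] at h3 h4
    exact ⟨(mul_eq_zero.mp h3).resolve_left (hψ0 u hu),
      (mul_eq_zero.mp h4).resolve_left (hψ0 u hu)⟩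
  have hdP : ∀ u ∈ W₁, ∀ v, frameForm (E₁ u) (E₂ u) (fderiv ℝ (fun u => φ u • N u) u v) =
      φ u * frameForm (E₁ u) (E₂ u) (fderiv ℝ N u v) := fun u hu v =>
    frameForm_fderiv_smul (hφ.hasFDerivAt_of_isOpen hW₁ hu).differentiableAt
      (hNs.hasFDerivAt_of_isOpen hs'o (hW₁s hu)).differentiableAt (hb u hu).e1p (hb u hu).e2p v
  have hdQ : ∀ u ∈ W₁, ∀ v, frameForm (E₁ u) (-E₂ u) (fderiv ℝ (fun u => ψ u • K u) u v) =
      ψ u * frameForm (E₁ u) (-E₂ u) (fderiv ℝ K u v) := fun u hu v =>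
    frameForm_fderiv_smul (hψs.hasFDerivAt_of_isOpen hW₁ hu).differentiableAt
      (hKs.hasFDerivAt_of_isOpen hs'o (hW₁s hu)).differentiableAt (hE_K u hu).1
      (by rw [mink_neg_left, (hE_K u hu).2, neg_zero]) v
  -- Since `N` is null and orthogonal to dN, the square of d(θN) is θ² times that of dN, so
  -- positivity survives the rescaling.
  have hPQpos : ∀ {θ : E2 → ℝ} {N : E2 → R41}, ContDiffOn ℝ ∞ θ W₁ → (∀ u ∈ W₁, θ u ≠ 0) →
      ContDiffOn ℝ ∞ N s' → (∀ u ∈ s', mink (N u) (N u) = 0) →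
      (∀ u ∈ s', ∀ v, v ≠ 0 → 0 < mink (fderiv ℝ N u v) (fderiv ℝ N u v)) →
      ∀ u ∈ W₁, ∀ v, v ≠ 0 → 0 < mink (fderiv ℝ (fun u => θ u • N u) u v)
        (fderiv ℝ (fun u => θ u • N u) u v) := by
    intro θ N hθ hθ0 hN hNN hp u hu v hv
    have d : HasFDerivAt (fun u => θ u • N u) _ u := (hθ.hasFDerivAt_of_isOpen hW₁ hu).smul
      (hN.hasFDerivAt_of_isOpen hs'o (hW₁s hu))
    have h0 := mink_fderiv_add_eq_zero hs'o hN hN hNN (hW₁s hu) v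
    have h1 : mink (fderiv ℝ N u v) (N u) = 0 := by linarith
    rw [d.fderiv]
    simp only [add_apply, smul_apply, ContinuousLinearMap.smulRight_apply, mink_add_left,
      mink_add_right, mink_smul_left, mink_smul_right, h1, mink_comm (N u) (fderiv ℝ N u v),
      hNN u (hW₁s hu), mul_zero, add_zero]
    have := hp u (hW₁s hu) v hv
    have := sq_pos_of_ne_zero (hθ0 u hu)
    nlinarith [mul_pos this (hp u (hW₁s hu) v hv)]
  obtain ⟨W₂, hW₂, hu₂, hW₂₁, z, hz, hz'⟩ := hfr.exists_coordinate
    (hPQpos hφ (fun u hu => (hφpos u hu).ne') hNs hNN hNpos)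
    (hPQpos hψs hψ0 hKs hKK hKpos) hu₁
  have hmem : ∀ p ∈ e.source ∩ e ⁻¹' W₂, p ∈ U := by
    intro p hp
    have := (hW₁s (hW₂₁ hp.2)).2
    rwa [Set.mem_preimage, e.left_inv hp.1] at this
  have hcont : ContinuousOn e (e.source ∩ e ⁻¹' W₂) := e.continuousOn.mono Set.inter_subset_left
  refine ⟨e.source ∩ e ⁻¹' W₂, fun p => E₁ (e p), fun p => E₂ (e p), fun p => z (e p),
    e.isOpen_inter_preimage hW₂, ⟨mem_chart_source E2 p₀, hu₂⟩, hmem,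
    (hfr.smooth_E₁.continuousOn.mono hW₂₁).comp hcont fun p hp => hp.2,
    (hfr.smooth_E₂.continuousOn.mono hW₂₁).comp hcont fun p hp => hp.2,
    contMDiffOn_comp_chart hz p₀, fun p hp => ?_⟩
  have hpU := hmem p hp
  have hu : e p ∈ W₁ := hW₂₁ hp.2
  have hNp : N (e p) = (F p).nullDir := by simp only [hN, e.left_inv hp.1]
  have hKp : K (e p) = (G p).nullDir := by simp only [hK, e.left_inv hp.1]
  have hφ0 : (φ (e p) : ℂ) ≠ 0 := Complex.ofReal_ne_zero.mpr (hφpos _ hu).ne'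
  have hψ0' : (ψ (e p) : ℂ) ≠ 0 := Complex.ofReal_ne_zero.mpr (hψ0 _ hu)
  refine ⟨⟨?_, fun v w => ?_, fun v w => ?_, fun v w => ?_⟩, fun v => ?_⟩
  · have := hb _ hu
    rw [hNp, hKp] at this
    exact this
  · simp only [frameDiff_apply, hdS p hp.1, hdN p hp.1 hpU]
    have := hfr.re_conj_frameForm_symm hu (chartDiff p₀ p v) (chartDiff p₀ p w)
    rw [hdP _ hu, hdP _ hu, mul_left_comm, Complex.re_ofReal_mul, mul_left_comm,
      Complex.re_ofReal_mul] at this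
    exact mul_left_cancel₀ (hφpos _ hu).ne' this
  · simp only [frameDiff_apply, hdS p hp.1, hdK p hp.1 hpU]
    have := hfr.re_frameForm_symm hu (chartDiff p₀ p v) (chartDiff p₀ p w)
    rw [hdQ _ hu, hdQ _ hu, mul_left_comm, Complex.re_ofReal_mul, mul_left_comm,
      Complex.re_ofReal_mul] at this
    exact mul_left_cancel₀ (hψ0 _ hu) this
  · simp only [frameDiff_apply, hdN p hp.1 hpU, hdK p hp.1 hpU]
    have := hfr.frameForm_wedge_eq_zero hu (chartDiff p₀ p v) (chartDiff p₀ p w)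
    rw [hdQ _ hu, hdQ _ hu, hdP _ hu, hdP _ hu] at this
    apply mul_left_cancel₀ (mul_ne_zero hφ0 hψ0')
    linear_combination this
  · have hd : DifferentiableAt ℝ z (e p) := (hz.hasFDerivAt_of_isOpen hW₂ hp.2).differentiableAt
    rw [diff_comp_chart hp.1 hd, hz' _ hp.2, hdP _ hu, hdQ _ hu]
    simp only [frameDiff_apply, hdN p hp.1 hpU, hdK p hp.1 hpU]
    -- The separate scalings depend on choices of primitives; their product -1/⟨N, N̂⟩ depends only
    -- on the two envelopes, and only this product enters AB.
    have hprod : (φ (e p) : ℂ) * ψ (e p) = nullFactor (F p) (G p) := by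
      rw [← Complex.ofReal_mul]
      congr 1
      simp only [hψ, nullFactor, hNp, hKp]
      have := (hφpos _ hu).ne'
      field_simp
    rw [← hprod]
    ring

end AdaptedFrames

/-! ### Curvature lines, conformality and orientation -/

section DarbouxProperties

open ComplexConjugate

variable {M : Type*} [TopologicalSpace M] [ChartedSpace E2 M]
variable {S : M → R41} {U : Set M} {F G : M → ContactElement} {p : M} {E₁ E₂ : R41}

lemma finrank_tangentSpace (p : M) : Module.finrank ℝ (TangentSpace (𝓡 2) p) = 2 := by
  change Module.finrank ℝ E2 = 2
  simp

lemma exists_ne_zero_tangentSpace (p : M) : ∃ v : TangentSpace (𝓡 2) p, v ≠ 0 := by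
  refine ⟨(EuclideanSpace.single 0 1 : E2), fun h => ?_⟩
  have : (EuclideanSpace.single 0 1 : E2) ≠ 0 := by simp
  exact this h

@[simp] lemma frameDiff_re (E₁ E₂ : R41) (φ : M → R41) (v : TangentSpace (𝓡 2) p) :
    (frameDiff E₁ E₂ φ p v).re = mink (diff φ p v) E₁ := frameForm_re _ _ _

@[simp] lemma frameDiff_im (E₁ E₂ : R41) (φ : M → R41) (v : TangentSpace (𝓡 2) p) :
    (frameDiff E₁ E₂ φ p v).im = mink (diff φ p v) E₂ := frameForm_im _ _ _

lemma frameDiff_neg (E₁ E₂ : R41) (φ : M → R41) (v : TangentSpace (𝓡 2) p) :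
    frameDiff E₁ (-E₂) φ p v = conj (frameDiff E₁ E₂ φ p v) := frameForm_neg _ _ _

lemma mink_diff_nullDir_self (hU : IsOpen U) (hF : IsLegendreImmersionOn U F) (hp : p ∈ U)
    (v : TangentSpace (𝓡 2) p) : mink (diff (fun q => (F q).nullDir) p v) (F p).nullDir = 0 := by
  rw [diff_nullDir hU hF hp]
  simp only [mink, ContactElement.nullDir, inner_neg_neg, zero_mul, sub_zero]
  exact inner_diff_normal_self hU hF.2.1 (fun q _ => (F q).norm_normal) hp v

/-- The third fundamental form in an orthonormal frame. -/
lemma thirdForm_eq_re (hU : IsOpen U) (hF : IsLegendreImmersionOn U F) (hp : p ∈ U) {m : R41}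
    (hB : IsNullBasis E₁ E₂ (F p).nullDir m) (v w : TangentSpace (𝓡 2) p) :
    thirdForm F p v w = (conj (frameDiff E₁ E₂ (fun q => (F q).nullDir) p v) *
      frameDiff E₁ E₂ (fun q => (F q).nullDir) p w).re := by
  rw [thirdForm_eq_mink hU hF hp, hB.parseval, mink_diff_nullDir_self hU hF hp,
    mink_diff_nullDir_self hU hF hp]
  simp only [Complex.mul_re, Complex.conj_re, Complex.conj_im, frameDiff_re, frameDiff_im]
  ring

lemma thirdForm_self_eq (hU : IsOpen U) (hF : IsLegendreImmersionOn U F) (hp : p ∈ U) {m : R41}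
    (hB : IsNullBasis E₁ E₂ (F p).nullDir m) (v : TangentSpace (𝓡 2) p) :
    thirdForm F p v v = ‖frameDiff E₁ E₂ (fun q => (F q).nullDir) p v‖ ^ 2 := by
  rw [thirdForm_eq_re hU hF hp hB, Complex.sq_norm, Complex.normSq_apply]
  simp

lemma frameDiff_injective (hU : IsOpen U) (hF : IsLegendreImmersionOn U F) (hp : p ∈ U) {m : R41}
    (hB : IsNullBasis E₁ E₂ (F p).nullDir m) (hpos : ThirdFormPosDefOn U F) :
    Function.Injective (frameDiff E₁ E₂ (fun q => (F q).nullDir) p) := by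
  rw [injective_iff_map_eq_zero]
  intro v hv
  by_contra h0
  have := hpos p hp v h0
  rw [thirdForm_self_eq hU hF hp hB, hv] at this
  simp at this

/-- The adapted frame, seen from the second envelope. -/
lemma IsAdaptedFrameAt.basis_right (h : IsAdaptedFrameAt S F G p E₁ E₂)
    (hne : (F p).normal ≠ (G p).normal) :
    IsNullBasis E₁ E₂ (G p).nullDir (nullFactor (G p) (F p) • (F p).nullDir) :=
  IsNullBasis.swap (ContactElement.mink_nullDir_self _) h.basis
    (ContactElement.mink_nullDir_neg hne).ne

/-- Reflecting the frame conjugates all the complex forms, and the relations are stable under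
conjugation. -/
lemma IsAdaptedFrameAt.neg (h : IsAdaptedFrameAt S F G p E₁ E₂) :
    IsAdaptedFrameAt S F G p E₁ (-E₂) := by
  have hb := h.basis
  constructor
  · constructor <;>
    simp only [mink_neg_left, mink_neg_right, hb.e11, hb.e22, hb.e12, hb.pp, hb.qq, hb.pq,
      hb.e1p, hb.e2p, hb.e1q, hb.e2q, neg_neg, neg_zero]
  · intro v w
    have := h.symm_F v w
    simp only [frameDiff_neg, Complex.mul_re, Complex.conj_re, Complex.conj_im] at this ⊢
    linarith
  · intro v w
    have := h.symm_G v w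
    simp only [frameDiff_neg, Complex.mul_re, Complex.conj_re, Complex.conj_im] at this ⊢
    linarith
  · intro v w
    have := congrArg conj (h.wedge v w)
    simpa only [frameDiff_neg, map_mul, neg_neg, Complex.conj_conj] using this

lemma IsAdaptedFrameAt.exists_ratio (h : IsAdaptedFrameAt S F G p E₁ E₂) (hU : IsOpen U)
    (hFG : IsEnvelopingPairOn S U F G) (hF : ThirdFormPosDefOn U F) (hG : ThirdFormPosDefOn U G)
    (hp : p ∈ U) : ∃ μ : ℂ, μ ≠ 0 ∧ ∀ v, frameDiff E₁ (-E₂) (fun q => (G q).nullDir) p v =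
      μ * frameDiff E₁ E₂ (fun q => (F q).nullDir) p v := by
  obtain ⟨v₀, hv₀⟩ := exists_ne_zero_tangentSpace p
  have hA := frameDiff_injective hU hFG.1.1 hp h.basis hF
  have hB := frameDiff_injective hU hFG.2.1.1 hp (h.basis_right (hFG.normal_ne hp)) hG
  refine ⟨_, div_ne_zero ?_ ?_, exists_ratio_of_wedge_eq_zero hA h.wedge hv₀⟩
  · rw [frameDiff_neg, map_ne_zero]
    exact fun h0 => hv₀ (hB (by rw [h0, map_zero]))
  · exact fun h0 => hv₀ (hA (by rw [h0, map_zero]))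

lemma IsAdaptedFrameAt.exists_proportion (h : IsAdaptedFrameAt S F G p E₁ E₂) (hU : IsOpen U)
    (hFG : IsEnvelopingPairOn S U F G) (hF : ThirdFormPosDefOn U F) (hG : ThirdFormPosDefOn U G)
    (hp : p ∈ U) : ∃ t a : ℝ, ∀ v : TangentSpace (𝓡 2) p,
      (conj (frameDiff E₁ E₂ S p v) * frameDiff E₁ E₂ (fun q => (F q).nullDir) p v).im =
        t * (frameDiff E₁ (-E₂) (fun q => (G q).nullDir) p v *
          frameDiff E₁ E₂ (fun q => (F q).nullDir) p v).im ∧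
      (frameDiff E₁ E₂ S p v * frameDiff E₁ (-E₂) (fun q => (G q).nullDir) p v).im =
        a * (frameDiff E₁ (-E₂) (fun q => (G q).nullDir) p v *
          frameDiff E₁ E₂ (fun q => (F q).nullDir) p v).im := by
  obtain ⟨μ, hμ, hB⟩ := h.exists_ratio hU hFG hF hG hp
  exact exists_real_proportion_of_symmetric (finrank_tangentSpace p)
    (frameDiff_injective hU hFG.1.1 hp h.basis hF) hμ hB h.symm_F h.symm_G

/-- From B = μA the conformal factor is |μ|², where both forms are taken for the unscaled null
normals. -/
lemma IsAdaptedFrameAt.thirdForms_conformal (h : IsAdaptedFrameAt S F G p E₁ E₂)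
    (hU : IsOpen U) (hFG : IsEnvelopingPairOn S U F G)
    (hF : ThirdFormPosDefOn U F) (hG : ThirdFormPosDefOn U G) (hp : p ∈ U) :
    ∃ ρ : ℝ, 0 < ρ ∧ ∀ v w, thirdForm G p v w = ρ * thirdForm F p v w := by
  obtain ⟨μ, hμ, hB⟩ := h.exists_ratio hU hFG hF hG hp
  refine ⟨Complex.normSq μ, Complex.normSq_pos.mpr hμ, fun v w => ?_⟩
  rw [thirdForm_eq_re hU hFG.2.1.1 hp (h.basis_right (hFG.normal_ne hp)),
    thirdForm_eq_re hU hFG.1.1 hp h.basis]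
  have h1 : (conj (frameDiff E₁ E₂ (fun q => (G q).nullDir) p v) *
      frameDiff E₁ E₂ (fun q => (G q).nullDir) p w).re =
      (frameDiff E₁ (-E₂) (fun q => (G q).nullDir) p v *
        conj (frameDiff E₁ (-E₂) (fun q => (G q).nullDir) p w)).re := by
    simp only [frameDiff_neg, Complex.conj_conj]
  rw [h1, hB, hB, map_mul, Complex.normSq_apply]
  simp only [Complex.mul_re, Complex.mul_im, Complex.conj_re, Complex.conj_im]
  ring

variable [IsManifold (𝓡 2) ∞ M]

lemma IsAdaptedFrameAt.isPrincipal_left (h : IsAdaptedFrameAt S F G p E₁ E₂) (hU : IsOpen U)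
    (hS : ContMDiff (𝓡 2) 𝓘(ℝ, R41) ∞ S) (hFG : IsEnvelopingPairOn S U F G)
    (hp : p ∈ U) (v : TangentSpace (𝓡 2) p) : IsPrincipal F p v ↔ v ≠ 0 ∧
      (conj (frameDiff E₁ E₂ S p v) * frameDiff E₁ E₂ (fun q => (F q).nullDir) p v).im = 0 := by
  rw [isPrincipal_iff hU hS hFG.1 hp h.basis]
  simp only [Complex.mul_im, Complex.conj_re, Complex.conj_im, frameDiff_re, frameDiff_im]
  exact and_congr_right fun _ => ⟨fun h => by linarith, fun h => by linarith⟩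

lemma IsAdaptedFrameAt.isPrincipal_right (h : IsAdaptedFrameAt S F G p E₁ E₂) (hU : IsOpen U)
    (hS : ContMDiff (𝓡 2) 𝓘(ℝ, R41) ∞ S) (hFG : IsEnvelopingPairOn S U F G)
    (hp : p ∈ U) (v : TangentSpace (𝓡 2) p) : IsPrincipal G p v ↔ v ≠ 0 ∧
      (frameDiff E₁ E₂ S p v * frameDiff E₁ (-E₂) (fun q => (G q).nullDir) p v).im = 0 := by
  rw [isPrincipal_iff hU hS hFG.2.1 hp (h.basis_right (hFG.normal_ne hp))]
  simp only [Complex.mul_im, frameDiff_re, frameDiff_im, mink_neg_right]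
  exact and_congr_right fun _ => ⟨fun h => by linarith, fun h => by linarith⟩

/-- Both principal nets are cut out by real multiples t, a of one quadratic form Im(BA). A zero
multiple makes every direction principal, so at a non-umbilic point the factor cancels. -/
lemma IsAdaptedFrameAt.curvatureLinesCorrespond (h : IsAdaptedFrameAt S F G p E₁ E₂)
    (hU : IsOpen U) (hS : ContMDiff (𝓡 2) 𝓘(ℝ, R41) ∞ S) (hFG : IsEnvelopingPairOn S U F G)
    (hF : ThirdFormPosDefOn U F) (hG : ThirdFormPosDefOn U G) (hp : p ∈ U) :
    (¬ IsUmbilic F p → ∀ v, IsPrincipal F p v → IsPrincipal G p v) ∧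
    (¬ IsUmbilic G p → ∀ v, IsPrincipal G p v → IsPrincipal F p v) := by
  obtain ⟨t, a, hta⟩ := h.exists_proportion hU hFG hF hG hp
  simp only [IsUmbilic, h.isPrincipal_left hU hS hFG hp, h.isPrincipal_right hU hS hFG hp,
    fun v => (hta v).1, fun v => (hta v).2]
  constructor
  · intro hum v hv
    rcases mul_eq_zero.mp hv.2 with h0 | h0
    · exact absurd (fun v hv => ⟨hv, by rw [h0, zero_mul]⟩) hum
    · exact ⟨hv.1, by rw [h0, mul_zero]⟩
  · intro hum v hv
    rcases mul_eq_zero.mp hv.2 with h0 | h0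
    · exact absurd (fun v hv => ⟨hv, by rw [h0, zero_mul]⟩) hum
    · exact ⟨hv.1, by rw [h0, mul_zero]⟩

/-- The tangential part of dN̂ is B̄ = μ̄Ā, a similarity composed with a reflection of the
tangential part A of dN; its area form is therefore -|μ|² times that of A. -/
lemma IsAdaptedFrameAt.tangentialArea_mul_neg (h : IsAdaptedFrameAt S F G p E₁ E₂)
    (hU : IsOpen U) (hS : ContMDiff (𝓡 2) 𝓘(ℝ, R41) ∞ S) (hFG : IsEnvelopingPairOn S U F G)
    (hF : ThirdFormPosDefOn U F) (hG : ThirdFormPosDefOn U G) (hp : p ∈ U) {e₂ e₃ : R41}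
    (he₂ : e₂ ∈ Set.range (diff S p)) (he₃ : e₃ ∈ Set.range (diff S p)) (h22 : mink e₂ e₂ = 1)
    (h33 : mink e₃ e₃ = 1) (h23 : mink e₂ e₃ = 0) {v w : TangentSpace (𝓡 2) p}
    (hvw : LinearIndependent ℝ ![v, w]) :
    tangentialArea F p e₂ e₃ v w * tangentialArea G p e₂ e₃ v w < 0 := by
  obtain ⟨μ, hμ, hB⟩ := h.exists_ratio hU hFG hF hG hp
  have hA := frameDiff_injective hU hFG.1.1 hp h.basis hF
  have hexp : ∀ x ∈ Set.range (diff S p), x = mink x E₁ • E₁ + mink x E₂ • E₂ := by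
    rintro _ ⟨x, rfl⟩
    conv_lhs => rw [h.basis.expansion (diff S p x), mink_smul_right,
      mink_diff_nullDir hU hS hFG.1 hp, mink_diff_nullDir hU hS hFG.2.1 hp]
    simp
  have x2 := hexp e₂ he₂
  have x3 := hexp e₃ he₃
  generalize mink e₂ E₁ = a at x2
  generalize mink e₂ E₂ = b at x2
  generalize mink e₃ E₁ = c at x3
  generalize mink e₃ E₂ = d at x3
  subst x2 x3
  simp only [mink_add_left, mink_add_right, mink_smul_left, mink_smul_right, h.basis.e11,
    h.basis.e22, h.basis.e12, mink_comm E₂ E₁] at h22 h33 h23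
  -- Lagrange's identity. The change of frame may reverse orientation, but the determinant enters
  -- both area forms, hence only squared.
  have hdet : (a * d - b * c) ^ 2 = 1 := by
    have e1 : a ^ 2 + b ^ 2 = 1 := by linarith
    have e2 : c ^ 2 + d ^ 2 = 1 := by linarith
    have e3 : a * c + b * d = 0 := by linarith
    linear_combination (c ^ 2 + d ^ 2) * e1 + e2 - (a * c + b * d) * e3
  have hBv := congrArg conj (hB v)
  have hBw := congrArg conj (hB w)
  rw [frameDiff_neg, Complex.conj_conj] at hBv hBw
  have hv1 := congrArg Complex.re hBv
  have hv2 := congrArg Complex.im hBv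
  have hw1 := congrArg Complex.re hBw
  have hw2 := congrArg Complex.im hBw
  simp only [map_mul, Complex.mul_re, Complex.mul_im, Complex.conj_re, Complex.conj_im,
    frameDiff_re, frameDiff_im] at hv1 hv2 hw1 hw2
  have hD : mink (diff (fun q => (F q).nullDir) p v) E₁ *
      mink (diff (fun q => (F q).nullDir) p w) E₂ -
      mink (diff (fun q => (F q).nullDir) p v) E₂ *
      mink (diff (fun q => (F q).nullDir) p w) E₁ ≠ 0 := by
    intro h0
    rw [LinearIndependent.pair_iff] at hvw
    -- These coefficients cancel the real part of the value of A, and `h0` cancels the imaginary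
    -- part; injectivity then gives a relation between `v` and `w`, so Re A(v) = 0. The second
    -- relation gives Im A(v) = 0.
    have k1 := hvw (-mink (diff (fun q => (F q).nullDir) p w) E₁)
      (mink (diff (fun q => (F q).nullDir) p v) E₁) (hA (by
        rw [map_zero, map_add, map_smul, map_smul]
        apply Complex.ext
        · simp only [Complex.add_re, Complex.smul_re, frameDiff_re, smul_eq_mul, Complex.zero_re]
          ring
        · simp only [Complex.add_im, Complex.smul_im, frameDiff_im, smul_eq_mul, Complex.zero_im]
          linarith))
    have k2 := hvw (-mink (diff (fun q => (F q).nullDir) p w) E₂)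
      (mink (diff (fun q => (F q).nullDir) p v) E₂) (hA (by
        rw [map_zero, map_add, map_smul, map_smul]
        apply Complex.ext
        · simp only [Complex.add_re, Complex.smul_re, frameDiff_re, smul_eq_mul, Complex.zero_re]
          linarith
        · simp only [Complex.add_im, Complex.smul_im, frameDiff_im, smul_eq_mul, Complex.zero_im]
          ring))
    have hv0 : v = 0 := hA (by
      rw [map_zero]
      apply Complex.ext
      · simpa using k1.2
      · simpa using k2.2)
    have := hvw 1 0 (by rw [hv0]; simp)
    exact one_ne_zero this.1
  have hμ2 := Complex.normSq_pos.mpr hμ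
  rw [Complex.normSq_apply] at hμ2
  simp only [tangentialArea, mink_add_right, mink_smul_right, hv1, hv2, hw1, hw2]
  generalize mink (diff (fun q => (F q).nullDir) p v) E₁ = v₁ at *
  generalize mink (diff (fun q => (F q).nullDir) p v) E₂ = v₂ at *
  generalize mink (diff (fun q => (F q).nullDir) p w) E₁ = w₁ at *
  generalize mink (diff (fun q => (F q).nullDir) p w) E₂ = w₂ at *
  have hpos : 0 < (μ.re * μ.re + μ.im * μ.im) * (v₁ * w₂ - v₂ * w₁) ^ 2 :=
    mul_pos hμ2 (sq_pos_of_ne_zero hD)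
  refine lt_of_eq_of_lt ?_ (neg_lt_zero.mpr hpos)
  linear_combination (-(μ.re * μ.re + μ.im * μ.im) * (v₁ * w₂ - v₂ * w₁) ^ 2) * hdet

end DarbouxProperties

/-! ### The global quadratic differential and L-isothermic coordinates -/

section QuadraticDifferential

open ComplexConjugate

variable {M : Type*} [TopologicalSpace M] [ChartedSpace E2 M]
variable {S : M → R41} {U : Set M} {F G : M → ContactElement} {p : M} {E₁ E₂ : R41}

/-- The orientation of a pair of spheres `E₁`, `E₂` with respect to the normal `n`. -/
def frameOrientation (n : E3) (E₁ E₂ : R41) : ℝ := inner ℝ (cross3 E₁.1 E₂.1) n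

lemma sq_inner_cross3 (a b n : E3) : (inner ℝ (cross3 a b) n : ℝ) ^ 2 =
    inner ℝ a a * (inner ℝ b b * inner ℝ n n - inner ℝ b n ^ 2) -
    inner ℝ a b * (inner ℝ a b * inner ℝ n n - inner ℝ b n * inner ℝ a n) +
    inner ℝ a n * (inner ℝ a b * inner ℝ b n - inner ℝ b b * inner ℝ a n) := by
  simp only [inner_E3, cross3_zero, cross3_one, cross3_two]
  ring

/-- The square of the triple product is the Gram determinant of the spatial parts of `E₁`, `E₂` and
the normal, and the null-basis relations make it equal to 1. -/
lemma frameOrientation_ne_zero {e : ContactElement} {m : R41}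
    (h : IsNullBasis E₁ E₂ e.nullDir m) : frameOrientation e.normal E₁ E₂ ≠ 0 := by
  have h11 := h.e11
  have h22 := h.e22
  have h12 := h.e12
  have h1 := h.e1p
  have h2 := h.e2p
  simp only [mink, ContactElement.nullDir, inner_neg_right, mul_one] at h11 h22 h12 h1 h2
  have hn : inner ℝ e.normal e.normal = (1 : ℝ) := by
    rw [real_inner_self_eq_norm_sq, e.norm_normal, one_pow]
  have hsq := sq_inner_cross3 E₁.1 E₂.1 e.normal
  have k11 : inner ℝ E₁.1 E₁.1 = 1 + E₁.2 * E₁.2 := by linarith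
  have k22 : inner ℝ E₂.1 E₂.1 = 1 + E₂.2 * E₂.2 := by linarith
  have k12 : inner ℝ E₁.1 E₂.1 = E₁.2 * E₂.2 := by linarith
  have k1 : inner ℝ E₁.1 e.normal = -E₁.2 := by linarith
  have k2 : inner ℝ E₂.1 e.normal = -E₂.2 := by linarith
  rw [hn, k11, k22, k12, k1, k2] at hsq
  intro h0
  rw [frameOrientation] at h0
  rw [h0] at hsq
  ring_nf at hsq
  norm_num at hsq

lemma frameOrientation_neg (n : E3) (E₁ E₂ : R41) :
    frameOrientation n E₁ (-E₂) = -frameOrientation n E₁ E₂ := by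
  simp only [frameOrientation, inner_E3, cross3_zero, cross3_one, cross3_two, Prod.fst_neg,
    PiLp.neg_apply]
  ring

lemma frameOrientation_comb (n : E3) (E₁ E₂ : R41) (a b c d : ℝ) :
    frameOrientation n (a • E₁ + b • E₂) (c • E₁ + d • E₂) =
      (a * d - b * c) * frameOrientation n E₁ E₂ := by
  simp only [frameOrientation, inner_E3, cross3_zero, cross3_one, cross3_two, Prod.fst_add,
    Prod.smul_fst, PiLp.add_apply, PiLp.smul_apply, smul_eq_mul]
  ring

/-- An orthonormal basis of the orthogonal complement of the null directions of two contact
elements, positively oriented with respect to the first. -/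
def IsOrientedFrame (e e' : ContactElement) (E₁ E₂ : R41) : Prop :=
  IsNullBasis E₁ E₂ e.nullDir (nullFactor e e' • e'.nullDir) ∧ 0 < frameOrientation e.normal E₁ E₂

/-- The product form does not depend on the oriented orthonormal frame. -/
lemma IsOrientedFrame.frameForm_mul_eq {e e' : ContactElement} {F₁ F₂ : R41}
    (h : IsOrientedFrame e e' E₁ E₂) (h' : IsOrientedFrame e e' F₁ F₂) (w z : R41) :
    frameForm F₁ F₂ w * frameForm F₁ (-F₂) z = frameForm E₁ E₂ w * frameForm E₁ (-E₂) z := by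
  have x1 := h.1.expansion F₁
  have x2 := h.1.expansion F₂
  rw [h'.1.e1p, h'.1.e1q, zero_smul, zero_smul, sub_zero, sub_zero] at x1
  rw [h'.1.e2p, h'.1.e2q, zero_smul, zero_smul, sub_zero, sub_zero] at x2
  have h11 := h'.1.e11
  have h22 := h'.1.e22
  have h12 := h'.1.e12
  have ho := h'.2
  generalize mink F₁ E₁ = a at x1
  generalize mink F₁ E₂ = b at x1
  generalize mink F₂ E₁ = c at x2
  generalize mink F₂ E₂ = d at x2
  subst x1 x2
  rw [frameOrientation_comb] at ho
  simp only [mink_add_left, mink_add_right, mink_smul_left, mink_smul_right, h.1.e11,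
    h.1.e22, h.1.e12, mink_comm E₂ E₁] at h11 h22 h12
  have e1 : a ^ 2 + b ^ 2 = 1 := by linarith
  have e2 : c ^ 2 + d ^ 2 = 1 := by linarith
  have e3 : a * c + b * d = 0 := by linarith
  have hdet : (a * d - b * c) ^ 2 = 1 := by
    linear_combination (c ^ 2 + d ^ 2) * e1 + e2 - (a * c + b * d) * e3
  -- Equally oriented frames differ by a rotation, which multiplies the first form by a - ib and the
  -- conjugated form by a + ib, of product 1.
  have hpos : 0 < a * d - b * c := pos_of_mul_pos_left ho h.2.le
  have h1 : a * d - b * c = 1 := (pow_eq_one_iff_of_nonneg hpos.le two_ne_zero).mp hdet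
  have hd : d = a := by linear_combination -d * h1 - c * e3 + a * e2
  have hc : c = -b := by linear_combination -b * h1 + a * e3 - c * e1
  subst hd hc
  apply Complex.ext
  · simp only [Complex.mul_re, frameForm_re, frameForm_im, mink_add_right, mink_smul_right,
      mink_neg_right]
    linear_combination (mink w E₁ * mink z E₁ + mink w E₂ * mink z E₂) * e1
  · simp only [Complex.mul_im, frameForm_re, frameForm_im, mink_add_right, mink_smul_right,
      mink_neg_right]
    linear_combination (mink w E₂ * mink z E₁ - mink w E₁ * mink z E₂) * e1

open Classical in
/-- The quadratic differential of a pair of envelopes: the complexified product of the shape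
operators of the two null normals. -/
def quadDiff (F G : M → ContactElement) (p : M) (v : TangentSpace (𝓡 2) p) : ℂ :=
  if h : ∃ E : R41 × R41, IsOrientedFrame (F p) (G p) E.1 E.2 then
    nullFactor (F p) (G p) *
      (frameDiff h.choose.1 h.choose.2 (fun q => (F q).nullDir) p v *
        frameDiff h.choose.1 (-h.choose.2) (fun q => (G q).nullDir) p v)
  else 0

/-- Makes the frame chosen in the definition irrelevant, so the local expressions agree on overlaps.
-/
lemma quadDiff_eq (h : IsOrientedFrame (F p) (G p) E₁ E₂) (v : TangentSpace (𝓡 2) p) :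
    quadDiff F G p v = nullFactor (F p) (G p) *
      (frameDiff E₁ E₂ (fun q => (F q).nullDir) p v *
        frameDiff E₁ (-E₂) (fun q => (G q).nullDir) p v) := by
  have hex : ∃ E : R41 × R41, IsOrientedFrame (F p) (G p) E.1 E.2 := ⟨(E₁, E₂), h⟩
  rw [quadDiff, dif_pos hex]
  simp only [frameDiff_apply]
  rw [h.frameForm_mul_eq hex.choose_spec]

variable [IsManifold (𝓡 2) ∞ M]

/-- Local coordinates whose squared differential is the quadratic differential, and adapted frames
in which it is the product of the forms of the two envelopes. -/
lemma exists_coordinate_quadDiff (hS : IsSpacelikeImmersion S) (hflat : HasFlatInducedMetric S)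
    (hnormal : HasFlatNormalBundle S) (hU : IsOpen U) (hFG : IsEnvelopingPairOn S U F G)
    (hF : ThirdFormPosDefOn U F) (hG : ThirdFormPosDefOn U G) {p₀ : M} (hp₀ : p₀ ∈ U) :
    ∃ (W : Set M) (z : M → ℂ), IsOpen W ∧ p₀ ∈ W ∧ W ⊆ U ∧
      ContMDiffOn (𝓡 2) 𝓘(ℝ, ℂ) ∞ z W ∧ ∀ p ∈ W,
        (∀ v, diff z p v ^ 2 = quadDiff F G p v) ∧ ∃ E₁ E₂, IsAdaptedFrameAt S F G p E₁ E₂ ∧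
          IsOrientedFrame (F p) (G p) E₁ E₂ := by
  obtain ⟨W, E₁, E₂, z, hW, hpW, hWU, hE₁, hE₂, hz, h⟩ :=
    exists_adaptedFrame hS hflat hnormal hU hFG hF hG hp₀
  have hor : ContinuousOn (fun p => frameOrientation (F p).normal (E₁ p) (E₂ p)) W := by
    have hn : ContinuousOn (fun p => (F p).normal) W := (hFG.1.1.2.1.mono hWU).continuousOn
    have h1 : ∀ i, ContinuousOn (fun p => (E₁ p).1 i) W := fun i =>
      (PiLp.continuous_apply 2 _ i).comp_continuousOn hE₁.fst
    have h2 : ∀ i, ContinuousOn (fun p => (E₂ p).1 i) W := fun i =>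
      (PiLp.continuous_apply 2 _ i).comp_continuousOn hE₂.fst
    have h3 : ∀ i, ContinuousOn (fun p => (F p).normal i) W := fun i =>
      (PiLp.continuous_apply 2 _ i).comp_continuousOn hn
    simp only [frameOrientation, inner_E3, cross3_zero, cross3_one, cross3_two]
    exact (((((h1 1).mul (h2 2)).sub ((h1 2).mul (h2 1))).mul (h3 0)).add
      ((((h1 2).mul (h2 0)).sub ((h1 0).mul (h2 2))).mul (h3 1))).add
      ((((h1 0).mul (h2 1)).sub ((h1 1).mul (h2 0))).mul (h3 2))
  -- The orientation is continuous and nonzero, so it keeps its sign near `p₀`. A negative frame is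
  -- reflected; this conjugates the product of the forms, and z is replaced by its conjugate.
  rcases (frameOrientation_ne_zero (h p₀ hpW).1.basis).lt_or_gt with hneg | hpos
  · refine ⟨W ∩ (fun p => frameOrientation (F p).normal (E₁ p) (E₂ p)) ⁻¹' Set.Iio 0,
      fun p => conj (z p), hor.isOpen_inter_preimage hW isOpen_Iio, ⟨hpW, hneg⟩,
      Set.inter_subset_left.trans hWU, ?_, ?_⟩
    · exact (Complex.conjCLE.contDiff (n := ∞)).contMDiff.comp_contMDiffOn
        (hz.mono Set.inter_subset_left)
    · rintro p ⟨hp, hpneg⟩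
      have hof : IsOrientedFrame (F p) (G p) (E₁ p) (-E₂ p) := by
        refine ⟨(h p hp).1.neg.basis, ?_⟩
        rw [frameOrientation_neg]
        exact neg_pos.mpr hpneg
      refine ⟨fun v => ?_, _, _, (h p hp).1.neg, hof⟩
      have hd : diff (fun p => conj (z p)) p v = conj (diff z p v) := by
        have := diff_comp (Φ := Complex.conjCLE) Complex.conjCLE.differentiableAt
          (mdifferentiableAt_of_contMDiffOn hW hz hp) v
        rw [ContinuousLinearEquiv.fderiv] at this
        exact this
      rw [quadDiff_eq hof, hd, ← map_pow, (h p hp).2 v, neg_neg, map_mul, map_mul,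
        Complex.conj_ofReal, frameDiff_neg, frameDiff_neg, Complex.conj_conj]
  · refine ⟨W ∩ (fun p => frameOrientation (F p).normal (E₁ p) (E₂ p)) ⁻¹' Set.Ioi 0,
      z, hor.isOpen_inter_preimage hW isOpen_Ioi, ⟨hpW, hpos⟩,
      Set.inter_subset_left.trans hWU, hz.mono Set.inter_subset_left, ?_⟩
    rintro p ⟨hp, hppos⟩
    refine ⟨fun v => ?_, _, _, (h p hp).1, (h p hp).1.basis, hppos⟩
    rw [quadDiff_eq ⟨(h p hp).1.basis, hppos⟩, (h p hp).2 v]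

/-- Both envelopes of a flat congruence are L-isothermic. -/
theorem isLIsothermicOn_left (hS : IsSpacelikeImmersion S) (hflat : HasFlatInducedMetric S)
    (hnormal : HasFlatNormalBundle S) (hU : IsOpen U) (hFG : IsEnvelopingPairOn S U F G)
    (hF : ThirdFormPosDefOn U F) (hG : ThirdFormPosDefOn U G) : IsLIsothermicOn U F := by
  refine ⟨quadDiff F G, fun p₀ hp₀ => ?_⟩
  obtain ⟨W, z, hW, hpW, hWU, hz, hzq⟩ :=
    exists_coordinate_quadDiff hS hflat hnormal hU hFG hF hG hp₀
  have hre : ∀ p ∈ W, ∀ v, diff (fun p => (z p).re) p v = (diff z p v).re := by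
    intro p hp v
    have := diff_comp (Φ := Complex.reCLM) Complex.reCLM.differentiableAt
      (mdifferentiableAt_of_contMDiffOn hW hz hp) v
    rw [ContinuousLinearMap.fderiv] at this
    exact this
  have him : ∀ p ∈ W, ∀ v, diff (fun p => (z p).im) p v = (diff z p v).im := by
    intro p hp v
    have := diff_comp (Φ := Complex.imCLM) Complex.imCLM.differentiableAt
      (mdifferentiableAt_of_contMDiffOn hW hz hp) v
    rw [ContinuousLinearMap.fderiv] at this
    exact this
  refine ⟨W, fun p => (z p).re, fun p => (z p).im, hW, hpW, hWU,
    ⟨(Complex.reCLM.contDiff (n := ∞)).contMDiff.comp_contMDiffOn hz,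
      (Complex.imCLM.contDiff (n := ∞)).contMDiff.comp_contMDiffOn hz, fun p hp => ?_⟩,
    fun p hp v => ?_⟩
  · obtain ⟨hzp, E₁, E₂, h, hof⟩ := hzq p hp
    have hpU := hWU hp
    obtain ⟨μ, hμ, hB⟩ := h.exists_ratio hU hFG hF hG hpU
    obtain ⟨t, a, hta⟩ := h.exists_proportion hU hFG hF hG hpU
    have hκ := nullFactor_pos (hFG.normal_ne hpU)
    have hA := frameDiff_injective hU hFG.1.1 hpU h.basis hF
    have hz2 : ∀ v, diff z p v ^ 2 = nullFactor (F p) (G p) *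
        (frameDiff E₁ E₂ (fun q => (F q).nullDir) p v *
          frameDiff E₁ (-E₂) (fun q => (G q).nullDir) p v) := fun v => by
      rw [hzp, quadDiff_eq hof]
    -- Taking absolute values in dz² = κAB with B = μA gives dx² + dy² = κ|μ||A|², and |A|² is the
    -- third form of `F`.
    have hnorm : ∀ v, (diff z p v).re ^ 2 + (diff z p v).im ^ 2 = nullFactor (F p) (G p) * ‖μ‖ *
        ‖frameDiff E₁ E₂ (fun q => (F q).nullDir) p v‖ ^ 2 := by
      intro v
      have h1 := congrArg norm (hz2 v)
      rw [hB, norm_pow, norm_mul, norm_mul, norm_mul, Complex.norm_real, Real.norm_of_nonneg hκ.le,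
        Complex.sq_norm, Complex.normSq_apply] at h1
      linear_combination h1
    have hcpos : 0 < nullFactor (F p) (G p) * ‖μ‖ := mul_pos hκ (norm_pos_iff.mpr hμ)
    refine ⟨?_, ⟨(nullFactor (F p) (G p) * ‖μ‖)⁻¹, inv_pos.mpr hcpos, fun v => ?_⟩, ?_⟩
    · have hinj : Function.Injective (diff z p).toLinearMap := by
        rw [injective_iff_map_eq_zero]
        intro v hv
        have h1 := hnorm v
        have h2 : diff z p v = 0 := hv
        rw [h2] at h1
        have h3 : ‖frameDiff E₁ E₂ (fun q => (F q).nullDir) p v‖ ^ 2 = 0 := by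
          simpa [hcpos.ne', hκ.ne', hμ] using h1.symm
        exact hA (by rw [map_zero]; simpa using h3)
      have : FiniteDimensional ℝ (TangentSpace (𝓡 2) p) :=
        FiniteDimensional.of_finrank_pos (by rw [finrank_tangentSpace]; norm_num)
      have hsurj := (LinearMap.injective_iff_surjective_of_finrank_eq_finrank
        (by rw [finrank_tangentSpace, Complex.finrank_real_complex])).mp hinj
      rw [LinearIndependent.pair_iff]
      intro c d hcd
      -- At a vector with dz(v) = c + id the relation c dx + d dy = 0 reads c² + d² = 0.
      obtain ⟨v, hv⟩ := hsurj ⟨c, d⟩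
      have hv' : diff z p v = ⟨c, d⟩ := hv
      have h1 := congrArg (fun L => L v) hcd
      have h2 : c * diff (fun p => (z p).re) p v + d * diff (fun p => (z p).im) p v = 0 := h1
      rw [hre p hp, him p hp, hv'] at h2
      simp only at h2
      constructor <;> nlinarith [sq_nonneg c, sq_nonneg d]
    · rw [hre p hp, him p hp, hnorm, thirdForm_self_eq hU hFG.1.1 hpU h.basis,
        inv_mul_cancel_left₀ hcpos.ne']
    · intro v hv hxy
      rw [hre p hp, him p hp] at hxy
      rw [h.isPrincipal_left hU hS.1 hFG hpU, (hta v).1]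
      refine ⟨hv, ?_⟩
      -- The imaginary part of dz² is 2 dx dy, so Im(BA) vanishes on the coordinate lines, and with
      -- it its real multiple that detects principal directions.
      have h1 := congrArg Complex.im (hz2 v)
      rw [Complex.im_ofReal_mul, sq, Complex.mul_im, mul_comm (frameDiff E₁ E₂ _ p v)] at h1
      have h2 : (diff z p v).re * (diff z p v).im + (diff z p v).im * (diff z p v).re = 0 := by
        rcases hxy with h0 | h0 <;> rw [h0] <;> ring
      rw [h2] at h1
      rw [(mul_eq_zero.mp h1.symm).resolve_left hκ.ne', mul_zero]
  · rw [← (hzq p hp).1 v, hre p hp, him p hp, Complex.re_add_im]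

end QuadraticDifferential

end

/-! ### The theorem assembled -/

theorem theorem1 {M : Type*} [TopologicalSpace M] [ChartedSpace E2 M] [IsManifold (𝓡 2) ∞ M]
    (S : M → R41) (hS : IsSpacelikeImmersion S)
    (hflat : HasFlatInducedMetric S) (hnormal : HasFlatNormalBundle S) :
    (∀ p : M, ∃ (U : Set M) (F G : M → ContactElement), IsOpen U ∧ p ∈ U ∧
      IsEnvelopingPairOn S U F G ∧
      ∀ (V : Set M) (H : M → ContactElement), IsOpen V → V ⊆ U → EnvelopesOn S V H →
        ∀ p' ∈ V, H p' = F p' ∨ H p' = G p') ∧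
    (∀ (U : Set M) (F G : M → ContactElement), IsOpen U → IsEnvelopingPairOn S U F G →
      ThirdFormPosDefOn U F → ThirdFormPosDefOn U G →
        DarbouxConditionOn U F G ∧ OppositelyOrientedOn S U F G ∧
          IsLIsothermicOn U F ∧ IsLIsothermicOn U G) := by
  refine ⟨exists_enveloping_pair hS, fun U F G hU hFG hF hG => ?_⟩
  have hframe : ∀ p ∈ U, ∃ E₁ E₂, IsAdaptedFrameAt S F G p E₁ E₂ := by
    intro p hp
    obtain ⟨_, E₁, E₂, _, _, hpW, _, _, _, _, h⟩ :=
      exists_adaptedFrame hS hflat hnormal hU hFG hF hG hp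
    exact ⟨_, _, (h p hpW).1⟩
  refine ⟨⟨fun p hp => ?_, fun p hp => ?_⟩, fun p hp e₂ he₂ e₃ he₃ h22 h33 h23 v w hvw => ?_,
    isLIsothermicOn_left hS hflat hnormal hU hFG hF hG,
    -- The hypotheses are symmetric in the two envelopes, so the second one is treated by exchanging
    -- them.
    isLIsothermicOn_left hS hflat hnormal hU hFG.symm hG hF⟩
  · obtain ⟨E₁, E₂, h⟩ := hframe p hp
    exact h.curvatureLinesCorrespond hU hS.1 hFG hF hG hp
  · obtain ⟨E₁, E₂, h⟩ := hframe p hp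
    exact h.thirdForms_conformal hU hFG hF hG hp
  · obtain ⟨E₁, E₂, h⟩ := hframe p hp
    exact h.tangentialArea_mul_neg hU hS.1 hFG hF hG hp he₂ he₃ h22 h33 h23 hvw
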